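/- Let $k\ge 2$ and $n\ge 2$ be integers, let $a$ be the largest divisor of $n$ that is coprime to $k$, and put $$N[k,n]=\frac{1}{kn}\sum_{d\mid a}\varphi(d)\,k^{n/d},$$ where $\varphi$ is Euler's totient function. Then $N[k,n]$ is an integer, and there is a nonempty open set $U\subset\mathbb{R}^n\times\mathbb{R}^n$ such that the following holds for every $r\in\{1,2,\dots\}\cup\{\infty\}$, every $(c^L,c^R)\in U$, and every map of the form $$f(x;\mu)=\begin{cases}C_Lx+\mu e_1+E_L(x;\mu),&x_1\le 0,\\ C_Rx+\mu e_1+E_R(x;\mu),&x_1\ge 0,\end{cases}\qquad x\in\mathbb{R}^n,\ \mu\in\mathbb{R},$$ (the two formulas agreeing when $x_1=0$). Here $C_L$, $C_R$ are the companion matrices with first columns $c^L$, $c^R$, ones on the superdiagonal and zeros elsewhere, and each of $E_L,E_R:\mathbb{R}^n\times\mathbb{R}\to\mathbb{R}^n$ is $C^1$ in $(x;\mu)$ near $(0;0)$, is $o(\|x\|+|\mu|)$ as $(x;\mu)\to(0;0)$, and near $(0;0)$ is $C^r$ as a function of $x$. There exists $\mu_0>0$ such that 1. for all $\mu\in(-\mu_0,0)$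 the map $x\mapsto f(x;\mu)$ has an asymptotically stable fixed point; 2. for all $\mu\in(0,\mu_0)$ there are $N[k,n]$ mutually disjoint nonempty trapping regions $\Omega$ for $f(\cdot;\mu)$, that is, compact sets with $f(\Omega;\mu)\subset\operatorname{int}(\Omega)$, on each of which the $kn$-th iterate $f^{kn}$ is piecewise-$C^r$ and expanding. The last phrase means that $f^{kn}$ maps $\Omega$ into $\Omega$ and that there are finitely many mutually disjoint open sets $\Omega_i\subset\Omega$ with piecewise-$C^r$ boundary such that $\Omega=\bigcup_i\overline{\Omega_i}$, that on each $\Omega_i$ the map $f^{kn}$ is $C^r$ and agrees with a map that is $C^r$ on a neighbourhood of $\overline{\Omega_i}$, and that for some $\lambda>1$ we have $\|\mathrm{D}(f^{kn})(x)v\|\ge\lambda\|v\|$ for all $x\in\bigcup_i\Omega_i$ and all $v\in\mathbb{R}^n$, with the Euclidean norm. An open set $W$ has piecewise-$C^r$ boundary if every $p\in\partial W$ has an open neighbourhood $V$ with $W\cap V=\{x\in V: g_1(x)>0,\dots,g_m(x)>0\}$ for finitely many $C^r$ functions $g_i:V\to\mathbb{R}$ that vanish at $p$ and have linearly independent derivatives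 there. -/

import Mathlib

open Set Filter Topology Asymptotics

noncomputable section

/-- The companion matrix with first column `c` and ones on the superdiagonal. -/
def companion {n : ℕ} (c : EuclideanSpace ℝ (Fin n)) : Matrix (Fin n) (Fin n) ℝ :=
  Matrix.of fun i j =>
    if (j : ℕ) = 0 then c i else if (j : ℕ) = (i : ℕ) + 1 then 1 else 0

/-- One smooth piece `x ↦ C x + μ e₁ + E(x; μ)`, where `C` is the companion matrix of `c`. -/
def bcPiece {n : ℕ} [NeZero n] (c : EuclideanSpace ℝ (Fin n))
    (E : EuclideanSpace ℝ (Fin n) × ℝ → EuclideanSpace ℝ (Fin n))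
    (x : EuclideanSpace ℝ (Fin n)) (μ : ℝ) : EuclideanSpace ℝ (Fin n) :=
  Matrix.toEuclideanLin (companion c) x + μ • EuclideanSpace.single (0 : Fin n) (1 : ℝ) + E (x, μ)

/-- An admissible nonlinear term: `C¹` in `(x; μ)` near the origin, `o(‖x‖ + |μ|)`, and, near the
origin, of class `C^r` in `x`. -/
structure IsHigherOrderTerm {n : ℕ} (r : ℕ∞)
    (E : EuclideanSpace ℝ (Fin n) × ℝ → EuclideanSpace ℝ (Fin n)) : Prop where
  contDiffAt : ContDiffAt ℝ 1 E (0, 0)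
  isLittleO : E =o[𝓝 (0, 0)] fun p => ‖p.1‖ + |p.2|
  smooth_slice : ∀ᶠ p in 𝓝 ((0, 0) : EuclideanSpace ℝ (Fin n) × ℝ),
    ContDiffAt ℝ r (fun x => E (x, p.2)) p.1

/-- `f = f(x; μ)` is a piecewise-`C^r` map given by the border-collision normal form with
parameters `cL`, `cR` plus higher order terms. Both formulas hold on the switching manifold
`x₁ = 0`, so `f` is continuous across it. -/
def IsBorderCollisionMap {n : ℕ} [NeZero n] (r : ℕ∞) (cL cR : EuclideanSpace ℝ (Fin n))
    (f : EuclideanSpace ℝ (Fin n) → ℝ → EuclideanSpace ℝ (Fin n)) : Prop :=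
  ∃ EL ER : EuclideanSpace ℝ (Fin n) × ℝ → EuclideanSpace ℝ (Fin n),
    IsHigherOrderTerm r EL ∧ IsHigherOrderTerm r ER ∧
    (∀ x μ, x 0 ≤ 0 → f x μ = bcPiece cL EL x μ) ∧
    (∀ x μ, 0 ≤ x 0 → f x μ = bcPiece cR ER x μ)

/-- Asymptotic stability of a fixed point: Lyapunov stable and locally attracting. -/
structure IsAsympStableFixedPt {X : Type*} [TopologicalSpace X] (F : X → X) (p : X) : Prop where
  isFixedPt : Function.IsFixedPt F p
  stable : ∀ U ∈ 𝓝 p, ∃ V ∈ 𝓝 p, ∀ x ∈ V, ∀ j : ℕ, F^[j] x ∈ U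
  attracting : ∃ V ∈ 𝓝 p, ∀ x ∈ V, Tendsto (fun j : ℕ => F^[j] x) atTop (𝓝 p)

/-- A trapping region: a compact set mapped into its own interior. -/
def IsTrappingRegion {X : Type*} [TopologicalSpace X] (F : X → X) (Ω : Set X) : Prop :=
  IsCompact Ω ∧ F '' Ω ⊆ interior Ω

/-- The set `W` has a piecewise-`C^r` boundary: near each boundary point `p` it is the
intersection of finitely many sides `{g i > 0}` of `C^r` hypersurfaces `{g i = 0}` through `p`
that are in general position there (a domain with corners). -/
def HasPiecewiseCrBoundary {E : Type*} [NormedAddCommGroup E] [NormedSpace ℝ E] (r : ℕ∞)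
    (W : Set E) : Prop :=
  ∀ p ∈ frontier W, ∃ V : Set E, IsOpen V ∧ p ∈ V ∧ ∃ (m : ℕ) (g : Fin m → E → ℝ),
    (∀ i, ContDiffOn ℝ r (g i) V) ∧ (∀ i, g i p = 0) ∧
    LinearIndependent ℝ (fun i => fderiv ℝ (g i) p) ∧
    W ∩ V = {x ∈ V | ∀ i, 0 < g i x}

/-- `F : Ω → Ω` is piecewise-`C^r` with pieces `P 0, …, P (m - 1)`. -/
structure IsPiecewiseCr {E : Type*} [NormedAddCommGroup E] [NormedSpace ℝ E] (r : ℕ∞)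
    (F : E → E) (Ω : Set E) {m : ℕ} (P : Fin m → Set E) : Prop where
  isCompact : IsCompact Ω
  mapsTo : MapsTo F Ω Ω
  isOpen : ∀ i, IsOpen (P i)
  subset : ∀ i, P i ⊆ Ω
  disjoint : Pairwise fun i j => Disjoint (P i) (P j)
  boundary : ∀ i, HasPiecewiseCrBoundary r (P i)
  cover : Ω = ⋃ i, closure (P i)
  smooth : ∀ i, ContDiffOn ℝ r F (P i)
  extend : ∀ i, ∃ (G : E → E) (O : Set E), IsOpen O ∧ closure (P i) ⊆ O ∧
    ContDiffOn ℝ r G O ∧ EqOn G F (P i)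

/-- `F` expands uniformly on the union of the pieces `P i`. -/
def IsExpandingOnPieces {E : Type*} [NormedAddCommGroup E] [NormedSpace ℝ E]
    (F : E → E) {m : ℕ} (P : Fin m → Set E) : Prop :=
  ∃ l : ℝ, 1 < l ∧ ∀ x ∈ ⋃ i, P i, ∀ v : E, l * ‖v‖ ≤ ‖fderiv ℝ F x v‖

/-- `F` is piecewise-`C^r` and expanding on `Ω`. -/
def IsPiecewiseCrExpanding {E : Type*} [NormedAddCommGroup E] [NormedSpace ℝ E] (r : ℕ∞)
    (F : E → E) (Ω : Set E) : Prop :=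
  ∃ (m : ℕ) (P : Fin m → Set E), IsPiecewiseCr r F Ω P ∧ IsExpandingOnPieces F P

end

/-! The model case has companion columns `(0, …, 0, s)` on the left and `(0, …, 0, -A)` on the
right, without higher order terms. For `μ > 0`, scaling by `μ` and translating by `(0, 1, …, 1)`
turns the map into the delay map `(y₁, …, yₙ) ↦ (y₂, …, yₙ, g y₁)`, where `g` is the skew tent map
with slopes `s`, `-A` and maximum `g 0 = 1`. The `n`-th iterate of a delay map is a product of `n`
copies of `g`.

Choose `s` and `A` so that `g` permutes `k` disjoint intervals cyclically and the first return to
each of them has slopes of modulus at least `P > 1` (`exists_isTentCycle`). The products of `n` of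
these intervals are boxes indexed by words in `(ℤ/k)ⁿ`, and the delay map sends the box of `x` into
the box of `(x₂, …, xₙ, x₁ + 1)`. The union of the boxes over an orbit of this shift is a trapping
region once the intervals are slightly enlarged. The shift satisfies `σ^[k * n] = id`, so Burnside's
lemma counts the orbits (`exists_orbit_labelling_cycShift`). The `k * n`-th iterate of the delay map
has a diagonal derivative whose entries are first-return slopes of `g`, so it expands.

All of this survives a `C¹`-small perturbation of the two branches
(`exists_trapping_regions_of_close`). The delicate point is the shape of the pieces, the sets of
points of a box with a prescribed itinerary. To leading order each inequality defining a piece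
involves a single coordinate. Inequalities that are active at a common point involve different
coordinates (`constraintCoord_injective`), so their derivatives form a diagonally dominant family.
Hence they are independent, which gives boundaries with corners, and they increase along a common
direction, which shows that the closed pieces cover the boxes.

For `μ < 0` the rescaled left branch is close to `y ↦ (y₂, …, yₙ, s y₁ - 1)`. With `s = 2⁻ⁿ` this
halves a weighted Euclidean norm, and its fixed point lies strictly on the left, so a nearby stable
fixed point persists (`exists_isAsympStableFixedPt_of_close`).

A general border-collision map, with columns near the model ones, becomes such a perturbation as `μ
→ 0`: the rescaled higher order terms tend to zero in `C¹` on bounded sets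
(`exists_scaledBranch_close`). The closeness required depends neither on `r` nor on the map, so a
single open set `U` serves all of them. -/

/-! ### Counting the orbits of the cyclic shift -/

/-- A labelling of the orbits of a map `σ` with `σ^[m] = id` on a finite type, and the number of
orbits by Burnside's lemma. -/
theorem exists_orbit_labelling {X : Type*} [Fintype X] [DecidableEq X] (σ : X → X) (m : ℕ)
    [NeZero m] (hσ : ∀ x, σ^[m] x = x) :
    ∃ (N : ℕ) (orb : X → Fin N), Function.Surjective orb ∧ (∀ x, orb (σ x) = orb x) ∧
      N * m = ∑ t ∈ Finset.range m, (Finset.univ.filter fun x => σ^[t] x = x).card := by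
  classical
  let _ : AddAction (ZMod m) X :=
    { vadd := fun z x => σ^[z.val] x
      zero_vadd := fun x => by
        change σ^[(0 : ZMod m).val] x = x
        simp
      add_vadd := fun a b x => by
        change σ^[(a + b).val] x = σ^[a.val] (σ^[b.val] x)
        rw [ZMod.val_add, ← Function.iterate_add_apply]
        exact Function.IsPeriodicPt.iterate_mod_apply (hσ x) _ }
  have hv : ∀ (z : ZMod m) (x : X), z +ᵥ x = σ^[z.val] x := fun _ _ => rfl
  let Q := Quotient (AddAction.orbitRel (ZMod m) X)
  have : Fintype Q := Fintype.ofFinite Q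
  let e : Q ≃ Fin (Fintype.card Q) := Fintype.equivFin Q
  refine ⟨Fintype.card Q, fun x => e (Quotient.mk _ x), ?_, ?_, ?_⟩
  · exact e.surjective.comp Quotient.mk_surjective
  · intro x
    refine congrArg e (Quotient.sound ?_)
    refine AddAction.orbitRel_apply.2 ⟨((1 : ℕ) : ZMod m), ?_⟩
    change ((1 : ℕ) : ZMod m) +ᵥ x = σ x
    rw [hv, ZMod.val_natCast]
    exact Function.IsPeriodicPt.iterate_mod_apply (hσ x) 1
  · have h := AddAction.sum_card_fixedBy_eq_card_orbits_mul_card_addGroup (ZMod m) X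
    rw [ZMod.card] at h
    refine (Eq.trans ?_ h).symm
    symm
    refine Finset.sum_nbij' ZMod.val (fun t => (t : ZMod m)) ?_ ?_ ?_ ?_ ?_
    · intro z _
      exact Finset.mem_range.2 (ZMod.val_lt z)
    · intro t _
      exact Finset.mem_univ _
    · intro z _
      simp
    · intro t ht
      exact ZMod.val_cast_of_lt (Finset.mem_range.1 ht)
    · intro z _
      rw [Fintype.card_subtype]
      rfl

/-! ### Words over `ℤ/k` and the fixed points of the powers of the shift. -/

section CyclicShift

variable {k n : ℕ} [NeZero n]

/-- The shift `(x₁, …, xₙ) ↦ (x₂, …, xₙ, x₁ + 1)` on words over `ℤ/k`. -/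
def cycShift (x : Fin n → ZMod k) (l : Fin n) : ZMod k :=
  if h : (l : ℕ) + 1 < n then x ⟨l + 1, h⟩ else x 0 + 1

/-- The residue of `j` modulo `n`. -/
def resid (n : ℕ) [NeZero n] (j : ℕ) : Fin n := ⟨j % n, Nat.mod_lt _ (NeZero.pos n)⟩

/-- The extension of a word to a sequence with `u (j + n) = u j + 1`. -/
def seqExt (x : Fin n → ZMod k) (j : ℕ) : ZMod k := x (resid n j) + ((j / n : ℕ) : ZMod k)

theorem resid_val (l : Fin n) : resid n (l : ℕ) = l :=
  Fin.ext (Nat.mod_eq_of_lt l.2)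

theorem seqExt_fin (x : Fin n → ZMod k) (l : Fin n) : seqExt x l = x l := by
  simp [seqExt, resid_val, Nat.div_eq_of_lt l.2]

theorem resid_add_mul (j u : ℕ) : resid n (j + u * n) = resid n j :=
  Fin.ext (by simp [resid])

theorem seqExt_add_mul (x : Fin n → ZMod k) (j u : ℕ) :
    seqExt x (j + u * n) = seqExt x j + u := by
  simp only [seqExt, resid_add_mul, Nat.add_mul_div_right _ _ (NeZero.pos n)]
  push_cast
  ring

theorem seqExt_add_card (x : Fin n → ZMod k) (j : ℕ) : seqExt x (j + n) = seqExt x j + 1 := by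
  simpa using seqExt_add_mul x j 1

/-- The rule `u (j + n) = u j + 1` absorbs the twist in the last letter, so on extended sequences
the shift is plain translation. -/
theorem seqExt_cycShift (x : Fin n → ZMod k) (j : ℕ) :
    seqExt (cycShift x) j = seqExt x (j + 1) := by
  have key : ∀ l : Fin n, seqExt (cycShift x) l = seqExt x (l + 1) := by
    intro l
    rw [seqExt_fin, cycShift]
    split_ifs with h
    · exact (seqExt_fin x ⟨l + 1, h⟩).symm
    · have : (l : ℕ) + 1 = ((0 : Fin n) : ℕ) + n := by
        have := l.2
        simp
        omega
      rw [this, seqExt_add_card, seqExt_fin]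
  have h1 := seqExt_add_mul (cycShift x) (resid n j) (j / n)
  have h2 := seqExt_add_mul x (resid n j + 1) (j / n)
  have e1 : (resid n j : ℕ) + j / n * n = j := by
    simp only [resid]
    rw [mul_comm]
    exact Nat.mod_add_div _ _
  have e2 : (resid n j : ℕ) + 1 + j / n * n = j + 1 := by omega
  rw [e1] at h1
  rw [e2] at h2
  rw [h1, h2, key]

theorem seqExt_iterate_cycShift (x : Fin n → ZMod k) (t j : ℕ) :
    seqExt (cycShift^[t] x) j = seqExt x (j + t) := by
  induction t generalizing j with
  | zero => rfl
  | succ t ih =>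
    rw [Function.iterate_succ_apply', seqExt_cycShift, ih]
    congr 1
    omega

theorem iterate_cycShift_apply (x : Fin n → ZMod k) (t : ℕ) (l : Fin n) :
    (cycShift^[t] x) l = seqExt x (l + t) := by
  rw [← seqExt_fin (cycShift^[t] x), seqExt_iterate_cycShift]

theorem iterate_cycShift_mul (x : Fin n → ZMod k) : cycShift^[k * n] x = x := by
  funext l
  rw [iterate_cycShift_apply, seqExt_add_mul, seqExt_fin]
  simp

theorem iterate_cycShift_eq_iff (x : Fin n → ZMod k) (t : ℕ) :
    cycShift^[t] x = x ↔ ∀ j, seqExt x (j + t) = seqExt x j := by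
  constructor
  · intro h j
    rw [← seqExt_iterate_cycShift, h]
  · intro h
    funext l
    rw [iterate_cycShift_apply, h, seqExt_fin]

/-- Bézout with natural coefficients: a sequence on `ℕ` can only be translated forwards. -/
theorem exists_mul_eq_mul_add_gcd (t n : ℕ) (hn : 0 < n) :
    ∃ u v : ℕ, u * n = v * t + Nat.gcd t n := by
  rcases Nat.eq_zero_or_pos t with rfl | ht
  · exact ⟨1, 0, by simp⟩
  rcases lt_or_ge (Nat.gcd n t) t with h | h
  · obtain ⟨m, -, hm⟩ := Nat.exists_mul_mod_eq_gcd h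
    refine ⟨m, n * m / t, ?_⟩
    rw [Nat.gcd_comm t n, ← hm, mul_comm (n * m / t), Nat.div_add_mod, mul_comm]
  · have hg : Nat.gcd n t = t :=
      le_antisymm (Nat.le_of_dvd ht (Nat.gcd_dvd_right n t)) h
    obtain ⟨c, hc⟩ : t ∣ n := hg ▸ Nat.gcd_dvd_left n t
    rw [Nat.gcd_comm, hg]
    have hc0 : c ≠ 0 := by
      rintro rfl
      omega
    obtain ⟨c, rfl⟩ := Nat.exists_eq_succ_of_ne_zero hc0
    exact ⟨1, c, by rw [hc, Nat.succ_eq_add_one]; ring⟩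

/-- A word is fixed when its extension `u` has period `t`. With `g = gcd t n`, comparing `u` at `0`
and at `lcm t n` forces `t / g = 0` in `ℤ/k`. If that holds, Bézout gives `u (j + g) = u j + const`,
so the first `g` letters are free and determine the rest. -/
theorem card_fixed_iterate_cycShift [NeZero k] (t : ℕ) :
    (Finset.univ.filter fun x : Fin n → ZMod k => cycShift^[t] x = x).card =
      if k ∣ t / Nat.gcd t n then k ^ Nat.gcd t n else 0 := by
  have hn : 0 < n := NeZero.pos n
  set g := Nat.gcd t n with hg
  have hg0 : 0 < g := Nat.gcd_pos_of_pos_right _ hn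
  obtain ⟨t', ht'⟩ : g ∣ t := Nat.gcd_dvd_left t n
  obtain ⟨n', hn'⟩ : g ∣ n := Nat.gcd_dvd_right t n
  have hdiv : t / g = t' := by
    rw [ht']
    exact Nat.mul_div_cancel_left _ hg0
  have hrep : ∀ (x : Fin n → ZMod k), (∀ j, seqExt x (j + t) = seqExt x j) → ∀ v j,
      seqExt x (j + v * t) = seqExt x j := by
    intro x hx v
    induction v with
    | zero => simp
    | succ v ih =>
      intro j
      rw [Nat.succ_mul, ← add_assoc, hx, ih]
  rw [hdiv]
  split_ifs with hk
  · obtain ⟨u, v, huv⟩ := exists_mul_eq_mul_add_gcd t n hn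
    rw [← hg] at huv
    have ht0 : ((t' : ℕ) : ZMod k) = 0 := (ZMod.natCast_eq_zero_iff _ _).2 hk
    -- The increment `u` per `g` letters is consistent with the increment `1` per `n = g * n'`
    -- letters.
    have hu : (n' : ZMod k) * u = 1 := by
      have h1 : n' * u = v * t' + 1 := by
        apply Nat.eq_of_mul_eq_mul_left hg0
        calc g * (n' * u) = u * (g * n') := by ring
          _ = v * (g * t') + g := by rw [← hn', ← ht']; exact huv
          _ = _ := by ring
      have := congrArg (Nat.cast : ℕ → ZMod k) h1
      push_cast at this
      rw [this, ht0]
      ring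
    have hgl : ∀ x : Fin n → ZMod k, (∀ j, seqExt x (j + t) = seqExt x j) → ∀ j q,
        seqExt x (j + q * g) = seqExt x j + q * u := by
      intro x hx j q
      induction q with
      | zero => simp
      | succ q ih =>
        -- Going `g` forwards and then `v` periods `t` amounts to going `u * n` forwards, which adds
        -- `u`.
        have h1 := hrep x hx v (j + (q + 1) * g)
        have h2 : j + (q + 1) * g + v * t = j + q * g + u * n := by rw [huv]; ring
        rw [h2, seqExt_add_mul, ih] at h1
        rw [← h1]
        push_cast
        ring
    have hgn : g ≤ n := Nat.le_of_dvd hn ⟨n', hn'⟩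
    have hcard : k ^ g = Fintype.card (Fin g → ZMod k) := by simp [ZMod.card]
    rw [hcard, ← Finset.card_univ]
    refine Finset.card_nbij' (fun x i => x (Fin.castLE hgn i))
      (fun y l => y ⟨(l : ℕ) % g, Nat.mod_lt _ hg0⟩ +
        (((l : ℕ) / g : ℕ) : ZMod k) * (u : ZMod k)) ?_ ?_ ?_ ?_
    · intro x _
      exact Finset.mem_univ _
    · intro y _
      simp only [Finset.coe_filter, Finset.mem_univ, true_and, Set.mem_ofPred_eq]
      rw [iterate_cycShift_eq_iff]
      have hf : ∀ j, seqExt (fun l : Fin n => y ⟨(l : ℕ) % g, Nat.mod_lt _ hg0⟩ +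
          (((l : ℕ) / g : ℕ) : ZMod k) * (u : ZMod k)) j =
          y ⟨j % g, Nat.mod_lt _ hg0⟩ + ((j / g : ℕ) : ZMod k) * (u : ZMod k) := by
        intro j
        simp only [seqExt, resid]
        have e1 : j % n % g = j % g := Nat.mod_mod_of_dvd _ ⟨n', hn'⟩
        have e2 : j / g = j % n / g + n' * (j / n) := by
          conv_lhs => rw [← Nat.mod_add_div j n]
          have : n * (j / n) = g * (n' * (j / n)) := by
            rw [← mul_assoc, ← hn']
          rw [this, Nat.add_mul_div_left _ _ hg0]
        simp only [e1, e2]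
        push_cast
        linear_combination (-((j / n : ℕ) : ZMod k)) * hu
      intro j
      rw [hf, hf]
      have e1 : (j + t) % g = j % g := by rw [ht', Nat.add_mul_mod_self_left]
      have e2 : (j + t) / g = j / g + t' := by rw [ht', Nat.add_mul_div_left _ _ hg0]
      simp only [e1, e2]
      push_cast
      rw [ht0, add_zero]
    · intro x hx
      simp only [Finset.coe_filter, Finset.mem_univ, true_and, Set.mem_ofPred_eq] at hx
      rw [iterate_cycShift_eq_iff] at hx
      funext l
      have h1 := hgl x hx ((l : ℕ) % g) (l / g)
      rw [mul_comm ((l : ℕ) / g) g, Nat.mod_add_div, seqExt_fin] at h1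
      rw [h1]
      refine congrArg (· + _) ?_
      exact (seqExt_fin x ⟨(l : ℕ) % g, (Nat.mod_lt _ hg0).trans_le hgn⟩).symm
    · intro y _
      funext i
      simp [Nat.mod_eq_of_lt i.2, Nat.div_eq_of_lt i.2]
  · rw [Finset.card_eq_zero, Finset.filter_eq_empty_iff]
    intro x _ hx
    rw [iterate_cycShift_eq_iff] at hx
    apply hk
    have h1 := hrep x hx n' 0
    have h2 : 0 + n' * t = 0 + t' * n :=
      calc 0 + n' * t = 0 + n' * (g * t') := by rw [← ht']
        _ = 0 + t' * (g * n') := by ring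
        _ = _ := by rw [← hn']
    rw [h2, seqExt_add_mul] at h1
    exact (ZMod.natCast_eq_zero_iff _ _).1 (by simpa using h1)

/-- Such `t` are exactly `g * k * τ` with `τ < d` and `d` coprime to `k * τ`. -/
theorem card_filter_gcd_dvd (k g d : ℕ) (hk : 0 < k) (hg : 0 < g) :
    ((Finset.range (k * (g * d))).filter fun t =>
      Nat.gcd t (g * d) = g ∧ k ∣ t / g).card = if Nat.Coprime d k then Nat.totient d else 0 := by
  have aux : ∀ τ, Nat.gcd (g * (k * τ)) (g * d) = g ↔ Nat.Coprime d k ∧ Nat.Coprime d τ := by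
    intro τ
    rw [Nat.gcd_mul_left, ← Nat.coprime_mul_iff_right, Nat.coprime_comm]
    constructor
    · intro h
      exact Nat.eq_of_mul_eq_mul_left hg (by simpa using h)
    · intro h
      rw [Nat.coprime_iff_gcd_eq_one] at h
      rw [h, mul_one]
  have himg : ((Finset.range (k * (g * d))).filter fun t =>
      Nat.gcd t (g * d) = g ∧ k ∣ t / g) =
      ((Finset.range d).filter fun τ => Nat.Coprime d k ∧ Nat.Coprime d τ).image
        fun τ => g * (k * τ) := by
    ext t
    simp only [Finset.mem_filter, Finset.mem_range, Finset.mem_image]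
    constructor
    · rintro ⟨ht, h1, τ, h2⟩
      have hgt : g ∣ t := h1 ▸ Nat.gcd_dvd_left t (g * d)
      have ht' : g * (k * τ) = t := by rw [← h2, Nat.mul_div_cancel' hgt]
      refine ⟨τ, ⟨?_, (aux τ).1 (by rw [ht', h1])⟩, ht'⟩
      rw [← ht'] at ht
      have : (g * k) * τ < (g * k) * d := by nlinarith
      exact lt_of_mul_lt_mul_left this (Nat.zero_le _)
    · rintro ⟨τ, ⟨h1, h2⟩, rfl⟩
      refine ⟨?_, (aux τ).2 h2, ?_⟩
      · have : (g * k) * τ < (g * k) * d := Nat.mul_lt_mul_of_pos_left h1 (Nat.mul_pos hg hk)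
        nlinarith
      · rw [Nat.mul_div_cancel_left _ hg]
        exact ⟨τ, rfl⟩
  rw [himg, Finset.card_image_of_injective]
  · split_ifs with h
    · rw [Nat.totient_eq_card_coprime]
      exact congrArg _ (Finset.filter_congr fun τ _ => and_iff_right h)
    · simp [h]
  · intro a b hab
    exact Nat.eq_of_mul_eq_mul_left hk (Nat.eq_of_mul_eq_mul_left hg hab)

theorem sum_card_fixed_iterate_cycShift [NeZero k] (a : ℕ)
    (ha : IsGreatest {d : ℕ | d ∣ n ∧ Nat.Coprime d k} a) :
    ∑ t ∈ Finset.range (k * n),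
      (Finset.univ.filter fun x : Fin n → ZMod k => cycShift^[t] x = x).card =
      ∑ d ∈ a.divisors, Nat.totient d * k ^ (n / d) := by
  have hn : 0 < n := NeZero.pos n
  have hk : 0 < k := NeZero.pos k
  have hdiv : a.divisors = n.divisors.filter fun d => Nat.Coprime d k := by
    obtain ⟨⟨han, hak⟩, hmax⟩ := ha
    have ha0 : 0 < a := Nat.pos_of_dvd_of_pos han hn
    ext d
    simp only [Nat.mem_divisors, Finset.mem_filter]
    constructor
    · rintro ⟨hd, -⟩
      exact ⟨⟨hd.trans han, hn.ne'⟩, hak.coprime_dvd_left hd⟩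
    · rintro ⟨⟨hd, -⟩, hdk⟩
      refine ⟨?_, ha0.ne'⟩
      -- The lcm of two divisors of `n` coprime to `k` is another one, so maximality of `a` in size
      -- already gives maximality for divisibility.
      have hl : Nat.lcm a d ≤ a := hmax ⟨Nat.lcm_dvd han hd,
        Nat.Coprime.coprime_dvd_left (Nat.lcm_dvd_mul a d) (Nat.Coprime.mul_left hak hdk)⟩
      have : Nat.lcm a d = a :=
        le_antisymm hl (Nat.le_of_dvd (Nat.lcm_pos ha0 (Nat.pos_of_dvd_of_pos hd hn))
          (Nat.dvd_lcm_left a d))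
      exact this ▸ Nat.dvd_lcm_right a d
  simp only [card_fixed_iterate_cycShift]
  rw [← Finset.sum_fiberwise_of_maps_to (t := n.divisors) (g := fun t => Nat.gcd t n)
    (fun t _ => Nat.mem_divisors.2 ⟨Nat.gcd_dvd_right t n, hn.ne'⟩), hdiv, Finset.sum_filter,
    ← Nat.sum_div_divisors n fun d => if Nat.Coprime d k then Nat.totient d * k ^ (n / d) else 0]
  refine Finset.sum_congr rfl fun g hg => ?_
  obtain ⟨d, hd⟩ := Nat.dvd_of_mem_divisors hg
  have hg0 : 0 < g := Nat.pos_of_mem_divisors hg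
  have hd0 : 0 < d := Nat.pos_of_ne_zero (by
    rintro rfl
    omega)
  have h1 : n / g = d := by rw [hd, Nat.mul_div_cancel_left _ hg0]
  have h2 : n / d = g := by rw [hd, Nat.mul_div_cancel _ hd0]
  rw [h1, h2]
  have hcard := card_filter_gcd_dvd k g d hk hg0
  rw [← hd] at hcard
  calc ∑ t ∈ (Finset.range (k * n)).filter (fun t => Nat.gcd t n = g),
        (if k ∣ t / Nat.gcd t n then k ^ Nat.gcd t n else 0)
      = ∑ t ∈ (Finset.range (k * n)).filter (fun t => Nat.gcd t n = g),
        (if k ∣ t / g then k ^ g else 0) := by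
        refine Finset.sum_congr rfl fun t ht => ?_
        rw [(Finset.mem_filter.1 ht).2]
    _ = ((Finset.range (k * n)).filter fun t => Nat.gcd t n = g ∧ k ∣ t / g).card * k ^ g := by
        rw [← Finset.sum_filter, Finset.filter_filter, Finset.sum_const, smul_eq_mul]
    _ = _ := by
        rw [hcard]
        split_ifs <;> simp

/-- The number of orbits of the cyclic shift, together with a labelling of the orbits. -/
theorem exists_orbit_labelling_cycShift [NeZero k] (a : ℕ)
    (ha : IsGreatest {d : ℕ | d ∣ n ∧ Nat.Coprime d k} a) :
    ∃ N : ℕ,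
      (N : ℚ) = 1 / ((k : ℚ) * n) * ∑ d ∈ a.divisors, (Nat.totient d : ℚ) * (k : ℚ) ^ (n / d) ∧
      ∃ orb : (Fin n → ZMod k) → Fin N, Function.Surjective orb ∧
        ∀ x, orb (cycShift x) = orb x := by
  have : NeZero (k * n) := ⟨mul_ne_zero (NeZero.ne k) (NeZero.ne n)⟩
  obtain ⟨N, orb, hs, ho, hN⟩ :=
    exists_orbit_labelling (cycShift (k := k) (n := n)) (k * n) iterate_cycShift_mul
  refine ⟨N, ?_, orb, hs, ho⟩
  rw [sum_card_fixed_iterate_cycShift a ha] at hN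
  have hN' := congrArg (Nat.cast : ℕ → ℚ) hN
  push_cast at hN'
  have hk : (k : ℚ) ≠ 0 := Nat.cast_ne_zero.2 (NeZero.ne k)
  have hn : (n : ℚ) ≠ 0 := Nat.cast_ne_zero.2 (NeZero.ne n)
  rw [← hN']
  field_simp

end CyclicShift

/-! ### A skew tent map with a cycle of intervals -/

/-- The slope of a branch of the skew tent map: `s` on the left and `-A` on the right. -/
noncomputable def tentSlope (s A : ℝ) (β : Bool) : ℝ := bif β then -A else s

/-- A branch of the skew tent map, as an affine map of the line. -/
noncomputable def tentBranch (s A : ℝ) (β : Bool) (u : ℝ) : ℝ := tentSlope s A β * u + 1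

/-- A cycle of `k` disjoint intervals `[a i, b i]` of a skew tent map. Enlarged by `n * η` they are
still disjoint and mapped into each other. Only `[a 0, b 0]` contains the turning point; the other
ones lie on the side recorded by `side`, and `c i` is the point of the `i`-th interval whose orbit
next meets the turning point. The first return to each interval has slopes at least `P`. -/
structure IsTentCycle (k n : ℕ) [NeZero k] (s A P η : ℝ) (a b c : ZMod k → ℝ)
    (side : ZMod k → Bool) : Prop where
  eta_pos : 0 < η
  c_zero : c 0 = 0
  lt_c : ∀ i, a i < c i
  c_lt : ∀ i, c i < b i
  neg : ∀ i, i ≠ 0 → side i = false → b i + n * η < 0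
  pos : ∀ i, i ≠ 0 → side i = true → 0 < a i - n * η
  mapsTo : ∀ i u β, u ∈ Icc (a i - n * η) (b i + n * η) → (β = false → u ≤ 0) →
    (β = true → 0 ≤ u) → tentBranch s A β u ∈ Icc (a (i + 1)) (b (i + 1))
  c_step : ∀ i, i ≠ 0 → tentBranch s A (side i) (c i) = c (i + 1)
  disjoint : ∀ i j u, i ≠ j → u ∈ Icc (a i - n * η) (b i + n * η) →
    u ∉ Icc (a j - n * η) (b j + n * η)
  one_lt : 1 < P
  le_prod : ∀ β : ZMod k → Bool, (∀ i, i ≠ 0 → β i = side i) →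
    P ≤ ∏ i, |tentSlope s A (β i)|

/-- The point whose `(k - r)`-th iterate under `u ↦ s * u + 1` is `u`. -/
noncomputable def backOrbit (s : ℝ) (k : ℕ) (u : ℝ) (r : ℕ) : ℝ :=
  1 / (1 - s) + (u - 1 / (1 - s)) / s ^ (k - r)

/-! ### Backward orbits of the contracting left branch of the tent map. -/

section BackOrbit

variable {s : ℝ} {k : ℕ}

theorem backOrbit_self (u : ℝ) : backOrbit s k u k = u := by
  simp [backOrbit]

theorem backOrbit_succ (hs : 0 < s) (hs1 : s < 1) (u : ℝ) {r : ℕ} (hr : r < k) :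
    backOrbit s k u (r + 1) = s * backOrbit s k u r + 1 := by
  have h : k - r = (k - (r + 1)) + 1 := by omega
  have h1 : (1 : ℝ) - s ≠ 0 := by linarith
  rw [backOrbit, backOrbit, h, pow_succ]
  field_simp
  ring

/-- Measures the gap between consecutive intervals of the cycle: it is the gap `(1 + s u) - v` at
the last step, stretched by the inverse of the contraction. -/
theorem backOrbit_succ_sub (hs : 0 < s) (hs1 : s < 1) (u v : ℝ) {r : ℕ} (hr : r < k) :
    backOrbit s k u (r + 1) - backOrbit s k v r = (1 + s * u - v) / s ^ (k - r) := by
  have h1 : (1 : ℝ) - s ≠ 0 := by linarith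
  rw [backOrbit_succ hs hs1 u hr, backOrbit, backOrbit]
  field_simp
  ring

theorem backOrbit_sub (u v : ℝ) (r : ℕ) :
    backOrbit s k u r - backOrbit s k v r = (u - v) / s ^ (k - r) := by
  rw [backOrbit, backOrbit]
  ring

theorem backOrbit_lt (hs : 0 < s) {u v : ℝ} (huv : u < v) (r : ℕ) :
    backOrbit s k u r < backOrbit s k v r := by
  have := backOrbit_sub (s := s) (k := k) v u r
  have h2 : 0 < (v - u) / s ^ (k - r) := div_pos (by linarith) (by positivity)
  linarith

theorem le_div_pow (hs : 0 < s) (hs1 : s < 1) {x : ℝ} (hx : 0 ≤ x) (r : ℕ) : x ≤ x / s ^ r :=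
  le_div_self hx (by positivity) (pow_le_one₀ hs.le hs1.le)

theorem backOrbit_mono (hs : 0 < s) (hs1 : s < 1) {u : ℝ} (hu : u ≤ 0) {r r' : ℕ}
    (hr : r ≤ r') (hr' : r' ≤ k) : backOrbit s k u r ≤ backOrbit s k u r' := by
  induction r', hr using Nat.le_induction with
  | base => exact le_rfl
  | succ m hm ih =>
    have h := backOrbit_succ_sub hs hs1 u u (show m < k by omega)
    have h2 : 0 ≤ (1 + s * u - u) / s ^ (k - m) := div_nonneg (by nlinarith) (by positivity)
    linarith [ih (by omega)]

end BackOrbit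

/-- The position of an index in the cycle `1, 2, …, k - 1, 0`. -/
def cycRank {k : ℕ} (i : ZMod k) : ℕ := if i = 0 then k else i.val

section CycRank

variable {k : ℕ} [NeZero k]

theorem one_le_cycRank (i : ZMod k) : 1 ≤ cycRank i := by
  unfold cycRank
  split_ifs with h
  · exact NeZero.pos k
  · exact Nat.one_le_iff_ne_zero.2 ((ZMod.val_eq_zero i).not.2 h)

theorem cycRank_le (i : ZMod k) : cycRank i ≤ k := by
  unfold cycRank
  split_ifs
  · exact le_rfl
  · exact (ZMod.val_lt i).le

theorem cycRank_eq_iff (i : ZMod k) : cycRank i = k ↔ i = 0 := by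
  unfold cycRank
  split_ifs with h
  · simp [h]
  · simp only [h, iff_false]
    exact (ZMod.val_lt i).ne

theorem cast_cycRank (i : ZMod k) : (cycRank i : ZMod k) = i := by
  unfold cycRank
  split_ifs with h
  · simp [h]
  · simp

theorem cycRank_injective : Function.Injective (cycRank (k := k)) := fun i j h => by
  rw [← cast_cycRank i, ← cast_cycRank j, h]

theorem cycRank_succ_of_ne {i : ZMod k} (h : i ≠ 0) : cycRank (i + 1) = cycRank i + 1 := by
  have hlt : cycRank i < k := lt_of_le_of_ne (cycRank_le i) ((cycRank_eq_iff i).not.2 h)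
  have hc : i + 1 = ((cycRank i + 1 : ℕ) : ZMod k) := by
    push_cast
    rw [cast_cycRank]
  rcases (Nat.succ_le_of_lt hlt).lt_or_eq with h1 | h1
  · have hv : (i + 1).val = cycRank i + 1 := by
      rw [hc]
      exact ZMod.val_cast_of_lt h1
    have : i + 1 ≠ 0 := by
      intro h0
      rw [h0, ZMod.val_zero] at hv
      omega
    rw [cycRank, if_neg this, hv]
  · have : i + 1 = 0 := by
      rw [hc, ← Nat.succ_eq_add_one, h1, ZMod.natCast_self]
    rw [(cycRank_eq_iff (i + 1)).2 this]
    exact h1.symm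

end CycRank

theorem cycRank_one {k : ℕ} (hk : 2 ≤ k) : cycRank (1 : ZMod k) = 1 := by
  have : Fact (1 < k) := ⟨by omega⟩
  rw [cycRank, if_neg one_ne_zero, ZMod.val_one]

/-- Here `p` stands for `s ^ (k - 2)`, the interval around the turning point is `[-w, (P ^ 2 - 1) *
w]`, and `e` is the room for enlargement. The first two bounds on `e` make both halves of the
enlarged interval land in `[1 - s P w, 1]`; the third separates the intervals. The last equation
says that `1 - A = g 1` reaches `-w` after `k - 2` further steps. -/
theorem exists_tent_constants (s p : ℝ) (hs : 0 < s) (hs4 : s ≤ 1 / 4) (hp0 : 0 < p)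
    (hp1 : p ≤ 1) :
    ∃ P A w e : ℝ, 1 < P ∧ 1 ≤ A ∧ A * (p * s) = P ∧ 0 < w ∧ 0 < e ∧ e ≤ (P - 1) * w ∧
      e ≤ (p * s ^ 2 - (P ^ 2 - 1)) * w ∧ 2 * e < 1 - s * P * w - (P ^ 2 - 1) * w ∧
      1 - A = 1 / (1 - s) + (-w - 1 / (1 - s)) / p := by
  have hx0 : 0 < p * s ^ 2 := by positivity
  have hx1 : p * s ^ 2 ≤ s ^ 2 := by nlinarith [sq_nonneg s]
  have hx2 : p * s ^ 2 ≤ 1 / 16 := by nlinarith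
  -- `P` exceeds `1` so slightly that `P ^ 2 - 1 < p * s ^ 2`, as the second bound on `e` requires.
  obtain ⟨P, hP⟩ : ∃ P : ℝ, P = 1 + p * s ^ 2 / 4 := ⟨_, rfl⟩
  have hP1 : 1 < P := by linarith
  have hP2 : P ^ 2 - 1 < p * s ^ 2 := by
    rw [hP]
    nlinarith
  have h1s : 0 < 1 - s := by linarith
  have hps : p * s ≤ s := by nlinarith
  have hps0 : 0 < p * s := by positivity
  have hY : 1 ≤ (1 - p * s) / (1 - s) := by
    rw [le_div_iff₀ h1s]
    linarith
  have hY2 : (1 - p * s) / (1 - s) ≤ 4 / 3 := by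
    rw [div_le_iff₀ h1s]
    linarith
  have hPs : 4 ≤ P / s := by
    rw [le_div_iff₀ hs]
    linarith
  -- The last equation of the statement, solved for `w` with `A = P / (p * s)`.
  obtain ⟨w, hw⟩ : ∃ w : ℝ, w = P / s - (1 - p * s) / (1 - s) := ⟨_, rfl⟩
  have hw0 : 0 < w := by linarith
  have hsw : s * w ≤ P - s := by
    have h1 : s * (P / s) = P := by field_simp
    have h2 : s * 1 ≤ s * ((1 - p * s) / (1 - s)) := mul_le_mul_of_nonneg_left hY hs.le
    rw [hw, mul_sub, h1]
    linarith
  have hmain : s * P * w + p * s ^ 2 * w < 1 := by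
    have h1 : P * (s * w) ≤ P * (P - s) := mul_le_mul_of_nonneg_left hsw (by linarith)
    have h2 : (p * s) * (s * w) ≤ s * (P - s) :=
      (mul_le_mul_of_nonneg_right hps (by positivity)).trans
        (mul_le_mul_of_nonneg_left hsw hs.le)
    have h3 : P * (P - s) + s * (P - s) = P ^ 2 - s ^ 2 := by ring
    have h4 : s * P * w + p * s ^ 2 * w = P * (s * w) + (p * s) * (s * w) := by ring
    linarith
  have g1 : 0 < (P - 1) * w := mul_pos (by linarith) hw0
  have g2 : 0 < (p * s ^ 2 - (P ^ 2 - 1)) * w := mul_pos (by linarith) hw0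
  have g3 : 0 < 1 - s * P * w - (P ^ 2 - 1) * w := by nlinarith
  refine ⟨P, P / (p * s), w, min (min ((P - 1) * w) ((p * s ^ 2 - (P ^ 2 - 1)) * w))
    ((1 - s * P * w - (P ^ 2 - 1) * w) / 3), hP1, ?_, ?_, hw0, by positivity,
    (min_le_left _ _).trans (min_le_left _ _), (min_le_left _ _).trans (min_le_right _ _), ?_, ?_⟩
  · rw [le_div_iff₀ hps0]
    linarith
  · field_simp
  · have := min_le_right (min ((P - 1) * w) ((p * s ^ 2 - (P ^ 2 - 1)) * w))
      ((1 - s * P * w - (P ^ 2 - 1) * w) / 3)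
    linarith
  · rw [hw]
    field_simp
    ring

/-- Going once around the cycle `1, 2, …, k - 1, 0` uses slope `-A` on interval `1`, slope `s` on
the intervals `2, …, k - 1`, and either slope on interval `0`. The smaller product is `A * s ^ (k -
1) = P`. Apart from the first, the intervals are pulled back from the one around `0` along the left
branch. -/
theorem exists_isTentCycle (k n : ℕ) [NeZero k] (hk : 2 ≤ k) (hn : 1 ≤ n) (s : ℝ) (hs : 0 < s)
    (hs4 : s ≤ 1 / 4) :
    ∃ (A P η : ℝ) (a b c : ZMod k → ℝ) (side : ZMod k → Bool),
      s ≤ A ∧ IsTentCycle k n s A P η a b c side := by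
  have hs1 : s < 1 := by linarith
  obtain ⟨p, hp⟩ : ∃ p : ℝ, p = s ^ (k - 2) := ⟨_, rfl⟩
  have hp0 : 0 < p := hp ▸ pow_pos hs _
  have hp1 : p ≤ 1 := hp ▸ pow_le_one₀ hs.le hs1.le
  obtain ⟨P, A, w, e, hP1, hA1, hAps, hw0, he0, he1, he2, he3, hAw⟩ :=
    exists_tent_constants s p hs hs4 hp0 hp1
  have hP2 : 0 < P ^ 2 - 1 := by nlinarith
  set T : ℝ := (P ^ 2 - 1) * w with hT
  have hT0 : 0 < T := mul_pos hP2 hw0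
  have hn0 : (0 : ℝ) < n := by exact_mod_cast hn
  set η : ℝ := e / (n * (2 * A) ^ k) with hη
  have hη0 : 0 < η := by positivity
  have hηe : n * η * (2 * A) ^ k = e := by
    rw [hη]
    field_simp
  let al : ℕ → ℝ := fun r => if r = 1 then 1 - s * P * w else backOrbit s k (-w) r
  let be : ℕ → ℝ := fun r => if r = 1 then 1 else backOrbit s k T r
  let ce : ℕ → ℝ := fun r => if r = 1 then (1 - backOrbit s k 0 2) / A else backOrbit s k 0 r
  -- Enlargement built into the interval of rank `r`. It grows fast enough to absorb the image,
  -- under a slope of modulus at most `A`, of a further enlargement by `n * η`; the choice of `η`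
  -- keeps the total below `e`.
  let en : ℕ → ℝ := fun r => n * η * ((2 * A) ^ r - 1)
  have hA2 : 1 ≤ 2 * A := by linarith
  have hen0 : ∀ r, 0 ≤ en r := fun r =>
    mul_nonneg (by positivity) (by linarith [one_le_pow₀ hA2 (n := r)])
  have henk : ∀ r, r ≤ k → en r + n * η ≤ e := by
    intro r hr
    have : (2 * A) ^ r ≤ (2 * A) ^ k := pow_le_pow_right₀ hA2 hr
    have h2 : n * η * (2 * A) ^ r ≤ n * η * (2 * A) ^ k :=
      mul_le_mul_of_nonneg_left this (by positivity)
    simp only [en]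
    linarith
  have hens : ∀ r, A * (en r + n * η) ≤ en (r + 1) := by
    intro r
    have h1 : 1 ≤ (2 * A) ^ r := one_le_pow₀ hA2
    have h2 : 0 < n * η := by positivity
    have h3 : en (r + 1) - A * (en r + n * η) = n * η * (A * (2 * A) ^ r - 1) := by
      simp only [en, pow_succ]
      ring
    have h4 : 1 ≤ A * (2 * A) ^ r := one_le_mul_of_one_le_of_one_le hA1 h1
    nlinarith [mul_nonneg h2.le (sub_nonneg.2 h4)]
  have hA_lo : 1 - A = backOrbit s k (-w) 2 := by
    rw [backOrbit, ← hp, hAw]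
  have hA_hi : 1 - A * (1 - s * P * w) = backOrbit s k T 2 := by
    have h1 := backOrbit_sub (s := s) (k := k) T (-w) 2
    rw [← hp] at h1
    have h2 : (T - -w) / p = A * (s * P * w) := by
      rw [div_eq_iff hp0.ne', hT, show A * (s * P * w) * p = (A * (p * s)) * P * w by ring, hAps]
      ring
    linarith
  have hgap : ∀ r, r < k → backOrbit s k T r + 2 * e < backOrbit s k (-w) (r + 1) := by
    intro r hr
    have h1 := backOrbit_succ_sub hs hs1 (-w) T hr
    have h2 : 2 * e < 1 + s * (-w) - T := by
      have : s * w * 1 ≤ s * w * P := mul_le_mul_of_nonneg_left hP1.le (by positivity)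
      linarith
    have h3 := le_div_pow hs hs1 (show 0 ≤ 1 + s * (-w) - T by linarith) (k - r)
    linarith
  have hneg : ∀ r, r < k → backOrbit s k T r + e < 0 := by
    intro r hr
    have h1 := hgap r hr
    have h2 := backOrbit_mono hs hs1 (show -w ≤ 0 by linarith) (Nat.succ_le_of_lt hr) le_rfl
    rw [backOrbit_self] at h2
    have h3 : backOrbit s k (-w) (r + 1) ≤ -w := h2
    linarith
  have hal1 : e < 1 - s * P * w := by linarith
  -- every enlarged interval other than the first lies to the left of the first
  have hsep1 : ∀ r, 2 ≤ r → r ≤ k → be r + e < al 1 - e := by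
    intro r hr hrk
    simp only [al, be, if_true, if_neg (show r ≠ 1 by omega)]
    rcases hrk.lt_or_eq with h | h
    · linarith [hneg r h]
    · rw [h, backOrbit_self]
      linarith
  have hsep2 : ∀ r r', 2 ≤ r → r < r' → r' ≤ k → be r + e < al r' - e := by
    intro r r' hr hrr hrk
    simp only [al, be, if_neg (show r ≠ 1 by omega), if_neg (show r' ≠ 1 by omega)]
    have h2 := backOrbit_mono hs hs1 (show -w ≤ 0 by linarith) (Nat.succ_le_of_lt hrr) hrk
    have h3 : backOrbit s k (-w) (r + 1) ≤ backOrbit s k (-w) r' := h2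
    linarith [hgap r (by omega)]
  have hdisj : ∀ r r' u, 1 ≤ r → r < r' → r' ≤ k → u ∈ Icc (al r - e) (be r + e) →
      u ∉ Icc (al r' - e) (be r' + e) := by
    intro r r' u hr hrr hrk hu hu'
    rcases hr.lt_or_eq with h | h
    · linarith [hsep2 r r' h hrr hrk, hu.2, hu'.1]
    · subst h
      linarith [hsep1 r' hrr hrk, hu.1, hu'.2]
  have hsub : ∀ (i : ZMod k) u, u ∈ Icc (al (cycRank i) - en (cycRank i) - n * η)
      (be (cycRank i) + en (cycRank i) + n * η) →
      u ∈ Icc (al (cycRank i) - e) (be (cycRank i) + e) := by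
    intro i u hu
    have := henk _ (cycRank_le i)
    exact ⟨by linarith [hu.1], by linarith [hu.2]⟩
  refine ⟨A, P, η, fun i => al (cycRank i) - en (cycRank i), fun i => be (cycRank i) +
    en (cycRank i), fun i => ce (cycRank i), fun i => decide (cycRank i = 1), by linarith, ?_⟩
  refine
    { eta_pos := hη0
      c_zero := ?_
      lt_c := ?_
      c_lt := ?_
      neg := ?_
      pos := ?_
      mapsTo := ?_
      c_step := ?_
      disjoint := ?_
      one_lt := hP1
      le_prod := ?_ }
  · simp only [ce]
    rw [(cycRank_eq_iff (0 : ZMod k)).2 rfl, if_neg (by omega), backOrbit_self]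
  · intro i
    have := hen0 (cycRank i)
    have h : al (cycRank i) < ce (cycRank i) := by
      simp only [al, ce]
      split_ifs with h
      · rw [lt_div_iff₀ (by linarith)]
        have := backOrbit_lt (k := k) hs hT0 2
        linarith
      · exact backOrbit_lt hs (by linarith) _
    linarith
  · intro i
    have := hen0 (cycRank i)
    have h : ce (cycRank i) < be (cycRank i) := by
      simp only [be, ce]
      split_ifs with h
      · rw [div_lt_iff₀ (by linarith)]
        have := backOrbit_lt (k := k) hs (show -w < 0 by linarith) 2
        linarith
      · exact backOrbit_lt hs hT0 _
    linarith
  · intro i hi hside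
    have h1 : cycRank i ≠ 1 := by simpa using hside
    have h2 : cycRank i < k := lt_of_le_of_ne (cycRank_le i) ((cycRank_eq_iff i).not.2 hi)
    have := hneg _ h2
    have := henk _ (cycRank_le i)
    simp only [be, if_neg h1]
    linarith
  · intro i hi hside
    have h1 : cycRank i = 1 := by simpa using hside
    have := henk _ (cycRank_le i)
    rw [h1] at this
    simp only [al, h1, if_true]
    linarith
  · intro i u β hu hβ0 hβ1
    have hue := hsub i u hu
    by_cases hi0 : i = 0
    · subst hi0
      have hr : cycRank ((0 : ZMod k)) = k := (cycRank_eq_iff _).2 rfl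
      have hr1 : cycRank ((0 : ZMod k) + 1) = 1 := by rw [zero_add, cycRank_one hk]
      rw [hr] at hue
      simp only [al, be, if_neg (show k ≠ 1 by omega), backOrbit_self] at hue
      -- Both halves fold onto the first interval, without using its enlargement; this closes the
      -- cycle.
      have hin : tentBranch s A β u ∈ Icc (1 - s * P * w) 1 := by
        cases β with
        | false =>
          have := hβ0 rfl
          simp only [tentBranch, tentSlope, cond_false]
          constructor
          · have : s * (-w - e) ≤ s * u := mul_le_mul_of_nonneg_left hue.1 hs.le
            have : s * e ≤ s * ((P - 1) * w) := mul_le_mul_of_nonneg_left he1 hs.le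
            linarith
          · linarith [mul_nonpos_of_nonneg_of_nonpos hs.le this]
        | true =>
          have := hβ1 rfl
          simp only [tentBranch, tentSlope, cond_true]
          have h4 : u ≤ p * s ^ 2 * w := by linarith [hue.2]
          have h5 : A * (p * s ^ 2 * w) = s * P * w := by
            rw [show A * (p * s ^ 2 * w) = (A * (p * s)) * s * w by ring, hAps]
            ring
          constructor
          · linarith [mul_le_mul_of_nonneg_left h4 (show 0 ≤ A by linarith)]
          · linarith [mul_nonneg (show 0 ≤ A by linarith) this]
      simp only [hr1, al, be, if_true]
      exact ⟨by linarith [hin.1, hen0 1], by linarith [hin.2, hen0 1]⟩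
    · have hlt : cycRank i < k := lt_of_le_of_ne (cycRank_le i) ((cycRank_eq_iff i).not.2 hi0)
      have hs' := hens (cycRank i)
      have hE0 : 0 ≤ en (cycRank i) + n * η := add_nonneg (hen0 _) (by positivity)
      simp only [cycRank_succ_of_ne hi0]
      have hne : cycRank i + 1 ≠ 1 := by
        have := one_le_cycRank i
        omega
      by_cases h1 : cycRank i = 1
      -- Away from the turning point the interval lies on one side, so only one branch is compatible
      -- with the sign of `u`.
      · have hβ : β = true := by
          by_contra h
          have := hβ0 (by simpa using h)
          rw [h1] at hue
          simp only [al, if_true] at hue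
          linarith [hue.1]
        subst hβ
        rw [h1] at hu hs' hE0 ⊢
        simp only [al, be, if_true, tentBranch, tentSlope, cond_true,
          if_neg (show (1 : ℕ) + 1 ≠ 1 by omega)] at hu ⊢
        have e2 : (1 : ℕ) + 1 = 2 := rfl
        rw [e2] at hs' ⊢
        rw [← hA_lo, ← hA_hi]
        constructor
        · linarith [mul_le_mul_of_nonneg_left hu.2 (show 0 ≤ A by linarith)]
        · linarith [mul_le_mul_of_nonneg_left hu.1 (show 0 ≤ A by linarith)]
      · have hβ : β = false := by
          by_contra h
          have := hβ1 (by simpa using h)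
          simp only [be, if_neg h1] at hue
          linarith [hue.2, hneg _ hlt]
        subst hβ
        simp only [al, be, if_neg h1, tentBranch, tentSlope, cond_false,
          if_neg hne, backOrbit_succ hs hs1 _ hlt] at hu ⊢
        have hsE : s * (en (cycRank i) + n * η) ≤ A * (en (cycRank i) + n * η) :=
          mul_le_mul_of_nonneg_right (by linarith) hE0
        constructor
        · linarith [mul_le_mul_of_nonneg_left hu.1 hs.le]
        · linarith [mul_le_mul_of_nonneg_left hu.2 hs.le]
  · intro i hi
    have hlt : cycRank i < k := lt_of_le_of_ne (cycRank_le i) ((cycRank_eq_iff i).not.2 hi)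
    simp only [cycRank_succ_of_ne hi, ce, tentBranch, tentSlope]
    have hne : cycRank i + 1 ≠ 1 := by
      have := one_le_cycRank i
      omega
    by_cases h1 : cycRank i = 1
    · simp only [h1, decide_true, cond_true, if_true]
      norm_num
      field_simp
      ring
    · simp only [h1, decide_false, cond_false, if_false, if_neg hne, backOrbit_succ hs hs1 _ hlt]
  · intro i j u hij hu hu'
    have h1 := hsub i u hu
    have h2 := hsub j u hu'
    rcases lt_trichotomy (cycRank i) (cycRank j) with h | h | h
    · exact hdisj _ _ u (one_le_cycRank i) h (cycRank_le j) h1 h2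
    · exact hij (cycRank_injective h)
    · exact hdisj _ _ u (one_le_cycRank j) h (cycRank_le i) h2 h1
  · intro β hβ
    have hβ1 : β 1 = true := by
      have : Fact (1 < k) := ⟨by omega⟩
      rw [hβ 1 one_ne_zero]
      simp [cycRank_one hk]
    have h1 : ∀ i, s ≤ |tentSlope s A (β i)| := by
      intro i
      cases β i with
      | false => simp [tentSlope, abs_of_pos hs]
      | true =>
        simp only [tentSlope, cond_true, abs_neg, abs_of_pos (show 0 < A by linarith)]
        linarith
    rw [← Finset.mul_prod_erase _ _ (Finset.mem_univ (1 : ZMod k)), hβ1]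
    have h2 : s ^ (k - 1) ≤ ∏ i ∈ Finset.univ.erase (1 : ZMod k), |tentSlope s A (β i)| := by
      have := Finset.prod_le_prod (s := Finset.univ.erase (1 : ZMod k)) (f := fun _ => s)
        (g := fun i => |tentSlope s A (β i)|) (fun _ _ => hs.le) (fun i _ => h1 i)
      rwa [Finset.prod_const, Finset.card_erase_of_mem (Finset.mem_univ _), Finset.card_univ,
        ZMod.card] at this
    have h3 : s ^ (k - 1) = p * s := by
      rw [hp, ← pow_succ]
      congr 1
      omega
    simp only [tentSlope, cond_true, abs_neg, abs_of_pos (show 0 < A by linarith)]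
    calc P = A * (p * s) := hAps.symm
      _ ≤ _ := mul_le_mul_of_nonneg_left (h3 ▸ h2) (by linarith)

/-! ### Domains with corners cut out by functionals close to multiples of the coordinates -/

section Corners

variable {E : Type*} [NormedAddCommGroup E] [NormedSpace ℝ E] {ι : Type*} [Finite ι]
  {r : ℕ∞} {g : ι → E → ℝ} {O : Set E}

theorem isOpen_forall_pos {E ι : Type*} [TopologicalSpace E] [Finite ι] {g : ι → E → ℝ}
    {O : Set E} (hO : IsOpen O) (hg : ∀ i, ContinuousOn (g i) O) :
    IsOpen {p ∈ O | ∀ i, 0 < g i p} := by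
  have h : {p ∈ O | ∀ i, 0 < g i p} = O ∩ ⋂ i, (O ∩ g i ⁻¹' Ioi 0) := by
    ext p
    simp only [mem_ofPred_eq, mem_inter_iff, mem_iInter, mem_preimage, mem_Ioi]
    exact ⟨fun h => ⟨h.1, fun i => ⟨h.1, h.2 i⟩⟩, fun h => ⟨h.1, fun i => (h.2 i).2⟩⟩
  rw [h]
  exact hO.inter (isOpen_iInter_of_finite fun i => (hg i).isOpen_inter_preimage hO isOpen_Ioi)

theorem nonneg_of_mem_closure {E ι : Type*} [TopologicalSpace E] {g : ι → E → ℝ} {O : Set E}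
    (hO : IsOpen O) (hg : ∀ i, ContinuousOn (g i) O) {p : E}
    (hp : p ∈ closure {p ∈ O | ∀ i, 0 < g i p}) (hpO : p ∈ O) (i : ι) : 0 ≤ g i p := by
  by_contra h
  have hopen : IsOpen (O ∩ g i ⁻¹' Iio 0) := (hg i).isOpen_inter_preimage hO isOpen_Iio
  obtain ⟨q, hq, hq'⟩ := mem_closure_iff.1 hp _ hopen ⟨hpO, not_le.1 h⟩
  have h1 : g i q < 0 := hq.2
  exact lt_asymm h1 (hq'.2 i)

/-- Near a boundary point the inactive constraints stay positive, so shrinking the neighbourhood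
discards them and leaves only functions vanishing at the point. -/
theorem hasPiecewiseCrBoundary_forall_pos (hO : IsOpen O)
    (hg : ∀ i, ContDiffOn ℝ r (g i) O) (hcl : closure {p ∈ O | ∀ i, 0 < g i p} ⊆ O)
    (hli : ∀ p ∈ O, (∀ i, 0 ≤ g i p) →
      LinearIndependent ℝ fun i : {i // g i p = 0} => fderiv ℝ (g i) p) :
    HasPiecewiseCrBoundary r {p ∈ O | ∀ i, 0 < g i p} := by
  intro p hp
  have hpc := frontier_subset_closure hp
  have hpO := hcl hpc
  have hp0 := nonneg_of_mem_closure hO (fun i => (hg i).continuousOn) hpc hpO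
  let e := Finite.equivFin {i // g i p = 0}
  refine ⟨{q ∈ O | ∀ i : {i // g i p ≠ 0}, 0 < g i q},
    isOpen_forall_pos hO fun i => (hg i).continuousOn,
    ⟨hpO, fun i => lt_of_le_of_ne (hp0 i) i.2.symm⟩, Nat.card {i // g i p = 0},
    fun j => g (e.symm j), fun j => (hg _).mono fun q hq => hq.1, fun j => (e.symm j).2, ?_, ?_⟩
  · exact (hli p hpO hp0).comp _ e.symm.injective
  · ext q
    simp only [mem_inter_iff, mem_ofPred_eq]
    constructor
    · rintro ⟨⟨hq, hall⟩, -⟩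
      exact ⟨⟨hq, fun i => hall i⟩, fun j => hall _⟩
    · rintro ⟨⟨hq, h1⟩, h2⟩
      refine ⟨⟨hq, fun i => ?_⟩, hq, h1⟩
      by_cases hi : g i p = 0
      · simpa using h2 (e ⟨i, hi⟩)
      · exact h1 ⟨i, hi⟩

/-- Along `p + t • v` with small `t > 0`, active constraints become positive to first order and the
others remain so by continuity. -/
theorem mem_closure_forall_pos (hO : IsOpen O) (hg : ∀ i, ContDiffOn ℝ r (g i) O) (hr : 1 ≤ r)
    {p : E} (hp : p ∈ O) (h0 : ∀ i, 0 ≤ g i p)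
    (hv : ∃ v, ∀ i, g i p = 0 → 0 < fderiv ℝ (g i) p v) :
    p ∈ closure {p ∈ O | ∀ i, 0 < g i p} := by
  obtain ⟨v, hv⟩ := hv
  have hline : Tendsto (fun t : ℝ => p + t • v) (𝓝[>] 0) (𝓝 p) := by
    have : Tendsto (fun t : ℝ => p + t • v) (𝓝 0) (𝓝 (p + (0 : ℝ) • v)) :=
      Continuous.tendsto (by fun_prop) 0
    rw [zero_smul, add_zero] at this
    exact this.mono_left nhdsWithin_le_nhds
  refine mem_closure_of_tendsto hline ?_
  have hOe : ∀ᶠ t : ℝ in 𝓝[>] 0, p + t • v ∈ O := hline.eventually (hO.mem_nhds hp)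
  have hpos : ∀ i, ∀ᶠ t : ℝ in 𝓝[>] 0, 0 < g i (p + t • v) := by
    intro i
    rcases (h0 i).eq_or_lt with h | h
    · have hd : DifferentiableAt ℝ (g i) p :=
        ((hg i).contDiffAt (hO.mem_nhds hp)).differentiableAt (by
          have : (1 : WithTop ℕ∞) ≤ (r : WithTop ℕ∞) := by exact_mod_cast hr
          intro h0
          rw [h0] at this
          simp at this)
      have hl : HasDerivAt (fun t : ℝ => g i (p + t • v)) (fderiv ℝ (g i) p v) 0 := by
        have h2 : HasDerivAt (fun t : ℝ => p + t • v) v 0 := by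
          simpa using ((hasDerivAt_id (0 : ℝ)).smul_const v).const_add p
        have h3 : HasFDerivAt (g i) (fderiv ℝ (g i) p) (p + (0 : ℝ) • v) := by
          simpa using hd.hasFDerivAt
        exact h3.comp_hasDerivAt (0 : ℝ) h2
      have hs := (hasDerivAt_iff_tendsto_slope.1 hl).eventually (lt_mem_nhds (hv i h.symm))
      have hs' : ∀ᶠ t : ℝ in 𝓝[>] 0,
          0 < slope (fun t : ℝ => g i (p + t • v)) 0 t :=
        hs.filter_mono (nhdsWithin_mono _ fun t ht => ne_of_gt ht)
      filter_upwards [hs', self_mem_nhdsWithin] with t ht ht0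
      rw [slope_def_field] at ht
      have ht0' : (0 : ℝ) < t := ht0
      simp only [zero_smul, add_zero, ← h, sub_zero] at ht
      exact (div_pos_iff_of_pos_right ht0').1 ht
    · have hc : ContinuousAt (g i) p := (hg i).continuousOn.continuousAt (hO.mem_nhds hp)
      exact (hc.tendsto.comp hline).eventually (lt_mem_nhds h)
  filter_upwards [hOe, eventually_all.2 hpos] with t h1 h2
  exact ⟨h1, h2⟩

end Corners

/-! ### Functionals that are nearly multiples of distinct coordinates. -/

section DiagonallyDominant

variable {n : ℕ} {ι : Type*} [Fintype ι] {ℓ : ι → EuclideanSpace ℝ (Fin n) →L[ℝ] ℝ}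
  {m : ι → Fin n} {d : ι → ℝ} {ε D : ℝ}

theorem linearIndependent_of_diagonallyDominant (hm : Function.Injective m)
    (hd : ∀ i, D ≤ |d i|) (hε : n * ε < D) (hε0 : 0 ≤ ε)
    (hℓ : ∀ i v, |ℓ i v - d i * v (m i)| ≤ ε * ‖v‖) : LinearIndependent ℝ ℓ := by
  classical
  rw [Fintype.linearIndependent_iff]
  intro a ha
  by_contra! hne
  obtain ⟨i₁, hi₁⟩ := hne
  -- Evaluating the relation on the basis vector of the largest coefficient, the diagonal term
  -- outweighs the at most `n` errors.
  obtain ⟨i₀, -, hmax⟩ := Finset.exists_max_image Finset.univ (fun i => |a i|)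
    ⟨i₁, Finset.mem_univ _⟩
  have hpos : 0 < |a i₀| := (abs_pos.2 hi₁).trans_le (hmax i₁ (Finset.mem_univ _))
  set e : EuclideanSpace ℝ (Fin n) := EuclideanSpace.single (m i₀) 1 with he
  have hne : ‖e‖ = 1 := by simp [he]
  have hsum : ∑ i, a i * ℓ i e = 0 := by
    have := congrArg (fun L : EuclideanSpace ℝ (Fin n) →L[ℝ] ℝ => L e) ha
    simpa [sum_apply] using this
  have hδ : ∑ i, a i * (d i * e (m i)) = a i₀ * d i₀ := by
    rw [Finset.sum_eq_single i₀]
    · simp [he]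
    · intro i _ hi
      have : m i ≠ m i₀ := fun h => hi (hm h)
      simp [he, this]
    · intro h
      exact absurd (Finset.mem_univ _) h
  have hdiff : a i₀ * d i₀ = -∑ i, a i * (ℓ i e - d i * e (m i)) := by
    simp only [mul_sub, Finset.sum_sub_distrib, hsum, hδ]
    ring
  have hcard : (Fintype.card ι : ℝ) ≤ n := by
    have := Fintype.card_le_of_injective m hm
    rw [Fintype.card_fin] at this
    exact_mod_cast this
  have h1 : |a i₀| * |d i₀| ≤ Fintype.card ι * (|a i₀| * ε) := by
    rw [← abs_mul, hdiff, abs_neg]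
    refine (Finset.abs_sum_le_sum_abs _ _).trans ?_
    rw [← nsmul_eq_mul, ← Finset.card_univ]
    refine Finset.sum_le_card_nsmul _ _ _ fun i hi => ?_
    rw [abs_mul]
    have h2 := hℓ i e
    rw [hne, mul_one] at h2
    exact mul_le_mul (hmax i hi) h2 (abs_nonneg _) (abs_nonneg _)
  have h2 : |a i₀| * D ≤ |a i₀| * |d i₀| := mul_le_mul_of_nonneg_left (hd i₀) hpos.le
  have h3 : (Fintype.card ι : ℝ) * (|a i₀| * ε) ≤ n * (|a i₀| * ε) :=
    mul_le_mul_of_nonneg_right hcard (by positivity)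
  nlinarith

theorem exists_forall_pos_of_diagonallyDominant (hm : Function.Injective m)
    (hd : ∀ i, D ≤ |d i|) (hε : n * ε < D) (hε0 : 0 ≤ ε)
    (hℓ : ∀ i v, |ℓ i v - d i * v (m i)| ≤ ε * ‖v‖) : ∃ v, ∀ i, 0 < ℓ i v := by
  classical
  have hn0 : 0 < D := lt_of_le_of_lt (by positivity) hε
  -- The signs make every diagonal term `|d i|`, while `‖v‖ ≤ n` bounds the errors by `n * ε < D`.
  set v : EuclideanSpace ℝ (Fin n) :=
    ∑ i, (SignType.sign (d i) : ℝ) • EuclideanSpace.single (m i) (1 : ℝ) with hv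
  have hvm : ∀ i, v (m i) = SignType.sign (d i) := by
    intro i
    have : v (m i) = ∑ j, (SignType.sign (d j) : ℝ) *
        (EuclideanSpace.single (m j) (1 : ℝ) : EuclideanSpace ℝ (Fin n)) (m i) := by
      simp [hv, Pi.single_apply]
    rw [this, Finset.sum_eq_single i]
    · simp
    · intro j _ hj
      have : m i ≠ m j := fun h => hj (hm h).symm
      simp [this]
    · intro h
      exact absurd (Finset.mem_univ _) h
  have hcard : (Fintype.card ι : ℝ) ≤ n := by
    have := Fintype.card_le_of_injective m hm
    rw [Fintype.card_fin] at this
    exact_mod_cast this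
  have hnorm : ‖v‖ ≤ n := by
    refine (norm_sum_le _ _).trans (le_trans ?_ hcard)
    have : ∀ i ∈ (Finset.univ : Finset ι), ‖(SignType.sign (d i) : ℝ) •
        (EuclideanSpace.single (m i) (1 : ℝ) : EuclideanSpace ℝ (Fin n))‖ ≤ (1 : ℝ) := by
      intro i _
      rw [norm_smul]
      rcases SignType.sign (d i) with _ | _ | _ <;> simp
    simpa using Finset.sum_le_card_nsmul _ _ _ this
  refine ⟨v, fun i => ?_⟩
  have h1 := (abs_le.1 (hℓ i v)).1
  rw [hvm, mul_comm (d i), sign_mul_self] at h1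
  have h2 : ε * ‖v‖ ≤ ε * n := mul_le_mul_of_nonneg_left hnorm hε0
  linarith [hd i]

end DiagonallyDominant

/-! ### Words in the two branches of a delay map and their perturbations -/

/-- The slope of the `j`-th term of the delay recurrence as a function of its initial value. -/
noncomputable def slopeSeq (n : ℕ) (s A : ℝ) (w : ℕ → Bool) (j : ℕ) : ℝ :=
  ∏ i ∈ Finset.range (j / n), tentSlope s A (w (j % n + i * n))

theorem abs_tentSlope_ge {s A : ℝ} (hs : 0 < s) (hsA : s ≤ A) (β : Bool) : s ≤ |tentSlope s A β| := by
  cases β with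
  | false => simp [tentSlope, abs_of_pos hs]
  | true => simpa [tentSlope, abs_of_pos (hs.trans_le hsA)] using hsA

/-- At most `k` factors occur, each of modulus at least `s`, and `s ≤ 1`. -/
theorem pow_le_abs_slopeSeq {n : ℕ} {s A : ℝ} {w : ℕ → Bool} (hs : 0 < s) (hs1 : s ≤ 1) (hsA : s ≤ A) {k t : ℕ}
    (ht : t ≤ k * n) : s ^ k ≤ |slopeSeq n s A w t| := by
  have hk : t / n ≤ k := Nat.div_le_of_le_mul (by rwa [mul_comm])
  rw [slopeSeq, Finset.abs_prod]
  calc s ^ k ≤ s ^ (t / n) := pow_le_pow_of_le_one hs.le hs1 hk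
    _ = ∏ i ∈ Finset.range (t / n), s := by simp
    _ ≤ _ := Finset.prod_le_prod (fun _ _ => hs.le) fun i _ => abs_tentSlope_ge hs hsA _

section DelayMap

variable {n : ℕ} [NeZero n]

/-- The last index of `Fin n`. -/
def lastIdx (n : ℕ) [NeZero n] : Fin n := ⟨n - 1, Nat.sub_lt (NeZero.pos n) one_pos⟩

/-- The vector of parameters `(0, …, 0, tentSlope s A β)`. -/
noncomputable def tentParam (n : ℕ) [NeZero n] (s A : ℝ) (β : Bool) : EuclideanSpace ℝ (Fin n) :=
  EuclideanSpace.single (lastIdx n) (tentSlope s A β)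

/-- A companion matrix as a continuous linear map. -/
noncomputable def companionCLM (c : EuclideanSpace ℝ (Fin n)) :
    EuclideanSpace ℝ (Fin n) →L[ℝ] EuclideanSpace ℝ (Fin n) :=
  LinearMap.toContinuousLinearMap (Matrix.toEuclideanLin (companion c))

/-- A branch of the delay map `(y₁, …, yₙ) ↦ (y₂, …, yₙ, g y₁)`, where `g` is a branch of the
skew tent map. -/
noncomputable def delayBranch (s A : ℝ) (β : Bool) (y : EuclideanSpace ℝ (Fin n)) :
    EuclideanSpace ℝ (Fin n) :=
  companionCLM (tentParam n s A β) y + EuclideanSpace.single (lastIdx n) 1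

theorem companionCLM_apply (c y : EuclideanSpace ℝ (Fin n)) (l : Fin n) :
    companionCLM c y l = c l * y 0 + if h : (l : ℕ) + 1 < n then y ⟨l + 1, h⟩ else 0 := by
  change (Matrix.toEuclideanLin (companion c) y) l = _
  rw [Matrix.toLpLin_apply]
  simp only [Matrix.mulVec, dotProduct, companion, Matrix.of_apply]
  have h0 : ∀ j : Fin n, (if (j : ℕ) = 0 then c l else if (j : ℕ) = (l : ℕ) + 1 then 1 else 0) *
      y j = (if j = 0 then c l * y j else 0) + if (j : ℕ) = (l : ℕ) + 1 then y j else 0 := by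
    intro j
    by_cases h1 : j = 0
    · simp [h1]
    · have h2 : (j : ℕ) ≠ 0 := fun h => h1 (Fin.ext (by simpa using h))
      by_cases h3 : (j : ℕ) = (l : ℕ) + 1 <;> simp [h1, h3]
  rw [Finset.sum_congr rfl fun j _ => h0 j, Finset.sum_add_distrib]
  congr 1
  · simp
  · split_ifs with h
    · rw [Finset.sum_eq_single (⟨l + 1, h⟩ : Fin n)]
      · simp
      · intro j _ hj
        exact if_neg fun h' => hj (Fin.ext h')
      · simp
    · refine Finset.sum_eq_zero fun j _ => if_neg fun h' => h ?_
      rw [← h']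
      exact j.2

theorem lt_of_add_one_lt {l : Fin n} (h : (l : ℕ) + 1 < n) : l ≠ lastIdx n := by
  intro h'
  rw [h'] at h
  simp only [lastIdx] at h
  omega

theorem eq_lastIdx {l : Fin n} (h : ¬ (l : ℕ) + 1 < n) : l = lastIdx n :=
  Fin.ext (by
    have := l.2
    simp only [lastIdx]
    omega)

theorem linPart_apply (s A : ℝ) (β : Bool) (y : EuclideanSpace ℝ (Fin n)) (l : Fin n) :
    companionCLM (tentParam n s A β) y l =
      if h : (l : ℕ) + 1 < n then y ⟨l + 1, h⟩ else tentSlope s A β * y 0 := by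
  rw [companionCLM_apply]
  split_ifs with h
  · simp [tentParam, lt_of_add_one_lt h]
  · simp [tentParam, eq_lastIdx h]

theorem delayBranch_apply (s A : ℝ) (β : Bool) (y : EuclideanSpace ℝ (Fin n)) (l : Fin n) :
    delayBranch s A β y l =
      if h : (l : ℕ) + 1 < n then y ⟨l + 1, h⟩ else tentBranch s A β (y 0) := by
  rw [delayBranch, PiLp.add_apply, linPart_apply]
  split_ifs with h
  · simp [lt_of_add_one_lt h]
  · simp [eq_lastIdx h, tentBranch]

/-- The composition `G (w (t - 1)) ∘ ⋯ ∘ G (w 0)`. -/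
def wordIter {E : Type*} (G : Bool → E → E) (w : ℕ → Bool) : ℕ → E → E
  | 0 => id
  | t + 1 => G (w t) ∘ wordIter G w t

/-- The linear part of the composition of the branches of the delay map along a word. -/
noncomputable def wordLin (n : ℕ) [NeZero n] (s A : ℝ) (w : ℕ → Bool) :
    ℕ → EuclideanSpace ℝ (Fin n) →L[ℝ] EuclideanSpace ℝ (Fin n)
  | 0 => ContinuousLinearMap.id ℝ _
  | t + 1 => (companionCLM (tentParam n s A (w t))).comp (wordLin n s A w t)

theorem slopeSeq_add (s A : ℝ) (w : ℕ → Bool) (j : ℕ) :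
    slopeSeq n s A w (j + n) = tentSlope s A (w j) * slopeSeq n s A w j := by
  have hn : 0 < n := NeZero.pos n
  simp only [slopeSeq, Nat.add_div_right j hn, Nat.add_mod_right,
    Finset.prod_range_succ]
  rw [mul_comm (j / n) n, Nat.mod_add_div, mul_comm]

variable {s A : ℝ} {w : ℕ → Bool}

theorem wordIter_sub_wordIter (t : ℕ) (y z : EuclideanSpace ℝ (Fin n)) :
    wordIter (delayBranch s A) w t y - wordIter (delayBranch s A) w t z =
      wordLin n s A w t (y - z) := by
  induction t with
  | zero => rfl
  | succ t ih =>
    simp only [wordIter, wordLin, Function.comp_apply, ContinuousLinearMap.comp_apply]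
    rw [← ih, map_sub, delayBranch, delayBranch]
    abel

/-- A delay map only moves coordinates forwards in time, so the first coordinate along the orbit
records all of them. -/
theorem wordLin_apply_zero_shift (t : ℕ) (v : EuclideanSpace ℝ (Fin n)) (l : Fin n) :
    wordLin n s A w t v l = wordLin n s A w (t + l) v 0 := by
  obtain ⟨l, hl⟩ := l
  induction l generalizing t with
  | zero => rfl
  | succ l ih =>
    have h := ih (t + 1) (by omega)
    have h2 : wordLin n s A w (t + 1) v ⟨l, by omega⟩ = wordLin n s A w t v ⟨l + 1, hl⟩ := by
      simp only [wordLin, ContinuousLinearMap.comp_apply]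
      rw [linPart_apply, dif_pos hl]
    rw [← h2, h, show t + 1 + l = t + (l + 1) by omega]

theorem wordIter_apply_zero_shift (t : ℕ) (y : EuclideanSpace ℝ (Fin n)) (l : Fin n) :
    wordIter (delayBranch s A) w t y l = wordIter (delayBranch s A) w (t + l) y 0 := by
  obtain ⟨l, hl⟩ := l
  induction l generalizing t with
  | zero => rfl
  | succ l ih =>
    have h := ih (t + 1) (by omega)
    have h2 : wordIter (delayBranch s A) w (t + 1) y ⟨l, by omega⟩ =
        wordIter (delayBranch s A) w t y ⟨l + 1, hl⟩ := by
      simp only [wordIter, Function.comp_apply]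
      rw [delayBranch_apply, dif_pos hl]
    rw [← h2, h, show t + 1 + l = t + (l + 1) by omega]

theorem wordIter_apply_zero_add (t : ℕ) (y : EuclideanSpace ℝ (Fin n)) :
    wordIter (delayBranch s A) w (t + n) y 0 =
      tentBranch s A (w t) (wordIter (delayBranch s A) w t y 0) := by
  have hn : 0 < n := NeZero.pos n
  have h := wordIter_apply_zero_shift (s := s) (A := A) (w := w) (t + 1) y (lastIdx n)
  have h1 : t + 1 + ((lastIdx n : Fin n) : ℕ) = t + n := by
    simp only [lastIdx]
    omega
  rw [h1] at h
  rw [← h]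
  simp only [wordIter, Function.comp_apply]
  rw [delayBranch_apply, dif_neg]
  simp only [lastIdx]
  omega

theorem wordLin_apply_zero (t : ℕ) (v : EuclideanSpace ℝ (Fin n)) :
    wordLin n s A w t v 0 = slopeSeq n s A w t * v (resid n t) := by
  have hn : 0 < n := NeZero.pos n
  induction t using Nat.strong_induction_on with
  | _ t ih =>
    rcases lt_or_ge t n with h | h
    · have h1 := wordLin_apply_zero_shift (s := s) (A := A) (w := w) 0 v ⟨t, h⟩
      simp only [zero_add] at h1
      rw [← h1, slopeSeq, Nat.div_eq_of_lt h, Finset.range_zero, Finset.prod_empty, one_mul]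
      exact congrArg (fun l => v l) (Fin.ext (Nat.mod_eq_of_lt h).symm)
    · obtain ⟨t, rfl⟩ := Nat.exists_eq_add_of_le' h
      have h1 := wordLin_apply_zero_shift (s := s) (A := A) (w := w) (t + 1) v (lastIdx n)
      have h2 : t + 1 + ((lastIdx n : Fin n) : ℕ) = t + n := by
        simp only [lastIdx]
        omega
      rw [h2] at h1
      have h3 : resid n (t + n) = resid n t := by simpa using resid_add_mul (n := n) t 1
      rw [← h1, slopeSeq_add, h3, mul_assoc, ← ih t (by omega)]
      simp only [wordLin, ContinuousLinearMap.comp_apply]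
      rw [linPart_apply, dif_neg]
      simp only [lastIdx]
      omega

/-- The coordinates decouple: each output coordinate depends on one input coordinate. At times
divisible by `n` the linear part is diagonal. -/
theorem wordLin_apply (t : ℕ) (v : EuclideanSpace ℝ (Fin n)) (l : Fin n) :
    wordLin n s A w t v l = slopeSeq n s A w (t + l) * v (resid n (t + l)) := by
  rw [wordLin_apply_zero_shift, wordLin_apply_zero]

/-- The maps `G β` are of class `C^r` and `C¹`-close to the branches of the delay map on a ball. -/
def IsCloseToDelay (r : ℕ∞) (s A δ R : ℝ)
    (G : Bool → EuclideanSpace ℝ (Fin n) → EuclideanSpace ℝ (Fin n)) : Prop :=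
  ∀ β, ∀ p ∈ Metric.ball (0 : EuclideanSpace ℝ (Fin n)) R, ContDiffAt ℝ r (G β) p ∧
    ‖G β p - delayBranch s A β p‖ ≤ δ ∧
    ‖fderiv ℝ (G β) p - companionCLM (tentParam n s A β)‖ ≤ δ

theorem IsCloseToDelay.mono {r : ℕ∞} {δ δ' R R' : ℝ}
    {G : Bool → EuclideanSpace ℝ (Fin n) → EuclideanSpace ℝ (Fin n)}
    (h : IsCloseToDelay r s A δ R G) (hδ : δ ≤ δ') (hR : R' ≤ R) :
    IsCloseToDelay r s A δ' R' G := fun β p hp =>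
  have h1 := h β p (Metric.ball_subset_ball hR hp)
  ⟨h1.1, h1.2.1.trans hδ, h1.2.2.trans hδ⟩

theorem enat_cast_ne_zero {r : ℕ∞} (hr : 1 ≤ r) : (r : WithTop ℕ∞) ≠ 0 := by
  have : (1 : WithTop ℕ∞) ≤ (r : WithTop ℕ∞) := by exact_mod_cast hr
  intro h0
  rw [h0] at this
  simp at this

theorem exists_bound_wordIter (n : ℕ) [NeZero n] (s A R₀ : ℝ) :
    ∃ M : ℝ, 1 ≤ M ∧ (∀ β, ‖companionCLM (tentParam n s A β)‖ ≤ M) ∧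
      ∀ t, ∃ B : ℝ, ∀ w, ‖wordLin n s A w t‖ ≤ B ∧
        ∀ p ∈ Metric.ball (0 : EuclideanSpace ℝ (Fin n)) R₀,
          ‖wordIter (delayBranch s A) w t p‖ ≤ B := by
  set M : ℝ := 1 + ‖companionCLM (tentParam n s A false)‖ +
    ‖companionCLM (tentParam n s A true)‖ with hM
  have h0 := norm_nonneg (companionCLM (tentParam n s A false))
  have h1 := norm_nonneg (companionCLM (tentParam n s A true))
  have hMβ : ∀ β, ‖companionCLM (tentParam n s A β)‖ ≤ M := by
    intro β
    cases β <;> linarith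
  refine ⟨M, by linarith, hMβ, fun t => ?_⟩
  induction t with
  | zero =>
    refine ⟨max 1 R₀, fun w => ⟨?_, fun p hp => ?_⟩⟩
    · exact ContinuousLinearMap.norm_id_le.trans (le_max_left _ _)
    · exact (mem_ball_zero_iff.1 hp).le.trans (le_max_right _ _)
  | succ t ih =>
    obtain ⟨B, hB⟩ := ih
    refine ⟨M * B + 1, fun w => ⟨?_, fun p hp => ?_⟩⟩
    · refine (ContinuousLinearMap.opNorm_comp_le _ _).trans ?_
      have := mul_le_mul (hMβ (w t)) (hB w).1 (norm_nonneg _) (by linarith)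
      linarith
    · simp only [wordIter, Function.comp_apply, delayBranch]
      refine (norm_add_le _ _).trans ?_
      have h2 := (companionCLM (tentParam n s A (w t))).le_opNorm
        (wordIter (delayBranch s A) w t p)
      have h3 := mul_le_mul (hMβ (w t)) ((hB w).2 p hp) (norm_nonneg _) (by linarith)
      simp only [PiLp.norm_single, norm_one]
      exact add_le_add (h2.trans h3) le_rfl

/-- Induction on the length of the word. Closeness holds for every word, including itineraries that
no point follows, and `δ`, `R` depend neither on `r` nor on `G`. -/
theorem wordIter_close (n : ℕ) [NeZero n] (s A R₀ : ℝ) (T : ℕ) : ∀ ε : ℝ, 0 < ε →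
    ∃ δ : ℝ, 0 < δ ∧ ∃ R : ℝ, ∀ r : ℕ∞, 1 ≤ r →
      ∀ G : Bool → EuclideanSpace ℝ (Fin n) → EuclideanSpace ℝ (Fin n),
      IsCloseToDelay r s A δ R G → ∀ w, ∀ p ∈ Metric.ball (0 : EuclideanSpace ℝ (Fin n)) R₀,
      ∀ t ≤ T, ContDiffAt ℝ r (wordIter G w t) p ∧
        ‖wordIter G w t p - wordIter (delayBranch s A) w t p‖ ≤ ε ∧
        ‖fderiv ℝ (wordIter G w t) p - wordLin n s A w t‖ ≤ ε := by
  obtain ⟨M, hM1, hM, hB⟩ := exists_bound_wordIter n s A R₀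
  induction T with
  | zero =>
    intro ε hε
    refine ⟨1, one_pos, 0, fun r hr G hG w p hp t ht => ?_⟩
    obtain rfl : t = 0 := by omega
    refine ⟨contDiffAt_id, ?_, ?_⟩
    · simp [wordIter, hε.le]
    · simp [wordIter, wordLin, hε.le]
  | succ T ih =>
    intro ε hε
    obtain ⟨B, hB⟩ := hB T
    have hB0 : 0 ≤ B := (norm_nonneg _).trans (hB fun _ => false).1
    set ε' : ℝ := min 1 (ε / (2 * M)) with hε'
    have hε'0 : 0 < ε' := by positivity
    have hε'1 : ε' ≤ 1 := min_le_left _ _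
    have hMε' : M * ε' ≤ ε / 2 := by
      have : ε' ≤ ε / (2 * M) := min_le_right _ _
      calc M * ε' ≤ M * (ε / (2 * M)) := mul_le_mul_of_nonneg_left this (by linarith)
        _ = ε / 2 := by field_simp
    have hε'ε : ε' ≤ ε := by nlinarith
    obtain ⟨δ, hδ, R, hR⟩ := ih ε' hε'0
    set δ' : ℝ := min δ (ε / (2 * (B + 1))) with hδ'
    have hδ'0 : 0 < δ' := by positivity
    have hδB : δ' * (B + 1) ≤ ε / 2 := by
      have : δ' ≤ ε / (2 * (B + 1)) := min_le_right _ _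
      calc δ' * (B + 1) ≤ ε / (2 * (B + 1)) * (B + 1) :=
            mul_le_mul_of_nonneg_right this (by linarith)
        _ = ε / 2 := by field_simp
    have hδε : δ' ≤ ε / 2 := by nlinarith
    -- The perturbed point at time `T` has norm at most `B + ε' ≤ B + 1`, so it still lies in the
    -- ball where `G` is controlled.
    refine ⟨δ', hδ'0, max R (B + 2), fun r hr G hG w p hp t ht => ?_⟩
    have hT := hR r hr G (hG.mono (min_le_left _ _) (le_max_left _ _)) w p hp
    rcases Nat.le_or_eq_of_le_succ ht with ht | rfl
    · obtain ⟨h1, h2, h3⟩ := hT t ht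
      exact ⟨h1, h2.trans hε'ε, h3.trans hε'ε⟩
    obtain ⟨h1, h2, h3⟩ := hT T le_rfl
    have hball : wordIter G w T p ∈
        Metric.ball (0 : EuclideanSpace ℝ (Fin n)) (max R (B + 2)) := by
      rw [mem_ball_zero_iff]
      have := norm_le_norm_add_norm_sub' (wordIter G w T p) (wordIter (delayBranch s A) w T p)
      have := (hB w).2 p hp
      exact lt_of_lt_of_le (by linarith) (le_max_right _ _)
    obtain ⟨g1, g2, g3⟩ := hG (w T) _ hball
    have hd1 := h1.differentiableAt (enat_cast_ne_zero hr)
    have hd2 := g1.differentiableAt (enat_cast_ne_zero hr)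
    refine ⟨g1.comp p h1, ?_, ?_⟩
    · have e1 : wordIter G w (T + 1) p - wordIter (delayBranch s A) w (T + 1) p =
          (G (w T) (wordIter G w T p) - delayBranch s A (w T) (wordIter G w T p)) +
          companionCLM (tentParam n s A (w T))
            (wordIter G w T p - wordIter (delayBranch s A) w T p) := by
        simp only [wordIter, Function.comp_apply, delayBranch, map_sub]
        abel
      rw [e1]
      refine (norm_add_le _ _).trans ?_
      have h4 := (companionCLM (tentParam n s A (w T))).le_opNorm
        (wordIter G w T p - wordIter (delayBranch s A) w T p)
      have h5 := mul_le_mul (hM (w T)) h2 (norm_nonneg _) (by linarith)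
      linarith
    · have e1 : fderiv ℝ (wordIter G w (T + 1)) p =
          (fderiv ℝ (G (w T)) (wordIter G w T p)).comp (fderiv ℝ (wordIter G w T) p) :=
        fderiv_comp p hd2 hd1
      have e2 : fderiv ℝ (wordIter G w (T + 1)) p - wordLin n s A w (T + 1) =
          (fderiv ℝ (G (w T)) (wordIter G w T p) - companionCLM (tentParam n s A (w T))).comp
            (fderiv ℝ (wordIter G w T) p) +
          (companionCLM (tentParam n s A (w T))).comp
            (fderiv ℝ (wordIter G w T) p - wordLin n s A w T) := by
        rw [e1]
        simp only [wordLin, ContinuousLinearMap.sub_comp, ContinuousLinearMap.comp_sub]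
        abel
      rw [e2]
      refine (norm_add_le _ _).trans ?_
      have h4 : ‖fderiv ℝ (wordIter G w T) p‖ ≤ B + 1 := by
        have := norm_le_norm_add_norm_sub' (fderiv ℝ (wordIter G w T) p) (wordLin n s A w T)
        linarith [(hB w).1]
      have h5 := (ContinuousLinearMap.opNorm_comp_le
        (fderiv ℝ (G (w T)) (wordIter G w T p) - companionCLM (tentParam n s A (w T)))
        (fderiv ℝ (wordIter G w T) p)).trans
        (mul_le_mul g3 h4 (norm_nonneg _) hδ'0.le)
      have h6 := (ContinuousLinearMap.opNorm_comp_le (companionCLM (tentParam n s A (w T)))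
        (fderiv ℝ (wordIter G w T) p - wordLin n s A w T)).trans
        (mul_le_mul (hM (w T)) h3 (norm_nonneg _) (by linarith))
      linarith

end DelayMap

/-! ### Trapping regions of perturbed delay maps -/

section Boxes

variable {k n : ℕ}

/-- The lower endpoint of the `i`-th interval of a cycle as it is used in the `l`-th coordinate.
Each shift of the coordinates to the left enlarges the interval by `η`. -/
def boxLo (n : ℕ) (η : ℝ) (a : ZMod k → ℝ) (i : ZMod k) (l : ℕ) : ℝ := a i - (n - l) * η

/-- The upper endpoint of the `i`-th interval in the `l`-th coordinate. -/
def boxHi (n : ℕ) (η : ℝ) (b : ZMod k → ℝ) (i : ZMod k) (l : ℕ) : ℝ := b i + (n - l) * η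

/-- The closed box with index `x`. -/
def cycleBox (η : ℝ) (a b : ZMod k → ℝ) (x : Fin n → ZMod k) : Set (EuclideanSpace ℝ (Fin n)) :=
  {y | ∀ l, y l ∈ Icc (boxLo n η a (x l) l) (boxHi n η b (x l) l)}

/-- The open box with index `x`. -/
def openCycleBox (η : ℝ) (a b : ZMod k → ℝ) (x : Fin n → ZMod k) :
    Set (EuclideanSpace ℝ (Fin n)) :=
  {y | ∀ l, y l ∈ Ioo (boxLo n η a (x l) l) (boxHi n η b (x l) l)}

theorem isOpen_openCycleBox (η : ℝ) (a b : ZMod k → ℝ) (x : Fin n → ZMod k) :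
    IsOpen (openCycleBox η a b x) := by
  simp only [openCycleBox, ofPred_forall]
  refine isOpen_iInter_of_finite fun l => ?_
  exact isOpen_Ioo.preimage (show Continuous fun y : EuclideanSpace ℝ (Fin n) => y l by fun_prop)

theorem isClosed_cycleBox (η : ℝ) (a b : ZMod k → ℝ) (x : Fin n → ZMod k) :
    IsClosed (cycleBox η a b x) := by
  simp only [cycleBox, ofPred_forall]
  refine isClosed_iInter fun l => ?_
  exact isClosed_Icc.preimage (show Continuous fun y : EuclideanSpace ℝ (Fin n) => y l by fun_prop)

theorem openCycleBox_subset (η : ℝ) (a b : ZMod k → ℝ) (x : Fin n → ZMod k) :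
    openCycleBox η a b x ⊆ cycleBox η a b x := fun _ hy l => Ioo_subset_Icc_self (hy l)

theorem exists_cycleBox_subset_ball [NeZero k] (n : ℕ) (η : ℝ) (a b : ZMod k → ℝ) :
    ∃ R : ℝ, 0 < R ∧ ∀ x : Fin n → ZMod k,
      cycleBox η a b x ⊆ Metric.ball (0 : EuclideanSpace ℝ (Fin n)) R := by
  have hb : ∀ x : Fin n → ZMod k, Bornology.IsBounded (cycleBox η a b x) := by
    intro x
    have h1 : Bornology.IsBounded
        (Set.pi univ fun l : Fin n => Icc (boxLo n η a (x l) l) (boxHi n η b (x l) l)) :=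
      Bornology.IsBounded.pi fun l => Metric.isBounded_Icc _ _
    have h2 := (PiLp.antilipschitzWith_ofLp 2 (fun _ : Fin n => ℝ)).isBounded_preimage h1
    exact h2.subset fun y hy l _ => hy l
  obtain ⟨R, hR⟩ := (Bornology.isBounded_iUnion.2 hb).subset_ball
    (0 : EuclideanSpace ℝ (Fin n))
  exact ⟨max R 1, by positivity, fun x =>
    (subset_iUnion _ x).trans (hR.trans (Metric.ball_subset_ball (le_max_left _ _)))⟩

theorem isCompact_cycleBox [NeZero k] (η : ℝ) (a b : ZMod k → ℝ) (x : Fin n → ZMod k) :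
    IsCompact (cycleBox η a b x) := by
  obtain ⟨R, -, hR⟩ := exists_cycleBox_subset_ball n η a b
  exact Metric.isCompact_of_isClosed_isBounded (isClosed_cycleBox η a b x)
    (Metric.isBounded_ball.subset (hR x))

/-- Within `k * n` steps a given coordinate visits each of the `k` intervals exactly once. -/
theorem seqExt_injective_of_resid_eq [NeZero n] (x : Fin n → ZMod k) {t t' : ℕ} (ht : t < k * n)
    (ht' : t' < k * n) (hres : resid n t = resid n t') (h : seqExt x t = seqExt x t') : t = t' := by
  have hn : 0 < n := NeZero.pos n
  simp only [seqExt, hres, add_right_inj] at h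
  rw [ZMod.natCast_eq_natCast_iff', Nat.mod_eq_of_lt ((Nat.div_lt_iff_lt_mul hn).2 ht),
    Nat.mod_eq_of_lt ((Nat.div_lt_iff_lt_mul hn).2 ht')] at h
  have h2 : t % n = t' % n := congrArg Fin.val hres
  rw [← Nat.mod_add_div t n, ← Nat.mod_add_div t' n, h, h2]

/-- By decoupling, only the symbols at earlier times congruent to `t` matter. If they follow the
cycle without reaching interval `0`, `c_step` carries the centre along. -/
theorem wordIter_tentCycle_center [NeZero k] [NeZero n] {s A P η : ℝ} {a b c : ZMod k → ℝ} {side : ZMod k → Bool}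
    (hC : IsTentCycle k n s A P η a b c side) (x : Fin n → ZMod k)
    (z : EuclideanSpace ℝ (Fin n)) (hz : ∀ l, z l = c (x l)) (w : ℕ → Bool) (t : ℕ)
    (hw : ∀ t' < t, resid n t' = resid n t → seqExt x t' ≠ 0 ∧ w t' = side (seqExt x t')) :
    wordIter (delayBranch s A) w t z 0 = c (seqExt x t) := by
  have hn : 0 < n := NeZero.pos n
  induction t using Nat.strong_induction_on with
  | _ t ih =>
    rcases lt_or_ge t n with h | h
    · have h1 := wordIter_apply_zero_shift (s := s) (A := A) (w := w) 0 z ⟨t, h⟩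
      simp only [zero_add] at h1
      rw [← h1]
      change z ⟨t, h⟩ = _
      rw [hz, ← seqExt_fin x]
    · obtain ⟨t, rfl⟩ := Nat.exists_eq_add_of_le' h
      have hres : resid n t = resid n (t + n) := by
        simpa using (resid_add_mul (n := n) t 1).symm
      obtain ⟨h1, h2⟩ := hw t (by omega) hres
      rw [wordIter_apply_zero_add, ih t (by omega) fun t' ht' hr =>
        hw t' (by omega) (hr.trans hres), h2, hC.c_step _ h1, seqExt_add_card]

/-- A map `Φ` whose two branches are `C¹`-close to those of a delay map with a cycle of
intervals, so close that the boxes built from the intervals control the dynamics. -/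
structure IsPerturbedCycle (k n : ℕ) [NeZero k] [NeZero n] (s A P η : ℝ) (a b c : ZMod k → ℝ)
    (side : ZMod k → Bool) (r : ℕ∞) (R ε : ℝ)
    (G : Bool → EuclideanSpace ℝ (Fin n) → EuclideanSpace ℝ (Fin n))
    (Φ : EuclideanSpace ℝ (Fin n) → EuclideanSpace ℝ (Fin n)) : Prop where
  cycle : IsTentCycle k n s A P η a b c side
  s_pos : 0 < s
  s_le_one : s ≤ 1
  s_le : s ≤ A
  one_le : 1 ≤ r
  left : ∀ p, p 0 ≤ 0 → Φ p = G false p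
  right : ∀ p, 0 ≤ p 0 → Φ p = G true p
  subset_ball : ∀ x : Fin n → ZMod k, cycleBox η a b x ⊆ Metric.ball 0 R
  eps_nonneg : 0 ≤ ε
  eps_lt_eta : ε < η
  eps_lt_slope : n * ε < s ^ k
  eps_lt_gap : ε < s ^ k * η
  eps_lt_expansion : ε < P - 1
  contDiffAt : ∀ w, ∀ p ∈ Metric.ball (0 : EuclideanSpace ℝ (Fin n)) R, ∀ t ≤ k * n,
    ContDiffAt ℝ r (wordIter G w t) p
  close : ∀ w, ∀ p ∈ Metric.ball (0 : EuclideanSpace ℝ (Fin n)) R, ∀ t ≤ k * n,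
    ‖wordIter G w t p - wordIter (delayBranch s A) w t p‖ ≤ ε
  fderiv_close : ∀ w, ∀ p ∈ Metric.ball (0 : EuclideanSpace ℝ (Fin n)) R, ∀ t ≤ k * n,
    ‖fderiv ℝ (wordIter G w t) p - wordLin n s A w t‖ ≤ ε

/-- The sign attached to a side of the switching manifold. -/
def sideSign (β : Bool) : ℝ := bif β then 1 else -1

/-- The functions whose positivity describes the set of points of a box with a given itinerary. -/
def boxConstraint [NeZero n] (η : ℝ) (a b : ZMod k → ℝ)
    (G : Bool → EuclideanSpace ℝ (Fin n) → EuclideanSpace ℝ (Fin n)) (x : Fin n → ZMod k)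
    (w : ℕ → Bool) : (Fin n × Bool) ⊕ Fin (k * n) → EuclideanSpace ℝ (Fin n) → ℝ
  | Sum.inl (l, true), p => boxHi n η b (x l) l - p l
  | Sum.inl (l, false), p => p l - boxLo n η a (x l) l
  | Sum.inr t, p => sideSign (w t) * wordIter G w t p 0

/-- The coordinate on which a constraint depends to leading order. -/
def constraintCoord [NeZero n] : (Fin n × Bool) ⊕ Fin (k * n) → Fin n
  | Sum.inl (l, _) => l
  | Sum.inr t => resid n t

/-- The leading order slope of a constraint. -/
noncomputable def constraintSlope (n : ℕ) (s A : ℝ) (w : ℕ → Bool) :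
    (Fin n × Bool) ⊕ Fin (k * n) → ℝ
  | Sum.inl (_, true) => -1
  | Sum.inl (_, false) => 1
  | Sum.inr t => sideSign (w t) * slopeSeq n s A w t

/-- The points of the box with index `x` that follow the itinerary `w`. -/
def boxPiece [NeZero n] (η : ℝ) (a b : ZMod k → ℝ)
    (G : Bool → EuclideanSpace ℝ (Fin n) → EuclideanSpace ℝ (Fin n)) (R : ℝ)
    (x : Fin n → ZMod k) (w : ℕ → Bool) : Set (EuclideanSpace ℝ (Fin n)) :=
  {p ∈ Metric.ball 0 R | ∀ i, 0 < boxConstraint η a b G x w i p}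

end Boxes

theorem abs_sideSign (β : Bool) : |sideSign β| = 1 := by
  cases β <;> simp [sideSign]

theorem apply_zero_mem_of_mem_cycleBox {k n : ℕ} [NeZero n] {η : ℝ} {a b : ZMod k → ℝ}
    {x : Fin n → ZMod k} {p : EuclideanSpace ℝ (Fin n)}
    (hp : p ∈ cycleBox η a b x) : p 0 ∈ Icc (a (x 0) - n * η) (b (x 0) + n * η) := by
  have := hp 0
  simpa [boxLo, boxHi] using this

theorem mem_cycleBox_of_nonneg {k n : ℕ} [NeZero n] {η : ℝ} {a b : ZMod k → ℝ}
    {G : Bool → EuclideanSpace ℝ (Fin n) → EuclideanSpace ℝ (Fin n)} {x : Fin n → ZMod k} {w : ℕ → Bool}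
    {p : EuclideanSpace ℝ (Fin n)} (hp : ∀ i, 0 ≤ boxConstraint η a b G x w i p) :
    p ∈ cycleBox η a b x := fun l =>
  ⟨by simpa [boxConstraint] using hp (Sum.inl (l, false)),
    by simpa [boxConstraint] using hp (Sum.inl (l, true))⟩

theorem boxPiece_subset {k n : ℕ} [NeZero n] (η R : ℝ) (a b : ZMod k → ℝ)
    (G : Bool → EuclideanSpace ℝ (Fin n) → EuclideanSpace ℝ (Fin n)) (x : Fin n → ZMod k) (w : ℕ → Bool) :
    boxPiece η a b G R x w ⊆ cycleBox η a b x := fun _ hp =>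
  mem_cycleBox_of_nonneg fun i => (hp.2 i).le

theorem closure_boxPiece_subset {k n : ℕ} [NeZero n] (η R : ℝ) (a b : ZMod k → ℝ)
    (G : Bool → EuclideanSpace ℝ (Fin n) → EuclideanSpace ℝ (Fin n)) (x : Fin n → ZMod k) (w : ℕ → Bool) :
    closure (boxPiece η a b G R x w) ⊆ cycleBox η a b x :=
  closure_minimal (boxPiece_subset η R a b G x w) (isClosed_cycleBox η a b x)

/-! ### Boxes, itineraries and pieces for a perturbed delay map. -/

namespace IsPerturbedCycle

variable {k n : ℕ} [NeZero k] [NeZero n] {s A P η : ℝ} {a b c : ZMod k → ℝ}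
  {side : ZMod k → Bool} {r : ℕ∞} {R ε : ℝ}
  {G : Bool → EuclideanSpace ℝ (Fin n) → EuclideanSpace ℝ (Fin n)}
  {Φ : EuclideanSpace ℝ (Fin n) → EuclideanSpace ℝ (Fin n)}
  (h : IsPerturbedCycle k n s A P η a b c side r R ε G Φ)

include h

theorem coord_mem {x : Fin n → ZMod k} {p : EuclideanSpace ℝ (Fin n)}
    (hp : p ∈ cycleBox η a b x) (l : Fin n) :
    p l ∈ Icc (a (x l) - n * η) (b (x l) + n * η) := by
  have h1 := hp l
  have h2 : ((l : ℕ) : ℝ) * η ≥ 0 := mul_nonneg (Nat.cast_nonneg _) h.cycle.eta_pos.le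
  simp only [boxLo, boxHi, mem_Icc] at h1
  exact ⟨by linarith [h1.1], by linarith [h1.2]⟩

theorem disjoint_cycleBox {x y : Fin n → ZMod k} (hxy : x ≠ y) :
    Disjoint (cycleBox η a b x) (cycleBox η a b y) := by
  rw [Set.disjoint_left]
  intro p hp hp'
  obtain ⟨l, hl⟩ := Function.ne_iff.1 hxy
  exact h.cycle.disjoint _ _ _ hl (h.coord_mem hp l) (h.coord_mem hp' l)

theorem nonempty_openCycleBox (x : Fin n → ZMod k) : (openCycleBox η a b x).Nonempty := by
  refine ⟨WithLp.toLp 2 fun l => c (x l), fun l => ?_⟩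
  have h1 : ((l : ℕ) : ℝ) ≤ n := by exact_mod_cast l.2.le
  have h2 : 0 ≤ ((n : ℝ) - l) * η := mul_nonneg (by linarith) h.cycle.eta_pos.le
  have h3 := h.cycle.lt_c (x l)
  have h4 := h.cycle.c_lt (x l)
  simp only [boxLo, boxHi, mem_Ioo]
  exact ⟨by linarith, by linarith⟩

theorem eq_branch {p : EuclideanSpace ℝ (Fin n)} {β : Bool} (hβ0 : β = false → p 0 ≤ 0)
    (hβ1 : β = true → 0 ≤ p 0) : Φ p = G β p := by
  cases β with
  | false => exact h.left p (hβ0 rfl)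
  | true => exact h.right p (hβ1 rfl)

theorem branch_close (β : Bool) {p : EuclideanSpace ℝ (Fin n)} (hp : p ∈ Metric.ball 0 R) :
    ‖G β p - delayBranch s A β p‖ ≤ ε :=
  h.close (fun _ => β) p hp 1 (Nat.mul_pos (NeZero.pos k) (NeZero.pos n))

/-- Moving one coordinate to the left gains a margin `η`, and the new last coordinate lands in an
interval that the box enlarges by `η`. Since `ε < η`, the image is strictly inside. -/
theorem map_mem {x : Fin n → ZMod k} {p : EuclideanSpace ℝ (Fin n)}
    (hp : p ∈ cycleBox η a b x) : Φ p ∈ openCycleBox η a b (cycShift x) := by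
  obtain ⟨β, hβ0, hβ1⟩ : ∃ β : Bool, (β = false → p 0 ≤ 0) ∧ (β = true → 0 ≤ p 0) := by
    rcases le_total (p 0) 0 with h0 | h0
    · exact ⟨false, fun _ => h0, fun h => by simp at h⟩
    · exact ⟨true, fun h => by simp at h, fun _ => h0⟩
  rw [h.eq_branch hβ0 hβ1]
  intro l
  have h1 : |G β p l - delayBranch s A β p l| ≤ ε := by
    have := PiLp.norm_apply_le (G β p - delayBranch s A β p) l
    rw [PiLp.sub_apply, Real.norm_eq_abs] at this
    exact this.trans (h.branch_close β (h.subset_ball x hp))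
  have h2 := abs_le.1 h1
  have hε := h.eps_lt_eta
  rw [delayBranch_apply] at h2
  simp only [boxLo, boxHi, mem_Ioo, cycShift]
  by_cases hl : (l : ℕ) + 1 < n
  · rw [dif_pos hl] at h2
    have h3 := hp ⟨l + 1, hl⟩
    simp only [boxLo, boxHi, mem_Icc] at h3
    push_cast at h3
    rw [dif_pos hl]
    constructor
    · linarith [h3.1, h2.1]
    · linarith [h3.2, h2.2]
  · rw [dif_neg hl] at h2
    have h3 := h.cycle.mapsTo (x 0) (p 0) β (apply_zero_mem_of_mem_cycleBox hp) hβ0 hβ1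
    have h4 : (n : ℝ) = (l : ℕ) + 1 := by
      have : n = (l : ℕ) + 1 := by
        have := l.2
        omega
      exact_mod_cast this
    rw [dif_neg hl, h4]
    constructor
    · linarith [h3.1, h2.1]
    · linarith [h3.2, h2.2]

theorem iterate_mem {x : Fin n → ZMod k} {p : EuclideanSpace ℝ (Fin n)}
    (hp : p ∈ cycleBox η a b x) (t : ℕ) : Φ^[t] p ∈ cycleBox η a b (cycShift^[t] x) := by
  induction t with
  | zero => exact hp
  | succ t ih =>
    rw [Function.iterate_succ_apply', Function.iterate_succ_apply']
    exact openCycleBox_subset _ _ _ _ (h.map_mem ih)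

theorem iterate_apply_zero_mem {x : Fin n → ZMod k} {p : EuclideanSpace ℝ (Fin n)}
    (hp : p ∈ cycleBox η a b x) (t : ℕ) :
    Φ^[t] p 0 ∈ Icc (a (seqExt x t) - n * η) (b (seqExt x t) + n * η) := by
  have h1 := apply_zero_mem_of_mem_cycleBox (h.iterate_mem hp t)
  rw [iterate_cycShift_apply] at h1
  simpa using h1

/-- Only the interval with index `0` meets the turning point, even after enlargement. -/
theorem seqExt_eq_zero {x : Fin n → ZMod k} {p : EuclideanSpace ℝ (Fin n)}
    (hp : p ∈ cycleBox η a b x) {t : ℕ} (h0 : Φ^[t] p 0 = 0) : seqExt x t = 0 := by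
  by_contra hne
  have h1 := h.iterate_apply_zero_mem hp t
  rw [h0] at h1
  cases hs : side (seqExt x t) with
  | false => linarith [h.cycle.neg _ hne hs, h1.2]
  | true => linarith [h.cycle.pos _ hne hs, h1.1]

theorem wordIter_eq_iterate {p : EuclideanSpace ℝ (Fin n)} {w : ℕ → Bool} {T : ℕ}
    (hw : ∀ t < T, 0 ≤ sideSign (w t) * wordIter G w t p 0) :
    ∀ t ≤ T, wordIter G w t p = Φ^[t] p := by
  intro t
  induction t with
  | zero => exact fun _ => rfl
  | succ t ih =>
    intro ht
    have h1 := ih (by omega)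
    have h2 := hw t (by omega)
    rw [h1] at h2
    rw [Function.iterate_succ_apply']
    change G (w t) (wordIter G w t p) = _
    rw [h1]
    refine (h.eq_branch (fun hβ => ?_) fun hβ => ?_).symm
    · simpa [hβ, sideSign] using h2
    · simpa [hβ, sideSign] using h2

/-- Counterpart of `wordIter_eq_iterate` with the signs read off the true orbit, for a word
constructed from the point. -/
theorem wordIter_eq_iterate_of_sign {p : EuclideanSpace ℝ (Fin n)} {w : ℕ → Bool} {T : ℕ}
    (hw : ∀ t < T, 0 ≤ sideSign (w t) * Φ^[t] p 0) :
    ∀ t ≤ T, wordIter G w t p = Φ^[t] p := by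
  intro t
  induction t with
  | zero => exact fun _ => rfl
  | succ t ih =>
    intro ht
    have h1 := ih (by omega)
    have h2 := hw t (by omega)
    rw [Function.iterate_succ_apply']
    change G (w t) (wordIter G w t p) = _
    rw [h1]
    refine (h.eq_branch (fun hβ => ?_) fun hβ => ?_).symm
    · simpa [hβ, sideSign] using h2
    · simpa [hβ, sideSign] using h2

theorem eq_side {x : Fin n → ZMod k} {p : EuclideanSpace ℝ (Fin n)}
    (hp : p ∈ cycleBox η a b x) {t : ℕ} {β : Bool} (hβ : 0 ≤ sideSign β * Φ^[t] p 0)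
    (hne : seqExt x t ≠ 0) : β = side (seqExt x t) := by
  have h1 := h.iterate_apply_zero_mem hp t
  cases hs : side (seqExt x t) with
  | false =>
    have h2 := h.cycle.neg _ hne hs
    cases β with
    | false => rfl
    | true =>
      simp only [sideSign, cond_true, one_mul] at hβ
      linarith [h1.2]
  | true =>
    have h2 := h.cycle.pos _ hne hs
    cases β with
    | true => rfl
    | false =>
      simp only [sideSign, cond_false] at hβ
      linarith [h1.1]

theorem wordIter_eq_of_nonneg {x : Fin n → ZMod k} {w : ℕ → Bool}
    {p : EuclideanSpace ℝ (Fin n)} (hp : ∀ i, 0 ≤ boxConstraint η a b G x w i p) {t : ℕ}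
    (ht : t ≤ k * n) : wordIter G w t p = Φ^[t] p :=
  h.wordIter_eq_iterate (fun t ht => hp (Sum.inr ⟨t, ht⟩)) t ht

theorem sign_of_nonneg {x : Fin n → ZMod k} {w : ℕ → Bool}
    {p : EuclideanSpace ℝ (Fin n)} (hp : ∀ i, 0 ≤ boxConstraint η a b G x w i p) {t : ℕ}
    (ht : t < k * n) : 0 ≤ sideSign (w t) * Φ^[t] p 0 := by
  rw [← h.wordIter_eq_of_nonneg hp ht.le]
  exact hp (Sum.inr ⟨t, ht⟩)

theorem iterate_eq_zero_of_active {x : Fin n → ZMod k} {w : ℕ → Bool}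
    {p : EuclideanSpace ℝ (Fin n)} (hp : ∀ i, 0 ≤ boxConstraint η a b G x w i p)
    {t : Fin (k * n)} (h0 : boxConstraint η a b G x w (Sum.inr t) p = 0) : Φ^[t] p 0 = 0 := by
  rw [← h.wordIter_eq_of_nonneg hp t.2.le]
  rcases mul_eq_zero.1 h0 with h1 | h1
  · have := abs_sideSign (w t)
    rw [h1] at this
    simp at this
  · exact h1

/-- A point whose `t`-th iterate lies on the switching manifold is not on the corresponding faces
of its box. -/
theorem lt_abs_sub_of_active {x : Fin n → ZMod k} {w : ℕ → Bool}
    {p : EuclideanSpace ℝ (Fin n)} (hp : ∀ i, 0 ≤ boxConstraint η a b G x w i p)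
    {t : Fin (k * n)} (h0 : boxConstraint η a b G x w (Sum.inr t) p = 0) :
    |p (resid n t) - c (x (resid n t))| < η := by
  have hbox := mem_cycleBox_of_nonneg hp
  have hz := h.iterate_eq_zero_of_active hp h0
  have hext := h.seqExt_eq_zero hbox hz
  set z : EuclideanSpace ℝ (Fin n) := WithLp.toLp 2 fun l => c (x l) with hzdef
  -- The unperturbed orbit of the centre hits the switching manifold at the same time, so `p` and
  -- the centre can be compared through the slope in the single coordinate `resid n t`.
  have hzc : wordIter (delayBranch s A) w t z 0 = 0 := by
    rw [wordIter_tentCycle_center h.cycle x z (fun l => rfl) w t, hext, h.cycle.c_zero]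
    intro t' ht' hres
    have hlt : t' < k * n := ht'.trans t.2
    have hne : seqExt x t' ≠ 0 := by
      intro h1
      exact ht'.ne (seqExt_injective_of_resid_eq x hlt t.2 hres (h1.trans hext.symm))
    exact ⟨hne, h.eq_side hbox (h.sign_of_nonneg hp hlt) hne⟩
  have h1 : |wordIter G w t p 0 - wordIter (delayBranch s A) w t p 0| ≤ ε := by
    have h2 := PiLp.norm_apply_le (wordIter G w t p - wordIter (delayBranch s A) w t p) 0
    rw [PiLp.sub_apply, Real.norm_eq_abs] at h2
    exact h2.trans (h.close w p (h.subset_ball x hbox) t t.2.le)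
  rw [h.wordIter_eq_of_nonneg hp t.2.le, hz, zero_sub, abs_neg] at h1
  have h3 : wordIter (delayBranch s A) w t p 0 =
      slopeSeq n s A w t * (p (resid n t) - c (x (resid n t))) := by
    have h4 := congrArg (fun v : EuclideanSpace ℝ (Fin n) => v 0)
      (wordIter_sub_wordIter (s := s) (A := A) (w := w) t p z)
    simp only [PiLp.sub_apply, wordLin_apply_zero, hzc, sub_zero] at h4
    exact h4
  rw [h3, abs_mul] at h1
  have h5 := pow_le_abs_slopeSeq (w := w) h.s_pos h.s_le_one h.s_le t.2.le
  have h6 : 0 < s ^ k := pow_pos h.s_pos k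
  have h7 := mul_le_mul_of_nonneg_right h5
    (abs_nonneg (p (resid n t) - c (x (resid n t))))
  exact lt_of_mul_lt_mul_left ((h7.trans h1).trans_lt h.eps_lt_gap) h6.le

theorem le_abs_sub_of_face {x : Fin n → ZMod k} {w : ℕ → Bool}
    {p : EuclideanSpace ℝ (Fin n)} {l : Fin n} {β : Bool}
    (h0 : boxConstraint η a b G x w (Sum.inl (l, β)) p = 0) : η ≤ |p l - c (x l)| := by
  have h1 : ((l : ℕ) : ℝ) + 1 ≤ n := by exact_mod_cast l.2
  have h2 : 1 * η ≤ ((n : ℝ) - l) * η :=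
    mul_le_mul_of_nonneg_right (by linarith) h.cycle.eta_pos.le
  have h3 := h.cycle.lt_c (x l)
  have h4 := h.cycle.c_lt (x l)
  cases β with
  | false =>
    simp only [boxConstraint, boxLo] at h0
    refine le_trans ?_ (neg_le_abs _)
    linarith
  | true =>
    simp only [boxConstraint, boxHi] at h0
    refine le_trans ?_ (le_abs_self _)
    linarith

/-- Opposite faces are disjoint; a point on the switching manifold at time `t` is less than `η` from
the centre in coordinate `resid n t`, while faces are at least `η` away; two crossing times with the
same residue would both have index `0`, against `seqExt_injective_of_resid_eq`. -/
theorem constraintCoord_injective {x : Fin n → ZMod k} {w : ℕ → Bool}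
    {p : EuclideanSpace ℝ (Fin n)} (hp : ∀ i, 0 ≤ boxConstraint η a b G x w i p) :
    Function.Injective fun i : {i // boxConstraint η a b G x w i p = 0} =>
      constraintCoord (i : (Fin n × Bool) ⊕ Fin (k * n)) := by
  have hbox := mem_cycleBox_of_nonneg hp
  have hmix : ∀ (l : Fin n) (β : Bool) (t : Fin (k * n)),
      boxConstraint η a b G x w (Sum.inl (l, β)) p = 0 →
      boxConstraint η a b G x w (Sum.inr t) p = 0 → l ≠ resid n t := by
    rintro l β t h1 h2 rfl
    exact absurd (h.lt_abs_sub_of_active hp h2) (not_lt.2 (h.le_abs_sub_of_face h1))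
  have hface : ∀ l : Fin n, boxConstraint η a b G x w (Sum.inl (l, false)) p = 0 →
      boxConstraint η a b G x w (Sum.inl (l, true)) p ≠ 0 := by
    intro l h1 h2
    simp only [boxConstraint] at h1 h2
    have h3 : ((l : ℕ) : ℝ) ≤ n := by exact_mod_cast l.2.le
    have h4 : 0 ≤ ((n : ℝ) - l) * η := mul_nonneg (by linarith) h.cycle.eta_pos.le
    simp only [boxLo, boxHi] at h1 h2
    linarith [h.cycle.lt_c (x l), h.cycle.c_lt (x l)]
  rintro ⟨i | t, hi⟩ ⟨j | t', hj⟩ hij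
  · obtain ⟨l, β⟩ := i
    obtain ⟨l', β'⟩ := j
    obtain rfl : l = l' := hij
    cases β <;> cases β'
    · rfl
    · exact absurd hj (hface l hi)
    · exact absurd hi (hface l hj)
    · rfl
  · obtain ⟨l, β⟩ := i
    exact absurd hij (hmix l β t' hi hj)
  · obtain ⟨l, β⟩ := j
    exact absurd hij.symm (hmix l β t hj hi)
  · have h1 := h.seqExt_eq_zero hbox (h.iterate_eq_zero_of_active hp hi)
    have h2 := h.seqExt_eq_zero hbox (h.iterate_eq_zero_of_active hp hj)
    have h3 := seqExt_injective_of_resid_eq x t.2 t'.2 hij (h1.trans h2.symm)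
    obtain rfl : t = t' := Fin.ext h3
    rfl

theorem contDiffAt_boxConstraint (x : Fin n → ZMod k) (w : ℕ → Bool)
    (i : (Fin n × Bool) ⊕ Fin (k * n)) {p : EuclideanSpace ℝ (Fin n)}
    (hp : p ∈ Metric.ball 0 R) : ContDiffAt ℝ r (boxConstraint η a b G x w i) p := by
  rcases i with ⟨l, β⟩ | t
  · have h1 : ContDiffAt ℝ r (fun y : EuclideanSpace ℝ (Fin n) => y l) p :=
      (contDiff_piLp_apply (p := 2)).contDiffAt
    cases β
    · exact h1.sub contDiffAt_const
    · exact contDiffAt_const.sub h1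
  · have h2 : ContDiffAt ℝ r (fun y => wordIter G w t y 0) p :=
      (contDiff_piLp_apply (p := 2) (i := (0 : Fin n))).contDiffAt.comp p
        (h.contDiffAt w p hp t t.2.le)
    exact contDiffAt_const.mul h2

theorem fderiv_boxConstraint_close (x : Fin n → ZMod k) (w : ℕ → Bool)
    (i : (Fin n × Bool) ⊕ Fin (k * n)) {p : EuclideanSpace ℝ (Fin n)}
    (hp : p ∈ Metric.ball 0 R) (v : EuclideanSpace ℝ (Fin n)) :
    |fderiv ℝ (boxConstraint η a b G x w i) p v -
      constraintSlope n s A w i * v (constraintCoord i)| ≤ ε * ‖v‖ := by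
  have hε : 0 ≤ ε * ‖v‖ := mul_nonneg h.eps_nonneg (norm_nonneg _)
  have hproj : ∀ l : Fin n, HasFDerivAt (fun y : EuclideanSpace ℝ (Fin n) => y l)
      (EuclideanSpace.proj l : EuclideanSpace ℝ (Fin n) →L[ℝ] ℝ) p := fun l =>
    (EuclideanSpace.proj l : EuclideanSpace ℝ (Fin n) →L[ℝ] ℝ).hasFDerivAt
  rcases i with ⟨l, β⟩ | t
  · cases β
    · have h1 : HasFDerivAt (boxConstraint η a b G x w (Sum.inl (l, false)))
          (EuclideanSpace.proj l : EuclideanSpace ℝ (Fin n) →L[ℝ] ℝ) p :=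
        (hproj l).sub_const _
      rw [h1.fderiv]
      simpa [constraintSlope, constraintCoord] using hε
    · have h1 : HasFDerivAt (boxConstraint η a b G x w (Sum.inl (l, true)))
          (-(EuclideanSpace.proj l : EuclideanSpace ℝ (Fin n) →L[ℝ] ℝ)) p :=
        (hproj l).const_sub _
      rw [h1.fderiv]
      simpa [constraintSlope, constraintCoord] using hε
  · have hd := ((h.contDiffAt w p hp t t.2.le).differentiableAt
      (enat_cast_ne_zero h.one_le)).hasFDerivAt
    have h1 : HasFDerivAt (boxConstraint η a b G x w (Sum.inr t))
        (sideSign (w t) • (EuclideanSpace.proj (0 : Fin n) :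
          EuclideanSpace ℝ (Fin n) →L[ℝ] ℝ).comp (fderiv ℝ (wordIter G w t) p)) p :=
      ((EuclideanSpace.proj (0 : Fin n) :
          EuclideanSpace ℝ (Fin n) →L[ℝ] ℝ).hasFDerivAt.comp p hd).const_mul _
    rw [h1.fderiv]
    have h2 : (sideSign (w t) • (EuclideanSpace.proj (0 : Fin n) :
          EuclideanSpace ℝ (Fin n) →L[ℝ] ℝ).comp (fderiv ℝ (wordIter G w t) p)) v -
        constraintSlope n s A w (Sum.inr t) * v (constraintCoord (Sum.inr t)) =
        sideSign (w t) * (fderiv ℝ (wordIter G w t) p - wordLin n s A w t) v 0 := by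
      simp only [constraintSlope, constraintCoord, mul_assoc, ← wordLin_apply_zero]
      simp [mul_sub]
    rw [h2, abs_mul, abs_sideSign, one_mul]
    have h3 := PiLp.norm_apply_le ((fderiv ℝ (wordIter G w t) p - wordLin n s A w t) v) 0
    rw [Real.norm_eq_abs] at h3
    exact h3.trans (((fderiv ℝ (wordIter G w t) p - wordLin n s A w t).le_opNorm v).trans
      (mul_le_mul_of_nonneg_right (h.fderiv_close w p hp t t.2.le) (norm_nonneg _)))

theorem le_abs_constraintSlope (w : ℕ → Bool) (i : (Fin n × Bool) ⊕ Fin (k * n)) :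
    s ^ k ≤ |constraintSlope n s A w i| := by
  rcases i with ⟨l, β⟩ | t
  · have := pow_le_one₀ h.s_pos.le h.s_le_one (n := k)
    cases β <;> simpa [constraintSlope] using this
  · rw [constraintSlope, abs_mul, abs_sideSign, one_mul]
    exact pow_le_abs_slopeSeq h.s_pos h.s_le_one h.s_le t.2.le

theorem linearIndependent_active {x : Fin n → ZMod k} {w : ℕ → Bool}
    {p : EuclideanSpace ℝ (Fin n)} (hp : ∀ i, 0 ≤ boxConstraint η a b G x w i p) :
    LinearIndependent ℝ fun i : {i // boxConstraint η a b G x w i p = 0} =>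
      fderiv ℝ (boxConstraint η a b G x w i) p := by
  classical
  exact linearIndependent_of_diagonallyDominant (h.constraintCoord_injective hp)
    (d := fun i => constraintSlope n s A w i.1) (fun i => h.le_abs_constraintSlope w i)
    h.eps_lt_slope h.eps_nonneg fun i v => h.fderiv_boxConstraint_close x w i
      (h.subset_ball x (mem_cycleBox_of_nonneg hp)) v

theorem exists_direction {x : Fin n → ZMod k} {w : ℕ → Bool}
    {p : EuclideanSpace ℝ (Fin n)} (hp : ∀ i, 0 ≤ boxConstraint η a b G x w i p) :
    ∃ v, ∀ i, boxConstraint η a b G x w i p = 0 →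
      0 < fderiv ℝ (boxConstraint η a b G x w i) p v := by
  classical
  obtain ⟨v, hv⟩ := exists_forall_pos_of_diagonallyDominant
    (ℓ := fun i : {i // boxConstraint η a b G x w i p = 0} =>
      fderiv ℝ (boxConstraint η a b G x w i) p) (h.constraintCoord_injective hp)
    (d := fun i => constraintSlope n s A w i.1) (fun i => h.le_abs_constraintSlope w i)
    h.eps_lt_slope h.eps_nonneg fun i v => h.fderiv_boxConstraint_close x w i
      (h.subset_ball x (mem_cycleBox_of_nonneg hp)) v
  exact ⟨v, fun i hi => hv ⟨i, hi⟩⟩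

theorem contDiffOn_boxConstraint (x : Fin n → ZMod k) (w : ℕ → Bool)
    (i : (Fin n × Bool) ⊕ Fin (k * n)) :
    ContDiffOn ℝ r (boxConstraint η a b G x w i) (Metric.ball 0 R) := fun _ hp =>
  (h.contDiffAt_boxConstraint x w i hp).contDiffWithinAt

theorem isOpen_boxPiece (x : Fin n → ZMod k) (w : ℕ → Bool) :
    IsOpen (boxPiece η a b G R x w) :=
  isOpen_forall_pos Metric.isOpen_ball fun i => (h.contDiffOn_boxConstraint x w i).continuousOn

theorem hasPiecewiseCrBoundary_boxPiece (x : Fin n → ZMod k) (w : ℕ → Bool) :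
    HasPiecewiseCrBoundary r (boxPiece η a b G R x w) :=
  hasPiecewiseCrBoundary_forall_pos Metric.isOpen_ball (h.contDiffOn_boxConstraint x w)
    ((closure_boxPiece_subset η R a b G x w).trans (h.subset_ball x))
    fun _ _ hp => h.linearIndependent_active hp

theorem iterate_eq_on_boxPiece (x : Fin n → ZMod k) (w : ℕ → Bool) :
    EqOn (wordIter G w (k * n)) Φ^[k * n] (boxPiece η a b G R x w) := fun _ hp =>
  h.wordIter_eq_of_nonneg (fun i => (hp.2 i).le) le_rfl

/-- Weak inequalities suffice: the common direction of increase pushes `p` into the open piece. This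
is what makes the closed pieces cover the box. -/
theorem exists_mem_closure_boxPiece {x : Fin n → ZMod k} {p : EuclideanSpace ℝ (Fin n)}
    (hp : p ∈ cycleBox η a b x) (w : ℕ → Bool)
    (hw : ∀ t < k * n, 0 ≤ sideSign (w t) * Φ^[t] p 0) :
    p ∈ closure (boxPiece η a b G R x w) := by
  have h0 : ∀ i, 0 ≤ boxConstraint η a b G x w i p := by
    rintro (⟨l, β⟩ | t)
    · cases β
      · exact sub_nonneg.2 (hp l).1
      · exact sub_nonneg.2 (hp l).2
    · simp only [boxConstraint]
      rw [h.wordIter_eq_iterate_of_sign hw t t.2.le]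
      exact hw t t.2
  exact mem_closure_forall_pos Metric.isOpen_ball (h.contDiffOn_boxConstraint x w) h.one_le
    (h.subset_ball x hp) h0 (h.exists_direction h0)

theorem disjoint_boxPiece {x : Fin n → ZMod k} {w w' : ℕ → Bool} {t : ℕ} (ht : t < k * n)
    (hww : w t ≠ w' t) : Disjoint (boxPiece η a b G R x w) (boxPiece η a b G R x w') := by
  rw [Set.disjoint_left]
  intro p hp hp'
  have h1 := hp.2 (Sum.inr ⟨t, ht⟩)
  have h2 := hp'.2 (Sum.inr ⟨t, ht⟩)
  simp only [boxConstraint] at h1 h2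
  rw [h.wordIter_eq_of_nonneg (fun i => (hp.2 i).le) ht.le] at h1
  rw [h.wordIter_eq_of_nonneg (fun i => (hp'.2 i).le) ht.le] at h2
  cases hw : w t <;> cases hw' : w' t <;> simp only [hw, hw', sideSign, cond_true, cond_false] at *
  · exact hww rfl
  · linarith
  · linarith
  · exact hww rfl

theorem le_abs_slopeSeq_period {x : Fin n → ZMod k} {w : ℕ → Bool}
    {p : EuclideanSpace ℝ (Fin n)} (hp : ∀ i, 0 ≤ boxConstraint η a b G x w i p) (l : Fin n) :
    P ≤ |slopeSeq n s A w (k * n + l)| := by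
  have hn : 0 < n := NeZero.pos n
  have hbox := mem_cycleBox_of_nonneg hp
  have h1 : (k * n + (l : ℕ)) / n = k := by
    rw [Nat.add_comm, Nat.add_mul_div_right _ _ hn, Nat.div_eq_of_lt l.2, zero_add]
  have h2 : (k * n + (l : ℕ)) % n = l := by
    rw [Nat.add_comm, Nat.add_mul_mod_self_right, Nat.mod_eq_of_lt l.2]
  have hlt : ∀ j < k, (l : ℕ) + j * n < k * n := by
    intro j hj
    have : (j + 1) * n ≤ k * n := Nat.mul_le_mul_right n hj
    have := l.2
    nlinarith
  rw [slopeSeq, h1, h2, Finset.abs_prod]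
  -- Coordinate `l` is in interval `i` at time `l + (i - x l).val * n`. Its symbol is forced for `i
  -- ≠ 0` and free for `i = 0`, just as in `le_prod`.
  refine (h.cycle.le_prod (fun i => w (l + (i - x l).val * n)) fun i hi => ?_).trans
    (le_of_eq ?_)
  · have hv := ZMod.val_lt (i - x l)
    have hext : seqExt x (l + (i - x l).val * n) = i := by
      rw [seqExt_add_mul, seqExt_fin, ZMod.natCast_zmod_val]
      ring
    rw [h.eq_side hbox (h.sign_of_nonneg hp (hlt _ hv)) (by rwa [hext]), hext]
  · refine Finset.prod_nbij' (fun i => (i - x l).val) (fun j => (j : ZMod k) + x l)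
      ?_ ?_ ?_ ?_ ?_
    · intro i _
      exact Finset.mem_range.2 (ZMod.val_lt _)
    · intro j _
      exact Finset.mem_univ _
    · intro i _
      simp
    · intro j hj
      simp [ZMod.val_cast_of_lt (Finset.mem_range.1 hj)]
    · intro i _
      rfl

theorem le_norm_fderiv_iterate {x : Fin n → ZMod k} {w : ℕ → Bool}
    {p : EuclideanSpace ℝ (Fin n)} (hp : p ∈ boxPiece η a b G R x w)
    (v : EuclideanSpace ℝ (Fin n)) : (P - ε) * ‖v‖ ≤ ‖fderiv ℝ Φ^[k * n] p v‖ := by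
  have he : Φ^[k * n] =ᶠ[𝓝 p] wordIter G w (k * n) := by
    filter_upwards [(h.isOpen_boxPiece x w).mem_nhds hp] with q hq
    exact (h.iterate_eq_on_boxPiece x w hq).symm
  rw [he.fderiv_eq]
  have hP0 : 0 ≤ P := by linarith [h.cycle.one_lt]
  -- The linear part is diagonal at time `k * n`, so the Euclidean norm is compared coordinate by
  -- coordinate.
  have h1 : P * ‖v‖ ≤ ‖wordLin n s A w (k * n) v‖ := by
    refine abs_le_of_sq_le_sq' ?_ (norm_nonneg _) |>.2
    rw [mul_pow, EuclideanSpace.real_norm_sq_eq, EuclideanSpace.real_norm_sq_eq, Finset.mul_sum]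
    refine Finset.sum_le_sum fun l _ => ?_
    have h2 : resid n (k * n + l) = l := by
      rw [add_comm, resid_add_mul, resid_val]
    rw [wordLin_apply, h2, mul_pow]
    refine mul_le_mul_of_nonneg_right ?_ (sq_nonneg _)
    rw [← sq_abs (slopeSeq n s A w (k * n + l))]
    exact pow_le_pow_left₀ hP0 (h.le_abs_slopeSeq_period (fun i => (hp.2 i).le) l) 2
  have h2 := ((fderiv ℝ (wordIter G w (k * n)) p - wordLin n s A w (k * n)).le_opNorm v).trans
    (mul_le_mul_of_nonneg_right (h.fderiv_close w p hp.1 _ le_rfl) (norm_nonneg _))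
  rw [sub_apply] at h2
  have h3 := norm_le_norm_add_norm_sub' (wordLin n s A w (k * n) v)
    (fderiv ℝ (wordIter G w (k * n)) p v)
  rw [norm_sub_rev] at h3
  linarith

theorem exists_trapping_regions {N : ℕ} (orb : (Fin n → ZMod k) → Fin N)
    (hsurj : Function.Surjective orb) (horb : ∀ x, orb (cycShift x) = orb x) :
    ∃ Ω : Fin N → Set (EuclideanSpace ℝ (Fin n)),
      (Pairwise fun i j => Disjoint (Ω i) (Ω j)) ∧
      ∀ i, (Ω i).Nonempty ∧ IsTrappingRegion Φ (Ω i) ∧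
        IsPiecewiseCrExpanding r Φ^[k * n] (Ω i) := by
  classical
  refine ⟨fun i => ⋃ x ∈ {x | orb x = i}, cycleBox η a b x, ?_, fun i => ⟨?_, ⟨?_, ?_⟩, ?_⟩⟩
  · intro i j hij
    simp only [mem_ofPred_eq, disjoint_iUnion_left, disjoint_iUnion_right]
    intro x hx y hy
    refine h.disjoint_cycleBox ?_
    rintro rfl
    exact hij (hy.symm.trans hx) |>.elim
  · obtain ⟨x, hx⟩ := hsurj i
    obtain ⟨p, hp⟩ := h.nonempty_openCycleBox x
    exact ⟨p, mem_biUnion (show x ∈ {x | orb x = i} from hx) (openCycleBox_subset _ _ _ _ hp)⟩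
  · exact (Set.toFinite _).isCompact_biUnion fun x _ => isCompact_cycleBox η a b x
  · rintro _ ⟨p, hp, rfl⟩
    simp only [mem_iUnion, mem_ofPred_eq] at hp
    obtain ⟨x, hx, hp⟩ := hp
    have hsub : openCycleBox η a b (cycShift x) ⊆
        ⋃ x ∈ {x | orb x = i}, cycleBox η a b x :=
      (openCycleBox_subset _ _ _ _).trans
        (subset_biUnion_of_mem (u := fun x => cycleBox η a b x)
          (show cycShift x ∈ {x | orb x = i} from (horb x).trans hx))
    exact interior_maximal hsub (isOpen_openCycleBox η a b _) (h.map_mem hp)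
  · let κ := {x : Fin n → ZMod k // orb x = i} × (Fin (k * n) → Bool)
    let e : κ ≃ Fin (Nat.card κ) := Finite.equivFin κ
    -- Only symbols before time `k * n` are read, so the default `false` is harmless; truncation
    -- makes the pieces finite in number.
    let ext : (Fin (k * n) → Bool) → ℕ → Bool := fun w t =>
      if ht : t < k * n then w ⟨t, ht⟩ else false
    have hext : ∀ w (t : Fin (k * n)), ext w t = w t := fun w t => by simp [ext]
    let Q : κ → Set (EuclideanSpace ℝ (Fin n)) := fun q => boxPiece η a b G R q.1 (ext q.2)
    refine ⟨Nat.card κ, fun j => Q (e.symm j), ?_, P - ε, ?_, ?_⟩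
    · refine
        { isCompact := (Set.toFinite _).isCompact_biUnion fun x _ => isCompact_cycleBox η a b x
          mapsTo := ?_
          isOpen := fun j => h.isOpen_boxPiece _ _
          subset := fun j => (boxPiece_subset _ _ _ _ _ _ _).trans
            (subset_biUnion_of_mem (u := fun x => cycleBox η a b x)
              (show _ ∈ {x | orb x = i} from (e.symm j).1.2))
          disjoint := ?_
          boundary := fun j => h.hasPiecewiseCrBoundary_boxPiece _ _
          cover := ?_
          smooth := ?_
          extend := ?_ }
      · intro p hp
        simp only [mem_iUnion, mem_ofPred_eq] at hp ⊢
        obtain ⟨x, hx, hp⟩ := hp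
        have := h.iterate_mem hp (k * n)
        rw [iterate_cycShift_mul] at this
        exact ⟨x, hx, this⟩
      · intro j j' hjj
        have hne : e.symm j ≠ e.symm j' := fun h' => hjj (e.symm.injective h')
        by_cases hx : (e.symm j).1 = (e.symm j').1
        · have hw : (e.symm j).2 ≠ (e.symm j').2 := fun hw => hne (Prod.ext hx hw)
          obtain ⟨t, ht⟩ := Function.ne_iff.1 hw
          simp only [Q, hx]
          exact h.disjoint_boxPiece t.2 (by rwa [hext, hext])
        · exact (h.disjoint_cycleBox fun h' => hx (Subtype.ext h')).mono
            (boxPiece_subset _ _ _ _ _ _ _) (boxPiece_subset _ _ _ _ _ _ _)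
      · refine Subset.antisymm ?_ ?_
        · intro p hp
          simp only [mem_iUnion, mem_ofPred_eq] at hp
          obtain ⟨x, hx, hp⟩ := hp
          -- On the switching manifold either symbol would do; here the right one is taken.
          let w : Fin (k * n) → Bool := fun t => decide (0 ≤ Φ^[t] p 0)
          have h1 : p ∈ closure (boxPiece η a b G R x (ext w)) := by
            refine h.exists_mem_closure_boxPiece hp _ fun t ht => ?_
            rw [hext w ⟨t, ht⟩]
            by_cases h0 : 0 ≤ Φ^[t] p 0
            · simp [w, h0, sideSign]
            · simpa [w, h0, sideSign] using (not_le.1 h0).le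
          refine mem_iUnion.2 ⟨e ⟨⟨x, hx⟩, w⟩, ?_⟩
          simpa [Q] using h1
        · refine iUnion_subset fun j => (closure_boxPiece_subset _ _ _ _ _ _ _).trans
            (subset_biUnion_of_mem (u := fun x => cycleBox η a b x)
              (show _ ∈ {x | orb x = i} from (e.symm j).1.2))
      · intro j
        have h1 : ContDiffOn ℝ r (wordIter G (ext (e.symm j).2) (k * n)) (Q (e.symm j)) :=
          fun p hp => (h.contDiffAt _ p hp.1 _ le_rfl).contDiffWithinAt
        exact h1.congr fun p hp => (h.iterate_eq_on_boxPiece _ _ hp).symm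
      · intro j
        exact ⟨wordIter G (ext (e.symm j).2) (k * n), Metric.ball 0 R, Metric.isOpen_ball,
          (closure_boxPiece_subset _ _ _ _ _ _ _).trans (h.subset_ball _),
          fun p hp => (h.contDiffAt _ p hp _ le_rfl).contDiffWithinAt,
          h.iterate_eq_on_boxPiece _ _⟩
    · linarith [h.eps_lt_expansion]
    · intro p hp v
      obtain ⟨j, hj⟩ := mem_iUnion.1 hp
      exact h.le_norm_fderiv_iterate hj v

end IsPerturbedCycle

/-- Every piecewise smooth map with branches close to those of a delay map with a cycle of
intervals has trapping regions labelled by the orbits of the cyclic shift. -/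
theorem exists_trapping_regions_of_close (k n : ℕ) [NeZero k] [NeZero n] {s A P η : ℝ}
    {a b c : ZMod k → ℝ} {side : ZMod k → Bool} (hC : IsTentCycle k n s A P η a b c side)
    (hs : 0 < s) (hs1 : s ≤ 1) (hsA : s ≤ A) {N : ℕ} (orb : (Fin n → ZMod k) → Fin N)
    (hsurj : Function.Surjective orb) (horb : ∀ x, orb (cycShift x) = orb x) :
    ∃ δ : ℝ, 0 < δ ∧ ∃ R : ℝ, ∀ r : ℕ∞, 1 ≤ r →
      ∀ (G : Bool → EuclideanSpace ℝ (Fin n) → EuclideanSpace ℝ (Fin n))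
        (Φ : EuclideanSpace ℝ (Fin n) → EuclideanSpace ℝ (Fin n)),
      IsCloseToDelay r s A δ R G → (∀ p, p 0 ≤ 0 → Φ p = G false p) →
      (∀ p, 0 ≤ p 0 → Φ p = G true p) →
      ∃ Ω : Fin N → Set (EuclideanSpace ℝ (Fin n)),
        (Pairwise fun i j => Disjoint (Ω i) (Ω j)) ∧
        ∀ i, (Ω i).Nonempty ∧ IsTrappingRegion Φ (Ω i) ∧
          IsPiecewiseCrExpanding r Φ^[k * n] (Ω i) := by
  have hn : (0 : ℝ) < n := Nat.cast_pos.2 (NeZero.pos n)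
  have hη := hC.eta_pos
  have hP := hC.one_lt
  obtain ⟨R₀, -, hR₀⟩ := exists_cycleBox_subset_ball n η a b
  -- The four bounds on `ε` in `IsPerturbedCycle`; half the minimum satisfies them strictly.
  set m : ℝ := min (min η (s ^ k * η)) (min (s ^ k / n) (P - 1)) with hm
  have hsk : 0 < s ^ k := pow_pos hs k
  have hm0 : 0 < m := lt_min (lt_min hη (by positivity)) (lt_min (by positivity) (by linarith))
  obtain ⟨δ, hδ, R, hR⟩ := wordIter_close n s A R₀ (k * n) (m / 2) (by linarith)
  refine ⟨δ, hδ, R, fun r hr G Φ hG hl hrt => ?_⟩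
  have hlt : m / 2 < m := by linarith
  have h1 : m / 2 < s ^ k / n :=
    hlt.trans_le ((min_le_right _ _).trans (min_le_left _ _))
  have hpc : IsPerturbedCycle k n s A P η a b c side r R₀ (m / 2) G Φ :=
    { cycle := hC
      s_pos := hs
      s_le_one := hs1
      s_le := hsA
      one_le := hr
      left := hl
      right := hrt
      subset_ball := hR₀
      eps_nonneg := by linarith
      eps_lt_eta := hlt.trans_le ((min_le_left _ _).trans (min_le_left _ _))
      eps_lt_slope := by
        rw [lt_div_iff₀ hn] at h1
        linarith
      eps_lt_gap := hlt.trans_le ((min_le_left _ _).trans (min_le_right _ _))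
      eps_lt_expansion := hlt.trans_le ((min_le_right _ _).trans (min_le_right _ _))
      contDiffAt := fun w p hp t ht => (hR r hr G hG w p hp t ht).1
      close := fun w p hp t ht => (hR r hr G hG w p hp t ht).2.1
      fderiv_close := fun w p hp t ht => (hR r hr G hG w p hp t ht).2.2 }
  exact hpc.exists_trapping_regions orb hsurj horb

/-! ### Conjugation by homotheties -/

theorem IsAsympStableFixedPt.of_semiconj {X Y : Type*} [TopologicalSpace X] [TopologicalSpace Y]
    {Φ : X → X} {F : Y → Y} (e : X ≃ₜ Y) (he : Function.Semiconj e Φ F) {p : X}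
    (h : IsAsympStableFixedPt Φ p) : IsAsympStableFixedPt F (e p) := by
  have hiter : ∀ (j : ℕ) (y : Y), F^[j] y = e (Φ^[j] (e.symm y)) := fun j y => by
    rw [(he.iterate_right j).eq, e.apply_symm_apply]
  have hsymm : Tendsto e.symm (𝓝 (e p)) (𝓝 p) := by
    simpa using e.symm.continuous.tendsto (e p)
  refine ⟨?_, fun U hU => ?_, ?_⟩
  · exact h.isFixedPt.map he
  · obtain ⟨V, hV, hVU⟩ := h.stable (e ⁻¹' U) (e.continuous.continuousAt hU)
    refine ⟨e.symm ⁻¹' V, hsymm hV, fun y hy j => ?_⟩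
    rw [hiter]
    exact hVU _ hy j
  · obtain ⟨V, hV, hVU⟩ := h.attracting
    refine ⟨e.symm ⁻¹' V, hsymm hV, fun y hy => ?_⟩
    simp only [hiter]
    exact (e.continuous.tendsto p).comp (hVU _ hy)

theorem IsTrappingRegion.image {X Y : Type*} [TopologicalSpace X] [TopologicalSpace Y]
    {Φ : X → X} {F : Y → Y} (e : X ≃ₜ Y) (he : Function.Semiconj e Φ F) {Ω : Set X}
    (h : IsTrappingRegion Φ Ω) : IsTrappingRegion F (e '' Ω) := by
  refine ⟨h.1.image e.continuous, ?_⟩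
  rw [← he.set_image, ← e.image_interior]
  exact image_mono h.2

section Homothety

variable {E : Type*} [NormedAddCommGroup E] [NormedSpace ℝ E]

/-- The homothety `y ↦ q + m • y`. -/
noncomputable def scaling (q : E) (m : ℝ) (hm : m ≠ 0) : E ≃ₜ E :=
  (Homeomorph.smulOfNeZero m hm).trans (Homeomorph.addLeft q)

variable {q : E} {m : ℝ} {hm : m ≠ 0}

theorem scaling_apply (y : E) : scaling q m hm y = q + m • y := rfl

theorem hasFDerivAt_scaling (y : E) :
    HasFDerivAt (scaling q m hm) (m • ContinuousLinearMap.id ℝ E) y :=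
  ((hasFDerivAt_id y).const_smul m).const_add q

theorem hasFDerivAt_scaling_symm (x : E) :
    HasFDerivAt (scaling q m hm).symm (m⁻¹ • ContinuousLinearMap.id ℝ E) x :=
  ((hasFDerivAt_id x).const_add (-q)).const_smul m⁻¹

theorem contDiff_scaling {r : WithTop ℕ∞} : ContDiff ℝ r (scaling q m hm) :=
  contDiff_const.add (contDiff_id.const_smul m)

theorem contDiff_scaling_symm {r : WithTop ℕ∞} : ContDiff ℝ r (scaling q m hm).symm :=
  (contDiff_const.add contDiff_id).const_smul m⁻¹

theorem contDiffOn_comp_scaling_symm {F : Type*} [NormedAddCommGroup F] [NormedSpace ℝ F]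
    {r : WithTop ℕ∞} {g : E → F} {V : Set E} (hg : ContDiffOn ℝ r g V) :
    ContDiffOn ℝ r (g ∘ (scaling q m hm).symm) (scaling q m hm '' V) :=
  hg.comp contDiff_scaling_symm.contDiffOn (by
    rintro _ ⟨y, hy, rfl⟩
    simpa using hy)

theorem HasPiecewiseCrBoundary.image_scaling {r : ℕ∞} (hr : 1 ≤ r) {W : Set E}
    (h : HasPiecewiseCrBoundary r W) : HasPiecewiseCrBoundary r (scaling q m hm '' W) := by
  intro p hp
  rw [← (scaling q m hm).image_frontier] at hp
  obtain ⟨y, hy, rfl⟩ := hp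
  obtain ⟨V, hV, hyV, N, g, hg, hg0, hli, hW⟩ := h y hy
  refine ⟨scaling q m hm '' V, (scaling q m hm).isOpenMap V hV, mem_image_of_mem _ hyV, N,
    fun i => g i ∘ (scaling q m hm).symm, fun i => contDiffOn_comp_scaling_symm (hg i),
    fun i => by simpa using hg0 i, ?_, ?_⟩
  · have hfd : ∀ i, fderiv ℝ (g i ∘ (scaling q m hm).symm) (scaling q m hm y) =
        m⁻¹ • fderiv ℝ (g i) y := by
      intro i
      have hd : DifferentiableAt ℝ (g i) ((scaling q m hm).symm (scaling q m hm y)) := by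
        rw [Homeomorph.symm_apply_apply]
        exact ((hg i).contDiffAt (hV.mem_nhds hyV)).differentiableAt (enat_cast_ne_zero hr)
      rw [(hd.hasFDerivAt.comp _ (hasFDerivAt_scaling_symm (scaling q m hm y))).fderiv,
        Homeomorph.symm_apply_apply]
      ext v
      simp
    simp only [hfd]
    exact hli.units_smul fun _ => Units.mk0 m⁻¹ (inv_ne_zero hm)
  · rw [← image_inter (scaling q m hm).injective, hW]
    ext x
    simp only [mem_image, mem_ofPred_eq]
    constructor
    · rintro ⟨z, ⟨hz, hz'⟩, rfl⟩
      exact ⟨⟨z, hz, rfl⟩, fun i => by simpa using hz' i⟩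
    · rintro ⟨⟨z, hz, rfl⟩, hz'⟩
      exact ⟨z, ⟨hz, fun i => by simpa using hz' i⟩, rfl⟩

/-- The factors `m` and `m⁻¹` cancel in the derivative, so the expansion constant is unchanged. -/
theorem IsPiecewiseCrExpanding.image_scaling {r : ℕ∞} (hr : 1 ≤ r) {Φ F : E → E} {Ω : Set E}
    (he : Function.Semiconj (scaling q m hm) Φ F) (h : IsPiecewiseCrExpanding r Φ Ω) :
    IsPiecewiseCrExpanding r F (scaling q m hm '' Ω) := by
  obtain ⟨N, Q, hQ, L, hL, hexp⟩ := h
  set e := scaling q m hm with hedef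
  have hF : F = e ∘ Φ ∘ e.symm := by
    funext x
    simp only [Function.comp_apply]
    rw [he.eq, e.apply_symm_apply]
  refine ⟨N, fun i => e '' Q i, ?_, L, hL, ?_⟩
  · refine
      { isCompact := hQ.isCompact.image e.continuous
        mapsTo := ?_
        isOpen := fun i => e.isOpenMap _ (hQ.isOpen i)
        subset := fun i => image_mono (hQ.subset i)
        disjoint := fun i j hij => (disjoint_image_iff e.injective).2 (hQ.disjoint hij)
        boundary := fun i => (hQ.boundary i).image_scaling hr
        cover := ?_
        smooth := fun i => ?_
        extend := fun i => ?_ }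
    · rintro _ ⟨y, hy, rfl⟩
      exact ⟨Φ y, hQ.mapsTo hy, he.eq y⟩
    · conv_lhs => rw [hQ.cover]
      rw [image_iUnion]
      exact iUnion_congr fun i => e.image_closure _
    · rw [hF]
      exact contDiff_scaling.comp_contDiffOn (contDiffOn_comp_scaling_symm (hQ.smooth i))
    · obtain ⟨G, O, hO, hcl, hG, hGF⟩ := hQ.extend i
      refine ⟨e ∘ G ∘ e.symm, e '' O, e.isOpenMap _ hO, ?_,
        contDiff_scaling.comp_contDiffOn (contDiffOn_comp_scaling_symm hG), ?_⟩
      · rw [← e.image_closure]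
        exact image_mono hcl
      · rintro _ ⟨y, hy, rfl⟩
        rw [hF]
        simp only [Function.comp_apply, e.symm_apply_apply, hGF hy]
  · intro x hx v
    obtain ⟨i, y, hy, rfl⟩ := mem_iUnion.1 hx
    have hd : DifferentiableAt ℝ Φ (e.symm (e y)) := by
      rw [e.symm_apply_apply]
      exact ((hQ.smooth i).contDiffAt ((hQ.isOpen i).mem_nhds hy)).differentiableAt
        (enat_cast_ne_zero hr)
    have h1 := (hasFDerivAt_scaling (q := q) (hm := hm) (Φ (e.symm (e y)))).comp (e y)
      (hd.hasFDerivAt.comp (e y) (hasFDerivAt_scaling_symm (q := q) (hm := hm) (e y)))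
    have h2 : fderiv ℝ F (e y) v = fderiv ℝ Φ y v := by
      rw [hF, h1.fderiv, e.symm_apply_apply]
      simp [smul_smul, hm]
    rw [h2]
    exact hexp y (mem_iUnion.2 ⟨i, hy⟩) v

end Homothety

/-! ### Stable fixed points of locally contracting maps -/

/-- Banach's theorem on the closed ball. The strict bound on the displacement of `q` puts the fixed
point in the interior, so a whole neighbourhood of it is attracted. -/
theorem exists_isAsympStableFixedPt_of_contracting {X : Type*} [MetricSpace X] [CompleteSpace X]
    {F : X → X} {q : X} {ρ κ : ℝ} (hκ : κ < 1) (hκ0 : 0 ≤ κ) (hρ : 0 < ρ)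
    (hF : ∀ x ∈ Metric.closedBall q ρ, ∀ y ∈ Metric.closedBall q ρ,
      dist (F x) (F y) ≤ κ * dist x y)
    (hq : dist (F q) q < (1 - κ) * ρ) : ∃ p, IsAsympStableFixedPt F p := by
  have hqm : q ∈ Metric.closedBall q ρ := Metric.mem_closedBall_self hρ.le
  have hmaps : MapsTo F (Metric.closedBall q ρ) (Metric.closedBall q ρ) := by
    intro x hx
    have h1 := hF x hx q hqm
    have h2 : κ * dist x q ≤ κ * ρ := mul_le_mul_of_nonneg_left hx hκ0
    have h3 := dist_triangle (F x) (F q) q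
    rw [Metric.mem_closedBall]
    linarith
  have hcontr : ContractingWith ⟨κ, hκ0⟩ (hmaps.restrict F _ _) := by
    refine ⟨by exact_mod_cast hκ, LipschitzWith.of_dist_le_mul fun x y => ?_⟩
    exact hF x x.2 y y.2
  obtain ⟨p, hp, hfix, -⟩ := hcontr.exists_fixedPoint' Metric.isClosed_closedBall.isComplete hmaps
    hqm (edist_ne_top _ _)
  have hpq : dist p q < ρ := by
    have h1 := hF p hp q hqm
    have h3 := dist_triangle (F p) (F q) q
    rw [hfix.eq] at h1 h3
    nlinarith
  have hdec : ∀ x, dist x p ≤ ρ - dist p q → ∀ j : ℕ, dist (F^[j] x) p ≤ κ ^ j * dist x p := by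
    intro x hx j
    induction j with
    | zero => simp
    | succ j ih =>
      have hj : dist (F^[j] x) p ≤ dist x p :=
        ih.trans (mul_le_of_le_one_left dist_nonneg (pow_le_one₀ hκ0 hκ.le))
      have hmem : F^[j] x ∈ Metric.closedBall q ρ := by
        have := dist_triangle (F^[j] x) p q
        rw [Metric.mem_closedBall]
        linarith
      have h1 := hF _ hmem p hp
      rw [hfix.eq] at h1
      rw [Function.iterate_succ_apply', pow_succ, mul_comm (κ ^ j), mul_assoc]
      exact h1.trans (mul_le_mul_of_nonneg_left ih hκ0)
  refine ⟨p, hfix, fun U hU => ?_, Metric.ball p (ρ - dist p q),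
    Metric.ball_mem_nhds _ (by linarith), fun x hx => ?_⟩
  · obtain ⟨ε, hε, hεU⟩ := Metric.mem_nhds_iff.1 hU
    refine ⟨Metric.ball p (min ε (ρ - dist p q)),
      Metric.ball_mem_nhds _ (lt_min hε (by linarith)), fun x hx j => hεU ?_⟩
    have hx1 : dist x p < min ε (ρ - dist p q) := hx
    have h1 := hdec x (hx1.le.trans (min_le_right _ _)) j
    have h2 : κ ^ j * dist x p ≤ dist x p :=
      mul_le_of_le_one_left dist_nonneg (pow_le_one₀ hκ0 hκ.le)
    exact (h1.trans h2).trans_lt (hx1.trans_le (min_le_left _ _))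
  · refine tendsto_iff_dist_tendsto_zero.2 ?_
    have hlim : Tendsto (fun j : ℕ => κ ^ j * dist x p) atTop (𝓝 0) := by
      simpa using (tendsto_pow_atTop_nhds_zero_of_lt_one hκ0 hκ).mul_const (dist x p)
    exact squeeze_zero (fun _ => dist_nonneg) (hdec x (le_of_lt hx)) hlim

/-- In the norm `‖D ·‖` the affine map contracts by `1 / 2`. A small `C¹` error raises this to `3 /
4` by the mean value inequality, and stability is transported back through `D`. -/
theorem exists_isAsympStableFixedPt_of_close_affine {E : Type*} [NormedAddCommGroup E]
    [NormedSpace ℝ E] [CompleteSpace E] (C : E →L[ℝ] E) (D : E ≃L[ℝ] E)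
    (hCD : ∀ v, ‖D (C v)‖ ≤ 1 / 2 * ‖D v‖) (q e : E) (hfix : C q + e = q) (H : Set E)
    (hH : H ∈ 𝓝 q) :
    ∃ δ : ℝ, 0 < δ ∧ ∃ R : ℝ, ∀ G Φ : E → E,
      (∀ p ∈ Metric.ball (0 : E) R, DifferentiableAt ℝ G p ∧ ‖G p - (C p + e)‖ ≤ δ ∧
        ‖fderiv ℝ G p - C‖ ≤ δ) →
      (∀ p ∈ H, Φ p = G p) → ∃ p, IsAsympStableFixedPt Φ p := by
  have hmem : (D.symm ⁻¹' (H ∩ Metric.ball (0 : E) (‖q‖ + 1))) ∈ 𝓝 (D q) := by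
    refine D.symm.continuous.continuousAt ?_
    rw [D.symm_apply_apply]
    exact inter_mem hH (Metric.isOpen_ball.mem_nhds (by
      rw [mem_ball_zero_iff]
      linarith))
  obtain ⟨ρ, hρ, hρsub⟩ := Metric.nhds_basis_closedBall.mem_iff.1 hmem
  set K : ℝ := ‖(D : E →L[ℝ] E)‖ + 1 with hK
  set K' : ℝ := ‖(D.symm : E →L[ℝ] E)‖ + 1 with hK'
  have hK0 : 0 < K := by positivity
  have hK'0 : 0 < K' := by positivity
  have hDle : ∀ v, ‖D v‖ ≤ K * ‖v‖ := fun v =>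
    ((D : E →L[ℝ] E).le_opNorm v).trans
      (mul_le_mul_of_nonneg_right (by linarith) (norm_nonneg _))
  have hDle' : ∀ v, ‖D.symm v‖ ≤ K' * ‖v‖ := fun v =>
    ((D.symm : E →L[ℝ] E).le_opNorm v).trans
      (mul_le_mul_of_nonneg_right (by linarith) (norm_nonneg _))
  refine ⟨min (1 / (4 * (K * K'))) (ρ / (8 * K)), by positivity, ‖q‖ + 1, fun G Φ hG hΦ => ?_⟩
  set δ : ℝ := min (1 / (4 * (K * K'))) (ρ / (8 * K)) with hδ
  have hδ1 : K * (δ * K') ≤ 1 / 4 := by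
    have h1 : δ ≤ 1 / (4 * (K * K')) := min_le_left _ _
    calc K * (δ * K') = δ * (K * K') := by ring
      _ ≤ 1 / (4 * (K * K')) * (K * K') := mul_le_mul_of_nonneg_right h1 (by positivity)
      _ = 1 / 4 := by field_simp
  have hδ2 : K * δ ≤ ρ / 8 := by
    have h1 : δ ≤ ρ / (8 * K) := min_le_right _ _
    calc K * δ ≤ K * (ρ / (8 * K)) := mul_le_mul_of_nonneg_left h1 hK0.le
      _ = ρ / 8 := by field_simp
  have hLip : ∀ x ∈ Metric.ball (0 : E) (‖q‖ + 1),
      ∀ y ∈ Metric.ball (0 : E) (‖q‖ + 1),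
      ‖D (G x - G y)‖ ≤ 3 / 4 * ‖D (x - y)‖ := by
    intro x hx y hy
    have h1 : ‖(G x - C x) - (G y - C y)‖ ≤ δ * ‖x - y‖ := by
      refine (convex_ball (0 : E) (‖q‖ + 1)).norm_image_sub_le_of_norm_fderiv_le (𝕜 := ℝ)
        (f := fun z => G z - C z) (fun z hz => ?_) (fun z hz => ?_) hy hx
      · exact (hG z hz).1.sub C.differentiableAt
      · rw [fderiv_fun_sub (hG z hz).1 C.differentiableAt, C.fderiv]
        exact (hG z hz).2.2
    have h2 : D (G x - G y) = D (C (x - y)) + D ((G x - C x) - (G y - C y)) := by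
      rw [← map_add, map_sub C]
      congr 1
      abel
    have h3 : ‖x - y‖ ≤ K' * ‖D (x - y)‖ := by
      simpa using hDle' (D (x - y))
    rw [h2]
    refine (norm_add_le _ _).trans ?_
    have h0 := hCD (x - y)
    have hδ0 : 0 ≤ δ := by positivity
    have h4 : ‖D ((G x - C x) - (G y - C y))‖ ≤ K * (δ * (K' * ‖D (x - y)‖)) :=
      (hDle _).trans (mul_le_mul_of_nonneg_left
        (h1.trans (mul_le_mul_of_nonneg_left h3 hδ0)) hK0.le)
    have h5 : K * (δ * (K' * ‖D (x - y)‖)) ≤ 1 / 4 * ‖D (x - y)‖ := by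
      calc K * (δ * (K' * ‖D (x - y)‖)) = K * (δ * K') * ‖D (x - y)‖ := by ring
        _ ≤ _ := mul_le_mul_of_nonneg_right hδ1 (norm_nonneg _)
    linarith
  have hstab : ∃ p, IsAsympStableFixedPt (fun y => D (Φ (D.symm y))) p := by
    refine exists_isAsympStableFixedPt_of_contracting (q := D q) (ρ := ρ) (κ := 3 / 4)
      (by norm_num) (by norm_num) hρ (fun x hx y hy => ?_) ?_
    · obtain ⟨hx1, hx2⟩ := hρsub hx
      obtain ⟨hy1, hy2⟩ := hρsub hy
      change dist (D (Φ (D.symm x))) (D (Φ (D.symm y))) ≤ _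
      rw [hΦ _ hx1, hΦ _ hy1, dist_eq_norm, dist_eq_norm, ← map_sub]
      simpa [map_sub] using hLip _ hx2 _ hy2
    · obtain ⟨hx1, hx2⟩ := hρsub (Metric.mem_closedBall_self hρ.le)
      rw [D.symm_apply_apply] at hx1 hx2 ⊢
      rw [hΦ _ hx1, dist_eq_norm, ← map_sub]
      have h1 := (hG q hx2).2.1
      rw [hfix] at h1
      have h2 := (hDle (G q - q)).trans (mul_le_mul_of_nonneg_left h1 hK0.le)
      linarith
  obtain ⟨p, hp⟩ := hstab
  refine ⟨D.symm p, hp.of_semiconj D.symm.toHomeomorph fun y => ?_⟩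
  simp

/-! ### The contracting left branch, for negative parameters. -/

section StableBranch

variable {n : ℕ}

/-- The diagonal map with entries `1, 2, …, 2 ^ (n - 1)`. -/
noncomputable def dyadicWeight (n : ℕ) :
    EuclideanSpace ℝ (Fin n) ≃L[ℝ] EuclideanSpace ℝ (Fin n) :=
  LinearEquiv.toContinuousLinearEquiv
    { toFun := fun v => WithLp.toLp 2 fun l => 2 ^ (l : ℕ) * v l
      invFun := fun v => WithLp.toLp 2 fun l => (2 ^ (l : ℕ))⁻¹ * v l
      map_add' := fun u v => by
        ext l
        simp [mul_add]
      map_smul' := fun t v => by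
        ext l
        simp only [PiLp.smul_apply, smul_eq_mul, RingHom.id_apply]
        ring
      left_inv := fun v => by
        ext l
        simp
      right_inv := fun v => by
        ext l
        simp }

theorem dyadicWeight_apply (v : EuclideanSpace ℝ (Fin n)) (l : Fin n) :
    dyadicWeight n v l = 2 ^ (l : ℕ) * v l := rfl

/-- The weights double with each index, and the wrap-around entry is `2 ^ (n - 1) * 2⁻ⁿ = 1 / 2`;
after conjugation the linear part is half a cyclic permutation. -/
theorem dyadicWeight_linPart_apply [NeZero n] (A : ℝ) (v : EuclideanSpace ℝ (Fin n)) (l : Fin n) :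
    dyadicWeight n (companionCLM (tentParam n ((1 / 2) ^ n) A false) v) l =
      1 / 2 * dyadicWeight n v (resid n (l + 1)) := by
  simp only [dyadicWeight_apply, linPart_apply]
  split_ifs with h
  · have h1 : resid n ((l : ℕ) + 1) = ⟨l + 1, h⟩ := Fin.ext (Nat.mod_eq_of_lt h)
    rw [h1]
    simp only [pow_succ]
    ring
  · have hl : (l : ℕ) + 1 = n := by
      have := l.2
      omega
    have h1 : resid n ((l : ℕ) + 1) = 0 := Fin.ext (by simp [resid, hl])
    rw [h1]
    simp only [tentSlope, cond_false, Fin.coe_ofNat_eq_mod, Nat.zero_mod, pow_zero, one_mul]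
    have h2 : (2 : ℝ) ^ (l : ℕ) * (1 / 2) ^ n = 1 / 2 := by
      have h3 : ((1 : ℝ) / 2) ^ n = (1 / 2) ^ ((l : ℕ) + 1) := congrArg (((1 : ℝ) / 2) ^ ·) hl.symm
      rw [h3, pow_succ, ← mul_assoc, ← mul_pow]
      norm_num
    rw [← mul_assoc, h2]

theorem norm_dyadicWeight_linPart [NeZero n] (A : ℝ) (v : EuclideanSpace ℝ (Fin n)) :
    ‖dyadicWeight n (companionCLM (tentParam n ((1 / 2) ^ n) A false) v)‖ =
      1 / 2 * ‖dyadicWeight n v‖ := by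
  have hinj : Function.Injective fun l : Fin n => resid n ((l : ℕ) + 1) := by
    intro l l' hll
    have h1 : ((l : ℕ) + 1) % n = ((l' : ℕ) + 1) % n := congrArg Fin.val hll
    have h2 : (l : ℕ) ≡ l' [MOD n] := Nat.ModEq.add_right_cancel' 1 h1
    exact Fin.ext (Nat.ModEq.eq_of_lt_of_lt h2 l.2 l'.2)
  have hbij := Finite.injective_iff_bijective.1 hinj
  have hsq : ‖dyadicWeight n (companionCLM (tentParam n ((1 / 2) ^ n) A false) v)‖ ^ 2 =
      (1 / 2 * ‖dyadicWeight n v‖) ^ 2 := by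
    rw [mul_pow, EuclideanSpace.real_norm_sq_eq, EuclideanSpace.real_norm_sq_eq, Finset.mul_sum]
    simp only [dyadicWeight_linPart_apply, mul_pow]
    exact Function.Bijective.sum_comp hbij fun l => (1 / 2 : ℝ) ^ 2 * (dyadicWeight n v l) ^ 2
  exact (pow_left_inj₀ (norm_nonneg _) (by positivity) two_ne_zero).1 hsq

theorem exists_isAsympStableFixedPt_of_close [NeZero n] (A : ℝ) :
    ∃ δ : ℝ, 0 < δ ∧ ∃ R : ℝ, ∀ G Φ : EuclideanSpace ℝ (Fin n) → EuclideanSpace ℝ (Fin n),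
      (∀ p ∈ Metric.ball (0 : EuclideanSpace ℝ (Fin n)) R, DifferentiableAt ℝ G p ∧
        ‖G p - (companionCLM (tentParam n ((1 / 2) ^ n) A false) p +
          EuclideanSpace.single (lastIdx n) (-1))‖ ≤ δ ∧
        ‖fderiv ℝ G p - companionCLM (tentParam n ((1 / 2) ^ n) A false)‖ ≤ δ) →
      (∀ p, p 0 ≤ 0 → Φ p = G p) → ∃ p, IsAsympStableFixedPt Φ p := by
  have hs1 : ((1 : ℝ) / 2) ^ n < 1 := pow_lt_one₀ (by norm_num) (by norm_num) (NeZero.ne n)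
  obtain ⟨u, hu⟩ : ∃ u : ℝ, u = -(1 / (1 - (1 / 2) ^ n)) := ⟨_, rfl⟩
  have hu0 : u < 0 := by
    have : 0 < 1 / (1 - ((1 : ℝ) / 2) ^ n) := one_div_pos.2 (by linarith)
    linarith
  have hueq : ((1 : ℝ) / 2) ^ n * u + -1 = u := by
    have : (1 : ℝ) - (1 / 2) ^ n ≠ 0 := by linarith
    rw [hu]
    field_simp
    ring
  obtain ⟨q, hq⟩ : ∃ q : EuclideanSpace ℝ (Fin n), ∀ l, q l = u :=
    ⟨WithLp.toLp 2 fun _ => u, fun _ => rfl⟩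
  have hfix : companionCLM (tentParam n ((1 / 2) ^ n) A false) q +
      EuclideanSpace.single (lastIdx n) (-1) = q := by
    ext l
    rw [PiLp.add_apply, linPart_apply]
    split_ifs with h
    · simp [hq, lt_of_add_one_lt h]
    · simpa [hq, eq_lastIdx h, tentSlope] using hueq
  have hH : {p : EuclideanSpace ℝ (Fin n) | p 0 < 0} ∈ 𝓝 q := by
    refine IsOpen.mem_nhds (isOpen_lt (by fun_prop) continuous_const) ?_
    change q 0 < 0
    rwa [hq]
  obtain ⟨δ, hδ, R, hR⟩ := exists_isAsympStableFixedPt_of_close_affine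
    (companionCLM (tentParam n ((1 / 2) ^ n) A false)) (dyadicWeight n)
    (fun v => (norm_dyadicWeight_linPart A v).le) q _ hfix _ hH
  exact ⟨δ, hδ, R, fun G Φ hG hΦ => hR G Φ hG fun p hp => hΦ p (le_of_lt hp)⟩

end StableBranch

/-! ### Rescaling a border-collision map -/

theorem IsHigherOrderTerm.eventually {n : ℕ} {r : ℕ∞}
    {E : EuclideanSpace ℝ (Fin n) × ℝ → EuclideanSpace ℝ (Fin n)} (hE : IsHigherOrderTerm r E)
    {ε : ℝ} (hε : 0 < ε) : ∀ᶠ p in 𝓝 ((0, 0) : EuclideanSpace ℝ (Fin n) × ℝ),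
      ContDiffAt ℝ r (fun x => E (x, p.2)) p.1 ∧ ‖E p‖ ≤ ε * (‖p.1‖ + |p.2|) ∧
      ‖fderiv ℝ (fun x => E (x, p.2)) p.1‖ ≤ ε := by
  have h0 : E (0, 0) = 0 := by
    have := (hE.isLittleO.def one_pos).self_of_nhds
    simpa using this
  -- The little-o condition makes the derivative vanish at the origin; being continuous, it is small
  -- nearby, and so is its restriction to the `x` directions.
  have hd : HasFDerivAt E (0 : EuclideanSpace ℝ (Fin n) × ℝ →L[ℝ] EuclideanSpace ℝ (Fin n))
      (0, 0) := by
    rw [hasFDerivAt_iff_isLittleO, h0]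
    simp only [sub_zero, zero_apply]
    refine hE.isLittleO.trans_isBigO (IsBigO.of_bound 2 (Eventually.of_forall fun p => ?_))
    have h1 := norm_fst_le p
    have h2 := norm_snd_le p
    rw [Real.norm_eq_abs] at h2
    rw [show p - ((0, 0) : EuclideanSpace ℝ (Fin n) × ℝ) = p from sub_zero p, Real.norm_eq_abs,
      abs_of_nonneg (by positivity)]
    linarith
  have hc : ContinuousAt (fderiv ℝ E) (0, 0) :=
    (hE.contDiffAt.fderiv_right (m := 0) (by norm_num)).continuousAt
  have hsmall : ∀ᶠ p in 𝓝 ((0, 0) : EuclideanSpace ℝ (Fin n) × ℝ), ‖fderiv ℝ E p‖ < ε := by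
    refine hc.norm.eventually (gt_mem_nhds ?_)
    change ‖fderiv ℝ E (0, 0)‖ < ε
    rwa [hd.fderiv, norm_zero]
  have hdiff : ∀ᶠ p in 𝓝 ((0, 0) : EuclideanSpace ℝ (Fin n) × ℝ), DifferentiableAt ℝ E p :=
    (hE.contDiffAt.eventually (by simp)).mono fun p hp => hp.differentiableAt one_ne_zero
  filter_upwards [hE.smooth_slice, hE.isLittleO.def hε, hsmall, hdiff] with p h1 h2 h3 h4
  refine ⟨h1, ?_, ?_⟩
  · rwa [Real.norm_eq_abs, abs_of_nonneg (by positivity)] at h2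
  · have h5 : HasFDerivAt (fun x => E (x, p.2)) ((fderiv ℝ E p).comp
        (ContinuousLinearMap.inl ℝ (EuclideanSpace ℝ (Fin n)) ℝ)) p.1 :=
      HasFDerivAt.comp (g := E) p.1 h4.hasFDerivAt (hasFDerivAt_prodMk_left p.1 p.2)
    rw [h5.fderiv]
    refine (ContinuousLinearMap.opNorm_comp_le _ _).trans ?_
    have h6 := ContinuousLinearMap.norm_inl_le_one ℝ (EuclideanSpace ℝ (Fin n)) ℝ
    nlinarith [norm_nonneg (fderiv ℝ E p),
      norm_nonneg (ContinuousLinearMap.inl ℝ (EuclideanSpace ℝ (Fin n)) ℝ)]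

section Rescaling

variable {n : ℕ} [NeZero n]

/-- The vector `(0, 1, …, 1)`. -/
def shiftVec (n : ℕ) [NeZero n] : EuclideanSpace ℝ (Fin n) :=
  WithLp.toLp 2 fun l => if l = 0 then 0 else 1

theorem shiftVec_zero : shiftVec n 0 = 0 := by simp [shiftVec]

/-- Translating by `(0, 1, …, 1)` moves the forcing term from the first coordinate to the last. The
first entry `0` keeps the switching manifold in place. -/
theorem linPart_shiftVec (s A : ℝ) (β : Bool) :
    companionCLM (tentParam n s A β) (shiftVec n) + EuclideanSpace.single (lastIdx n) 1 =
      EuclideanSpace.single 0 1 + shiftVec n := by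
  ext l
  have hr : (EuclideanSpace.single (0 : Fin n) (1 : ℝ) + shiftVec n) l = 1 := by
    by_cases h : l = 0 <;> simp [shiftVec, h]
  rw [hr, PiLp.add_apply, linPart_apply]
  split_ifs with h
  · have h1 : (⟨l + 1, h⟩ : Fin n) ≠ 0 := fun h' => by simpa using congrArg Fin.val h'
    simp [shiftVec, lt_of_add_one_lt h, h1]
  · simp [shiftVec_zero, eq_lastIdx h]

/-- A branch of a border-collision map at the parameter `σ * m`, in the coordinates `y` given by
`x = m • (y - σ • (0, 1, …, 1))`. -/
noncomputable def scaledBranch (c : EuclideanSpace ℝ (Fin n))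
    (E : EuclideanSpace ℝ (Fin n) × ℝ → EuclideanSpace ℝ (Fin n)) (σ m : ℝ)
    (y : EuclideanSpace ℝ (Fin n)) : EuclideanSpace ℝ (Fin n) :=
  companionCLM c (y - σ • shiftVec n) + σ • EuclideanSpace.single 0 1 + σ • shiftVec n +
    m⁻¹ • E (m • (y - σ • shiftVec n), σ * m)

theorem norm_companionCLM_sub_apply (c c₀ v : EuclideanSpace ℝ (Fin n)) :
    ‖companionCLM c v - companionCLM c₀ v‖ ≤ ‖c - c₀‖ * ‖v‖ := by
  have h : companionCLM c v - companionCLM c₀ v = v 0 • (c - c₀) := by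
    ext l
    simp only [PiLp.sub_apply, PiLp.smul_apply, companionCLM_apply, smul_eq_mul]
    ring
  rw [h, norm_smul, mul_comm]
  exact mul_le_mul_of_nonneg_left (PiLp.norm_apply_le v 0) (norm_nonneg _)

/-- Half of `δ` pays for the difference of the columns, half for `m⁻¹ • E (m • z, σ * m)`. The
latter is small in `C¹` because the factors `m⁻¹` and `m` cancel in the derivative. -/
theorem exists_scaledBranch_close {r : ℕ∞} (hr : 1 ≤ r)
    {E : EuclideanSpace ℝ (Fin n) × ℝ → EuclideanSpace ℝ (Fin n)} (hE : IsHigherOrderTerm r E)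
    {s A δ R : ℝ} {β : Bool} (hδ : 0 < δ) (hR : 0 < R) {c : EuclideanSpace ℝ (Fin n)}
    (hc : ‖c - tentParam n s A β‖ * (R + ‖shiftVec n‖ + 1) ≤ δ / 2) :
    ∃ m₀ : ℝ, 0 < m₀ ∧ ∀ m : ℝ, 0 < m → m < m₀ → ∀ σ : ℝ, |σ| = 1 →
      ∀ y ∈ Metric.ball (0 : EuclideanSpace ℝ (Fin n)) R,
      ContDiffAt ℝ r (scaledBranch c E σ m) y ∧
      ‖scaledBranch c E σ m y - (companionCLM (tentParam n s A β) y +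
        EuclideanSpace.single (lastIdx n) σ)‖ ≤ δ ∧
      ‖fderiv ℝ (scaledBranch c E σ m) y - companionCLM (tentParam n s A β)‖ ≤ δ := by
  set T : ℝ := R + ‖shiftVec n‖ + 1 with hT
  have hT1 : 1 ≤ T := by
    have := norm_nonneg (shiftVec n)
    linarith
  have hε : 0 < δ / (2 * (T + 1)) := by positivity
  obtain ⟨ρ, hρ, hball⟩ := Metric.eventually_nhds_iff_ball.1 (hE.eventually hε)
  refine ⟨ρ / T, by positivity, fun m hm hmρ σ hσ y hy => ?_⟩
  set z : EuclideanSpace ℝ (Fin n) := y - σ • shiftVec n with hz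
  have hzT : ‖z‖ ≤ T := by
    refine (norm_sub_le _ _).trans ?_
    rw [norm_smul, Real.norm_eq_abs, hσ, one_mul]
    have := mem_ball_zero_iff.1 hy
    linarith
  have hmT : m * T < ρ := by rwa [lt_div_iff₀ (by linarith)] at hmρ
  have hmz : ‖m • z‖ ≤ m * T := by
    rw [norm_smul, Real.norm_eq_abs, abs_of_pos hm]
    exact mul_le_mul_of_nonneg_left hzT hm.le
  have hσm : |σ * m| = m := by rw [abs_mul, hσ, one_mul, abs_of_pos hm]
  obtain ⟨h1, h2, h3⟩ := hball (m • z, σ * m) (by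
    rw [Metric.mem_ball, dist_eq_norm, show ((m • z, σ * m) : EuclideanSpace ℝ (Fin n) × ℝ) -
      (0, 0) = (m • z, σ * m) from sub_zero _, Prod.norm_def]
    refine max_lt (hmz.trans_lt hmT) ?_
    change ‖σ * m‖ < ρ
    rw [Real.norm_eq_abs, hσm]
    nlinarith)
  simp only at h1 h2 h3
  have hεδ : δ / (2 * (T + 1)) ≤ δ / 2 :=
    div_le_div_of_nonneg_left hδ.le (by norm_num) (by linarith)
  have hinner : HasFDerivAt (fun y : EuclideanSpace ℝ (Fin n) => m • (y - σ • shiftVec n))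
      (m • ContinuousLinearMap.id ℝ (EuclideanSpace ℝ (Fin n))) y :=
    ((hasFDerivAt_id y).sub_const _).const_smul m
  have hEd : HasFDerivAt (fun y => E (m • (y - σ • shiftVec n), σ * m))
      ((fderiv ℝ (fun x => E (x, σ * m)) (m • z)).comp
        (m • ContinuousLinearMap.id ℝ (EuclideanSpace ℝ (Fin n)))) y :=
    HasFDerivAt.comp (g := fun x => E (x, σ * m)) y
      (h1.differentiableAt (enat_cast_ne_zero hr)).hasFDerivAt hinner
  have hfd : HasFDerivAt (scaledBranch c E σ m)
      (companionCLM c + fderiv ℝ (fun x => E (x, σ * m)) (m • z)) y := by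
    have hlin : HasFDerivAt (fun y => companionCLM c (y - σ • shiftVec n)) (companionCLM c) y :=
      (companionCLM c).hasFDerivAt.comp y ((hasFDerivAt_id y).sub_const _)
    have h4 := ((hlin.add_const (σ • EuclideanSpace.single (0 : Fin n) (1 : ℝ))).add_const
      (σ • shiftVec n)).add (hEd.const_smul m⁻¹)
    refine h4.congr_fderiv ?_
    ext v : 1
    simp [smul_smul, hm.ne']
  have hcR : ‖c - tentParam n s A β‖ ≤ δ / 2 :=
    (le_mul_of_one_le_right (norm_nonneg _) hT1).trans hc
  refine ⟨?_, ?_, ?_⟩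
  · have h5 : ContDiffAt ℝ r (fun y => E (m • (y - σ • shiftVec n), σ * m)) y :=
      ContDiffAt.comp (g := fun x => E (x, σ * m)) y h1
        ((contDiffAt_id.sub contDiffAt_const).const_smul m)
    exact ((((companionCLM c).contDiff.contDiffAt.comp y
      (contDiffAt_id.sub contDiffAt_const)).add contDiffAt_const).add contDiffAt_const).add
      (h5.const_smul m⁻¹)
  · have hkey : scaledBranch c E σ m y - (companionCLM (tentParam n s A β) y +
        EuclideanSpace.single (lastIdx n) σ) =
        (companionCLM c z - companionCLM (tentParam n s A β) z) +
          m⁻¹ • E (m • z, σ * m) := by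
      have h6 : EuclideanSpace.single (lastIdx n) σ =
          σ • EuclideanSpace.single (lastIdx n) (1 : ℝ) := by
        ext l
        simp
      have h7 : EuclideanSpace.single (lastIdx n) (1 : ℝ) = EuclideanSpace.single 0 1 +
          shiftVec n - companionCLM (tentParam n s A β) (shiftVec n) :=
        eq_sub_of_add_eq' (linPart_shiftVec s A β)
      rw [scaledBranch, h6, h7, hz, map_sub (companionCLM (tentParam n s A β)), map_smul,
        smul_sub σ (EuclideanSpace.single 0 1 + shiftVec n), smul_add σ]
      abel
    rw [hkey]
    refine (norm_add_le _ _).trans ?_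
    have h8 := (norm_companionCLM_sub_apply c (tentParam n s A β) z).trans
      ((mul_le_mul_of_nonneg_left hzT (norm_nonneg _)).trans hc)
    have h9 : ‖m⁻¹ • E (m • z, σ * m)‖ ≤ δ / 2 := by
      rw [norm_smul, norm_inv, Real.norm_eq_abs, abs_of_pos hm, inv_mul_le_iff₀ hm]
      refine h2.trans ?_
      rw [hσm]
      calc δ / (2 * (T + 1)) * (‖m • z‖ + m) ≤ δ / (2 * (T + 1)) * (m * T + m) :=
            mul_le_mul_of_nonneg_left (by linarith) hε.le
        _ = m * (δ / 2) := by field_simp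
    linarith
  · rw [hfd.fderiv, add_sub_right_comm]
    refine (norm_add_le _ _).trans ?_
    have h8 : ‖companionCLM c - companionCLM (tentParam n s A β)‖ ≤ ‖c - tentParam n s A β‖ :=
      ContinuousLinearMap.opNorm_le_bound _ (norm_nonneg _) fun v =>
        norm_companionCLM_sub_apply c _ v
    linarith

/-- The change of coordinates that puts a border-collision map into rescaled form. -/
noncomputable def borderScaling (n : ℕ) [NeZero n] (σ m : ℝ) (hm : m ≠ 0) :
    EuclideanSpace ℝ (Fin n) ≃ₜ EuclideanSpace ℝ (Fin n) :=
  scaling (-(m • σ • shiftVec n)) m hm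

theorem borderScaling_apply (σ m : ℝ) (hm : m ≠ 0) (y : EuclideanSpace ℝ (Fin n)) :
    borderScaling n σ m hm y = m • (y - σ • shiftVec n) := by
  rw [borderScaling, scaling_apply, smul_sub]
  abel

theorem borderScaling_apply_zero (σ m : ℝ) (hm : m ≠ 0) (y : EuclideanSpace ℝ (Fin n)) :
    borderScaling n σ m hm y 0 = m * y 0 := by
  rw [borderScaling_apply]
  simp [shiftVec_zero]

theorem borderScaling_symm_bcPiece (c : EuclideanSpace ℝ (Fin n))
    (E : EuclideanSpace ℝ (Fin n) × ℝ → EuclideanSpace ℝ (Fin n)) (σ m : ℝ) (hm : m ≠ 0)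
    (y : EuclideanSpace ℝ (Fin n)) :
    (borderScaling n σ m hm).symm (bcPiece c E (borderScaling n σ m hm y) (σ * m)) =
      scaledBranch c E σ m y := by
  rw [Homeomorph.symm_apply_eq, borderScaling_apply, borderScaling_apply, scaledBranch, bcPiece]
  have h : Matrix.toEuclideanLin (companion c) (m • (y - σ • shiftVec n)) =
      m • companionCLM c (y - σ • shiftVec n) := map_smul (companionCLM c) m _
  have h2 : (σ * m) • EuclideanSpace.single (0 : Fin n) (1 : ℝ) =
      m • σ • EuclideanSpace.single (0 : Fin n) (1 : ℝ) := by
    rw [smul_smul, mul_comm]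
  rw [h, h2, add_sub_right_comm, add_sub_cancel_right, smul_add, smul_add, smul_smul m m⁻¹,
    mul_inv_cancel₀ hm, one_smul]

end Rescaling

/-! ### Assembly for border-collision maps. -/

theorem theorem2p2 (k n : ℕ) [NeZero n] (hk : 2 ≤ k) (hn : 2 ≤ n)
    (a : ℕ) (ha : IsGreatest {d : ℕ | d ∣ n ∧ Nat.Coprime d k} a) :
    ∃ N : ℕ,
      (N : ℚ) = 1 / ((k : ℚ) * n) * ∑ d ∈ a.divisors, (Nat.totient d : ℚ) * (k : ℚ) ^ (n / d) ∧
      ∃ U : Set (EuclideanSpace ℝ (Fin n) × EuclideanSpace ℝ (Fin n)),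
        IsOpen U ∧ U.Nonempty ∧
        ∀ r : ℕ∞, 1 ≤ r →
        ∀ cL cR : EuclideanSpace ℝ (Fin n), (cL, cR) ∈ U →
        ∀ f : EuclideanSpace ℝ (Fin n) → ℝ → EuclideanSpace ℝ (Fin n),
          IsBorderCollisionMap r cL cR f →
          ∃ μ₀ : ℝ, 0 < μ₀ ∧
            (∀ μ ∈ Set.Ioo (-μ₀) 0, ∃ p, IsAsympStableFixedPt (fun x => f x μ) p) ∧
            (∀ μ ∈ Set.Ioo 0 μ₀, ∃ Ω : Fin N → Set (EuclideanSpace ℝ (Fin n)),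
              (Pairwise fun i j => Disjoint (Ω i) (Ω j)) ∧
              ∀ i, (Ω i).Nonempty ∧ IsTrappingRegion (fun x => f x μ) (Ω i) ∧
                IsPiecewiseCrExpanding r ((fun x => f x μ)^[k * n]) (Ω i)) := by
  have : NeZero k := ⟨by omega⟩
  obtain ⟨N, hN, orb, hsurj, horb⟩ := exists_orbit_labelling_cycShift (k := k) (n := n) a ha
  refine ⟨N, hN, ?_⟩
  -- This value suits the dyadic weights when `μ < 0`, and `n ≥ 2` gives the bound `1 / 4` needed
  -- for the tent cycle.
  obtain ⟨s, hs⟩ : ∃ s : ℝ, s = (1 / 2) ^ n := ⟨_, rfl⟩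
  have hs0 : 0 < s := hs ▸ by positivity
  have hs4 : s ≤ 1 / 4 := by
    rw [hs]
    calc ((1 : ℝ) / 2) ^ n ≤ (1 / 2) ^ 2 :=
          pow_le_pow_of_le_one (by norm_num) (by norm_num) hn
      _ = 1 / 4 := by norm_num
  obtain ⟨A, P, η, a', b', c', side, hsA, hC⟩ :=
    exists_isTentCycle k n hk (by omega) s hs0 hs4
  obtain ⟨δ₁, hδ₁, R₁, hΩ⟩ :=
    exists_trapping_regions_of_close k n hC hs0 (by linarith) hsA orb hsurj horb
  obtain ⟨δ₂, hδ₂, R₂, hstab⟩ := exists_isAsympStableFixedPt_of_close (n := n) A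
  rw [← hs] at hstab
  set δ : ℝ := min δ₁ δ₂ with hδdef
  have hδ : 0 < δ := lt_min hδ₁ hδ₂
  set R : ℝ := max 1 (max R₁ R₂) with hRdef
  have hR : 0 < R := lt_max_of_lt_left one_pos
  have hR₁ : R₁ ≤ R := (le_max_left _ _).trans (le_max_right _ _)
  have hR₂ : R₂ ≤ R := (le_max_right _ _).trans (le_max_right _ _)
  set T : ℝ := R + ‖shiftVec n‖ + 1 with hT
  have hT0 : 0 < T := by positivity
  -- Radius of the balls forming `U`, fixed before `r` and `f`; only `μ₀` depends on the map.
  set ρ : ℝ := δ / (2 * T) with hρ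
  have hρ0 : 0 < ρ := by positivity
  have hclose : ∀ c c₀ : EuclideanSpace ℝ (Fin n), c ∈ Metric.ball c₀ ρ →
      ‖c - c₀‖ * T ≤ δ / 2 := by
    intro c c₀ hc
    rw [mem_ball_iff_norm] at hc
    calc ‖c - c₀‖ * T ≤ ρ * T := mul_le_mul_of_nonneg_right hc.le hT0.le
      _ = δ / 2 := by
        rw [hρ]
        field_simp
  refine ⟨Metric.ball (tentParam n s A false) ρ ×ˢ Metric.ball (tentParam n s A true) ρ,
    Metric.isOpen_ball.prod Metric.isOpen_ball,
    ⟨(tentParam n s A false, tentParam n s A true), Metric.mem_ball_self hρ0,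
      Metric.mem_ball_self hρ0⟩, ?_⟩
  rintro r hr cL cR ⟨hcL, hcR⟩ f ⟨EL, ER, hEL, hER, hfL, hfR⟩
  obtain ⟨mL, hmL, hL⟩ := exists_scaledBranch_close hr hEL hδ hR (hclose cL _ hcL)
  obtain ⟨mR, hmR, hRt⟩ := exists_scaledBranch_close hr hER hδ hR (hclose cR _ hcR)
  refine ⟨min mL mR, lt_min hmL hmR, ?_, ?_⟩
  · rintro μ ⟨hμ1, hμ2⟩
    have hm : 0 < -μ := by linarith
    have hmlt : -μ < mL := lt_of_lt_of_le (by linarith) (min_le_left mL mR)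
    -- For `μ < 0` the scale is `-μ` and the sign is `-1`, so that the homothety preserves the two
    -- sides of the switching manifold.
    set e := borderScaling n (-1) (-μ) hm.ne' with he
    have hsemi : Function.Semiconj e (fun y => e.symm (f (e y) μ)) (fun x => f x μ) := fun y => by
      simp
    obtain ⟨p, hp⟩ := hstab (scaledBranch cL EL (-1) (-μ)) (fun y => e.symm (f (e y) μ))
      (fun p hp => by
        obtain ⟨h1, h2, h3⟩ := hL (-μ) hm hmlt (-1) (by simp) p (Metric.ball_subset_ball hR₂ hp)
        exact ⟨h1.differentiableAt (enat_cast_ne_zero hr), h2.trans (min_le_right _ _),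
          h3.trans (min_le_right _ _)⟩)
      (fun p hp => by
        have h0 : e p 0 ≤ 0 := by
          rw [he, borderScaling_apply_zero]
          exact mul_nonpos_of_nonneg_of_nonpos hm.le hp
        have h1 := borderScaling_symm_bcPiece cL EL (-1) (-μ) hm.ne' p
        rw [neg_one_mul, neg_neg] at h1
        rw [hfL _ _ h0, he, h1])
    exact ⟨e p, hp.of_semiconj e hsemi⟩
  · rintro μ ⟨hμ1, hμ2⟩
    have hmlt : μ < mL := hμ2.trans_le (min_le_left mL mR)
    have hmlt' : μ < mR := hμ2.trans_le (min_le_right mL mR)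
    set e := borderScaling n 1 μ hμ1.ne' with he
    have hsemi : Function.Semiconj e (fun y => e.symm (f (e y) μ)) (fun x => f x μ) := fun y => by
      simp
    obtain ⟨Ω, hdisj, hΩ'⟩ := hΩ r hr
      (fun β => bif β then scaledBranch cR ER 1 μ else scaledBranch cL EL 1 μ)
      (fun y => e.symm (f (e y) μ))
      (fun β p hp => by
        have hpR := Metric.ball_subset_ball hR₁ hp
        cases β with
        | false =>
          obtain ⟨h1, h2, h3⟩ := hL μ hμ1 hmlt 1 (by simp) p hpR
          exact ⟨h1, h2.trans (min_le_left _ _), h3.trans (min_le_left _ _)⟩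
        | true =>
          obtain ⟨h1, h2, h3⟩ := hRt μ hμ1 hmlt' 1 (by simp) p hpR
          exact ⟨h1, h2.trans (min_le_left _ _), h3.trans (min_le_left _ _)⟩)
      (fun p hp => by
        have h0 : e p 0 ≤ 0 := by
          rw [he, borderScaling_apply_zero]
          exact mul_nonpos_of_nonneg_of_nonpos hμ1.le hp
        have h1 := borderScaling_symm_bcPiece cL EL 1 μ hμ1.ne' p
        rw [one_mul] at h1
        rw [hfL _ _ h0, he, h1, cond_false])
      (fun p hp => by
        have h0 : 0 ≤ e p 0 := by
          rw [he, borderScaling_apply_zero]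
          exact mul_nonneg hμ1.le hp
        have h1 := borderScaling_symm_bcPiece cR ER 1 μ hμ1.ne' p
        rw [one_mul] at h1
        rw [hfR _ _ h0, he, h1, cond_true])
    refine ⟨fun i => e '' Ω i, fun i j hij => (disjoint_image_iff e.injective).2 (hdisj hij),
      fun i => ?_⟩
    obtain ⟨h1, h2, h3⟩ := hΩ' i
    exact ⟨h1.image e, h2.image e hsemi, h3.image_scaling hr (hsemi.iterate_right (k * n))⟩
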